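/- All manifolds, flows and diffeomorphisms are $C^\infty$; a closed manifold is a compact manifold without boundary; norms of tangent vectors come from Riemannian metrics. Write $\mathbb T^d=\mathbb R^d/\mathbb Z^d$. A diffeomorphism $f$ is Anosov if there are a $Df$-invariant splitting $TN=E^s\oplus E^u$ and constants $C>0$, $\lambda\in(0,1)$ with $\|Df^{k}v\|\le C\lambda^k\|v\|$ for $v\in E^s$ and $\|Df^{-k}v\|\le C\lambda^k\|v\|$ for $v\in E^u$, $k\ge 0$. A flow without rest points is Anosov if its generator $X$ is complemented by an invariant splitting $TM=E^s\oplus\mathbb RX\oplus E^u$ satisfying the analogous estimates for times $t>0$. The suspension flow of a diffeomorphism $f\colon N\to N$ with smooth roof function $r\colon N\to(0,\infty)$ is the flow $(x,s)\mapsto(x,s+t)$ on the mapping torus $N_{f,r}=(N\times\mathbb R)/\big((x,s)\sim(f(x),s-r(x))\big)$ (the case $r\equiv 1$ is the usual suspension of $f$). A flow on $M$ is a suspension of $f$ with roof $r$ if a diffeomorphism $h\colon N_{f,r}\to M$ conjugates the suspension flow to it; then $N$ is regarded as a submanifold of $M$ through $x\mapsto h([x,0])$. **Proposition 2.10.** Let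 $M$ and $E$ be closed manifolds, let $\pi\colon E\to M$ be an affine $\mathbb T^d$-bundle, that is, a smooth locally trivial bundle with fiber $\mathbb T^d$ and structure group $SL(d,\mathbb Z)\ltimes\mathbb T^d$ acting by $z\mapsto Az+v$, and let $\varphi^t\colon M\to M$ be an Anosov flow. Let $\Phi^t\colon E\to E$ be a fiberwise Anosov flow over $\varphi^t$, that is, $\pi\circ\Phi^t=\varphi^t\circ\pi$, and there are a $D\Phi^t$-invariant splitting $\ker D\pi=V^s\oplus V^u$ and constants $C>0$, $\lambda\in(0,1)$ such that, for $t>0$, $\|D\Phi^tv\|\le C\lambda^t\|v\|$ for $v\in V^s$ and $\|D\Phi^{-t}v\|\le C\lambda^t\|v\|$ for $v\in V^u$. Suppose that $\varphi^t$ is a suspension, with roof function $r$, of an Anosov diffeomorphism $f\colon N\to N$ of a closed manifold $N$, and regard $N$ as a submanifold of $M$ as above. Then $\hat N=\pi^{-1}(N)$ is a smooth submanifold of $E$, the restriction $p=\pi|_{\hat N}\colon\hat N\to N$ is an affine $\mathbb T^d$-bundle, and there is an Anosov diffeomorphism $\hat f\colon\hat N\to\hat N$ such that $\Phi^t$ is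 a suspension of $\hat f$ with roof function $r\circ p$, the submanifold corresponding to it being $\hat N\subset E$ itself. In particular, if $r\equiv1$, then $\Phi^t$ is the suspension of $\hat f$ with roof function $1$. -/

import Mathlib

open scoped Manifold ContDiff

noncomputable section

/-! ### Riemannian norms -/

/-- A continuous Riemannian metric on a manifold of dimension `n`.  On a compact manifold any two
such metrics define uniformly equivalent norms, so the notions below do not depend on its choice. -/
abbrev RiemMetric (n : ℕ) (M : Type*) [TopologicalSpace M]
    [ChartedSpace (EuclideanSpace ℝ (Fin n)) M] [IsManifold (𝓡 n) ∞ M] :=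
  Bundle.ContinuousRiemannianMetric (EuclideanSpace ℝ (Fin n))
    (fun x : M => TangentSpace (𝓡 n) x)

/-- The norm of a tangent vector `v` at `x`. -/
def RiemMetric.norm {n : ℕ} {M : Type*} [TopologicalSpace M]
    [ChartedSpace (EuclideanSpace ℝ (Fin n)) M] [IsManifold (𝓡 n) ∞ M]
    (g : RiemMetric n M) {x : M} (v : TangentSpace (𝓡 n) x) : ℝ :=
  Real.sqrt (g.inner x v v)

/-! ### Anosov diffeomorphisms -/

/-- `f : N → N` is an Anosov diffeomorphism: there are a `Df`-invariant splitting
`TN = Eˢ ⊕ Eᵘ`, a Riemannian metric and constants `C > 0`, `lam ∈ (0, 1)` such that `Df^k` contracts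
`Eˢ` by `C * lam ^ k` and `Df^{-k}` contracts `Eᵘ` by `C * lam ^ k`.  (The continuity of the
splitting is a consequence of these conditions when `N` is compact.) -/
def IsAnosovDiffeo {n : ℕ} {N : Type*} [TopologicalSpace N]
    [ChartedSpace (EuclideanSpace ℝ (Fin n)) N] [IsManifold (𝓡 n) ∞ N]
    (f : N ≃ₘ^∞⟮𝓡 n, 𝓡 n⟯ N) : Prop :=
  ∃ (g : RiemMetric n N) (Es Eu : ∀ x : N, Submodule ℝ (TangentSpace (𝓡 n) x)) (C lam : ℝ),
    0 < C ∧ 0 < lam ∧ lam < 1 ∧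
    (∀ x, IsCompl (Es x) (Eu x)) ∧
    (∀ x, (Es x).map (mfderiv (𝓡 n) (𝓡 n) f x).toLinearMap = Es (f x)) ∧
    (∀ x, (Eu x).map (mfderiv (𝓡 n) (𝓡 n) f x).toLinearMap = Eu (f x)) ∧
    (∀ (k : ℕ) (x : N), ∀ v ∈ Es x,
      g.norm (mfderiv (𝓡 n) (𝓡 n) (f^[k]) x v) ≤ C * lam ^ k * g.norm v) ∧
    (∀ (k : ℕ) (x : N), ∀ v ∈ Eu x,
      g.norm (mfderiv (𝓡 n) (𝓡 n) (f.symm^[k]) x v) ≤ C * lam ^ k * g.norm v)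

/-! ### Smooth flows and Anosov flows -/

/-- The flow `φ` is jointly smooth in time and space. -/
def IsSmoothFlow {m : ℕ} {M : Type*} [TopologicalSpace M]
    [ChartedSpace (EuclideanSpace ℝ (Fin m)) M] (φ : Flow ℝ M) : Prop :=
  ContMDiff (𝓘(ℝ, ℝ).prod (𝓡 m)) (𝓡 m) ∞ (fun p : ℝ × M => φ p.1 p.2)

/-- The vector at `x` of the vector field generating the flow `φ`: the velocity at time `0` of
the orbit of `x` (transported along the equality `φ 0 x = x`). -/
def flowGenerator {m : ℕ} {M : Type*} [TopologicalSpace M]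
    [ChartedSpace (EuclideanSpace ℝ (Fin m)) M] (φ : Flow ℝ M) (x : M) :
    TangentSpace (𝓡 m) x :=
  φ.map_zero_apply x ▸
    (mfderiv 𝓘(ℝ, ℝ) (𝓡 m) (fun t : ℝ => φ t x) 0 (1 : ℝ) : TangentSpace (𝓡 m) (φ 0 x))

/-- `φ` is an Anosov flow: it is smooth, without rest points, and there are a `Dφ`-invariant
splitting `TM = Eˢ ⊕ ℝX ⊕ Eᵘ`, where `X` generates the flow, a Riemannian metric and constants
`C > 0`, `lam ∈ (0, 1)` such that for `t > 0` the map `Dφ^t` contracts `Eˢ` by `C * lam ^ t`, and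
`Dφ^{-t}` contracts `Eᵘ` by `C * lam ^ t`. -/
def IsAnosovFlow {m : ℕ} {M : Type*} [TopologicalSpace M]
    [ChartedSpace (EuclideanSpace ℝ (Fin m)) M] [IsManifold (𝓡 m) ∞ M] (φ : Flow ℝ M) : Prop :=
  IsSmoothFlow (m := m) φ ∧
  (∀ x : M, flowGenerator (m := m) φ x ≠ 0) ∧
  ∃ (g : RiemMetric m M) (Es Eu : ∀ x : M, Submodule ℝ (TangentSpace (𝓡 m) x)) (C lam : ℝ),
    0 < C ∧ 0 < lam ∧ lam < 1 ∧
    (∀ x, DirectSum.IsInternal ![Es x, Submodule.span ℝ {flowGenerator φ x}, Eu x]) ∧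
    (∀ (t : ℝ) (x : M), (Es x).map (mfderiv (𝓡 m) (𝓡 m) (φ t) x).toLinearMap = Es (φ t x)) ∧
    (∀ (t : ℝ) (x : M), (Eu x).map (mfderiv (𝓡 m) (𝓡 m) (φ t) x).toLinearMap = Eu (φ t x)) ∧
    (∀ t : ℝ, 0 < t → ∀ (x : M), ∀ v ∈ Es x,
      g.norm (mfderiv (𝓡 m) (𝓡 m) (φ t) x v) ≤ C * lam ^ t * g.norm v) ∧
    (∀ t : ℝ, 0 < t → ∀ (x : M), ∀ v ∈ Eu x,
      g.norm (mfderiv (𝓡 m) (𝓡 m) (φ (-t)) x v) ≤ C * lam ^ t * g.norm v)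

/-! ### Affine torus bundles

The `d`-dimensional torus is `UnitAddTorus (Fin d) = Fin d → ℝ ⧸ ℤ`. -/

/-- The universal covering `ℝ^d → 𝕋^d` of the torus. -/
def toTorus {d : ℕ} (v : EuclideanSpace ℝ (Fin d)) : UnitAddTorus (Fin d) :=
  fun i => (v i : UnitAddCircle)

/-- The affine transformation `z ↦ A z + v` of the torus. -/
def torusAffine {d : ℕ} (A : Matrix.SpecialLinearGroup (Fin d) ℤ) (v z : UnitAddTorus (Fin d)) :
    UnitAddTorus (Fin d) :=
  fun i => (∑ j, A.1 i j • z j) + v i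

/-- A local trivialization `e : π⁻¹(U) ≃ U × 𝕋^d` is a diffeomorphism.  As the smooth structure of
`𝕋^d` is the one for which the covering `ℝ^d → 𝕋^d` is a local diffeomorphism, this means that
`U × ℝ^d → U × 𝕋^d → π⁻¹(U)` is a local diffeomorphism. -/
def IsSmoothTorusTrivialization {m k d : ℕ} {M E : Type*}
    [TopologicalSpace M] [ChartedSpace (EuclideanSpace ℝ (Fin m)) M]
    [TopologicalSpace E] [ChartedSpace (EuclideanSpace ℝ (Fin k)) E] {proj : E → M}
    (e : Bundle.Trivialization (UnitAddTorus (Fin d)) proj) : Prop :=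
  IsLocalDiffeomorphOn ((𝓡 m).prod (𝓡 d)) (𝓡 k) ∞
    (fun p : M × EuclideanSpace ℝ (Fin d) => e.toOpenPartialHomeomorph.symm (p.1, toTorus p.2))
    (e.baseSet ×ˢ Set.univ)

/-- `proj : E → M` is an affine `𝕋^d`-bundle: it is a smooth locally trivial fiber bundle with fiber
`𝕋^d` and structure group `SL(d, ℤ) ⋉ 𝕋^d`.  Thus there is a family of smooth local
trivializations covering `M` any two of which differ by `(x, z) ↦ (x, A(x) z + v(x))`, where `A` and
`v` are continuous functions on the common domain with values in the discrete group `SL(d, ℤ)` (so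
`A` is locally constant) and in `𝕋^d`. -/
def IsAffineTorusBundle {m k : ℕ} {M E : Type*}
    [TopologicalSpace M] [ChartedSpace (EuclideanSpace ℝ (Fin m)) M]
    [TopologicalSpace E] [ChartedSpace (EuclideanSpace ℝ (Fin k)) E]
    (d : ℕ) (proj : E → M) : Prop :=
  ∃ S : Set (Bundle.Trivialization (UnitAddTorus (Fin d)) proj),
    (∀ x : M, ∃ e ∈ S, x ∈ e.baseSet) ∧
    (∀ e ∈ S, IsSmoothTorusTrivialization (m := m) (k := k) e) ∧
    (∀ e ∈ S, ∀ e' ∈ S,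
      ∃ (A : M → Matrix.SpecialLinearGroup (Fin d) ℤ) (v : M → UnitAddTorus (Fin d)),
        (∀ x ∈ e.baseSet ∩ e'.baseSet, ∀ᶠ y in nhds x, A y = A x) ∧
        ContinuousOn v (e.baseSet ∩ e'.baseSet) ∧
        ∀ x ∈ e.baseSet ∩ e'.baseSet, ∀ z : UnitAddTorus (Fin d),
          e' (e.toOpenPartialHomeomorph.symm (x, z)) = (x, torusAffine (A x) (v x) z))

/-! ### Fiberwise Anosov flows -/

/-- `Φ` is a (smooth) fiberwise Anosov flow over `φ`, with respect to `proj : E → M`: it fibers over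
`φ`, and the vertical bundle `VE = ker (D proj)` has a `DΦ`-invariant splitting `VE = Vˢ ⊕ Vᵘ` for which
`DΦ^t` contracts `Vˢ` and `DΦ^{-t}` contracts `Vᵘ` by `C * lam ^ t`, `t > 0`. -/
def IsFiberwiseAnosovFlow {m k : ℕ} {M E : Type*}
    [TopologicalSpace M] [ChartedSpace (EuclideanSpace ℝ (Fin m)) M]
    [TopologicalSpace E] [ChartedSpace (EuclideanSpace ℝ (Fin k)) E] [IsManifold (𝓡 k) ∞ E]
    (proj : E → M) (φ : Flow ℝ M) (Φ : Flow ℝ E) : Prop :=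
  IsSmoothFlow (m := k) Φ ∧
  (∀ (t : ℝ) (e : E), proj (Φ t e) = φ t (proj e)) ∧
  ∃ (g : RiemMetric k E) (Vs Vu : ∀ e : E, Submodule ℝ (TangentSpace (𝓡 k) e)) (C lam : ℝ),
    0 < C ∧ 0 < lam ∧ lam < 1 ∧
    (∀ e, Disjoint (Vs e) (Vu e)) ∧
    (∀ e, Vs e ⊔ Vu e = LinearMap.ker (mfderiv (𝓡 k) (𝓡 m) proj e).toLinearMap) ∧
    (∀ (t : ℝ) (e : E), (Vs e).map (mfderiv (𝓡 k) (𝓡 k) (Φ t) e).toLinearMap = Vs (Φ t e)) ∧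
    (∀ (t : ℝ) (e : E), (Vu e).map (mfderiv (𝓡 k) (𝓡 k) (Φ t) e).toLinearMap = Vu (Φ t e)) ∧
    (∀ t : ℝ, 0 < t → ∀ (e : E), ∀ v ∈ Vs e,
      g.norm (mfderiv (𝓡 k) (𝓡 k) (Φ t) e v) ≤ C * lam ^ t * g.norm v) ∧
    (∀ t : ℝ, 0 < t → ∀ (e : E), ∀ v ∈ Vu e,
      g.norm (mfderiv (𝓡 k) (𝓡 k) (Φ (-t)) e v) ≤ C * lam ^ t * g.norm v)

/-! ### Suspensions -/

/-- The generator `(x, s) ↦ (f x, s - r x)` of the deck group `ℤ` of the covering of the mapping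
torus of `f` with roof function `r` by `N × ℝ`; it identifies `(x, r x)` with `(f x, 0)`. -/
def suspensionDeck {N : Type*} (f : N ≃ N) (r : N → ℝ) : Equiv.Perm (N × ℝ) where
  toFun p := (f p.1, p.2 - r p.1)
  invFun p := (f.symm p.1, p.2 + r (f.symm p.1))
  left_inv p := by simp
  right_inv p := by simp

/-- The mapping torus of `f` with roof function `r`: the quotient of `N × ℝ` by the deck group. -/
def MappingTorus {N : Type*} (f : N ≃ N) (r : N → ℝ) : Type _ :=
  Quotient (Equiv.Perm.SameCycle.setoid (suspensionDeck f r))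

/-- The covering map `N × ℝ → MappingTorus f r`. -/
def MappingTorus.mk {N : Type*} (f : N ≃ N) (r : N → ℝ) (p : N × ℝ) : MappingTorus f r :=
  Quotient.mk (Equiv.Perm.SameCycle.setoid (suspensionDeck f r)) p

/-- Translation of the `ℝ`-coordinate of `N × ℝ`. -/
def suspensionTranslate (N : Type*) (t : ℝ) : Equiv.Perm (N × ℝ) where
  toFun p := (p.1, p.2 + t)
  invFun p := (p.1, p.2 - t)
  left_inv p := by simp
  right_inv p := by simp

theorem suspensionTranslate_commute {N : Type*} (f : N ≃ N) (r : N → ℝ) (t : ℝ) :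
    Commute (suspensionTranslate N t) (suspensionDeck f r) := by
  ext p
  · rfl
  · change p.2 - r p.1 + t = p.2 + t - r p.1
    ring

/-- The suspension flow `(x, s) ↦ (x, s + t)` on the mapping torus. -/
def suspensionFlow {N : Type*} (f : N ≃ N) (r : N → ℝ) (t : ℝ) :
    MappingTorus f r → MappingTorus f r :=
  Quotient.map (suspensionTranslate N t) (by
    rintro p _ ⟨k, rfl⟩
    refine ⟨k, ?_⟩
    have h := (suspensionTranslate_commute f r t).zpow_right k
    exact (DFunLike.congr_fun h.eq p).symm)

/-- A presentation of the flow `φ` on `M` as the suspension of the diffeomorphism `f : N → N` with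
the positive smooth roof function `r`: a diffeomorphism from the mapping torus of `f` onto `M`
that takes the suspension flow to `φ`.  The smooth structure of the mapping torus is the one for
which the covering by `N × ℝ` is a local diffeomorphism, so that a bijection from the mapping torus
to `M` is a diffeomorphism if and only if its composition with the covering is a local
diffeomorphism.  The suspension in the narrow sense is the case `r = 1`. -/
structure SuspensionPresentation {n m : ℕ} {N M : Type*}
    [TopologicalSpace N] [ChartedSpace (EuclideanSpace ℝ (Fin n)) N]
    [TopologicalSpace M] [ChartedSpace (EuclideanSpace ℝ (Fin m)) M]
    (φ : Flow ℝ M) (f : N ≃ₘ^∞⟮𝓡 n, 𝓡 n⟯ N) (r : N → ℝ) where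
  roof_smooth : ContMDiff (𝓡 n) 𝓘(ℝ, ℝ) ∞ r
  roof_pos : ∀ x, 0 < r x
  toEquiv : MappingTorus f.toEquiv r ≃ M
  isLocalDiffeomorph : IsLocalDiffeomorph ((𝓡 n).prod 𝓘(ℝ, ℝ)) (𝓡 m) ∞
    (fun p : N × ℝ => toEquiv (MappingTorus.mk f.toEquiv r p))
  map_flow : ∀ (t : ℝ) (q : MappingTorus f.toEquiv r),
    toEquiv (suspensionFlow f.toEquiv r t q) = φ t (toEquiv q)

/-- The inclusion of `N` in `M` as the cross-section `N × {0}` of the flow. -/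
def SuspensionPresentation.crossSection {n m : ℕ} {N M : Type*}
    [TopologicalSpace N] [ChartedSpace (EuclideanSpace ℝ (Fin n)) N]
    [TopologicalSpace M] [ChartedSpace (EuclideanSpace ℝ (Fin m)) M]
    {φ : Flow ℝ M} {f : N ≃ₘ^∞⟮𝓡 n, 𝓡 n⟯ N} {r : N → ℝ}
    (S : SuspensionPresentation (m := m) φ f r) (x : N) : M :=
  S.toEquiv (MappingTorus.mk f.toEquiv r (x, 0))

end

/-! ### Extensions of hyperbolic cocycles -/

/-! Write N̂ = π⁻¹(N). Since Φ covers φ, an orbit of Φ meets N̂ exactly when its projection meets N.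
The return map is therefore f̂(x) = Φ^{r(p x)}(x). It lies over f, and its inverse is obtained by
flowing backwards (`exists_return_map`). The map (x, s) ↦ Φ^s(x) descends to the mapping torus of
f̂, whose deck transformations lie over those of f, so its bijectivity follows from that of the
suspension downstairs (`exists_suspensionPresentation`). Locally its inverse sends e to (Φ^{-τ}(e),
τ), where τ is the time coordinate of π(e) in a suspension chart of M (`exists_flow_section`).
Charts of N together with fibre coordinates make N̂ a submanifold, and restricting the
trivializations makes p an affine bundle.

The substance is that f̂ is Anosov. Vertical vectors are tangent to N̂. On them the derivative of
f̂^l is that of Φ^t with t frozen at the return time, because the return time depends only on the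
base point and so has zero derivative in vertical directions (`mfderiv_val_flow`). The roof is
bounded below by some c > 0, so ker Dp = Vˢ ⊕ Vᵘ is hyperbolic with rate λ^c. Modulo ker Dp the
derivative of f̂ is that of f, which is hyperbolic too.

It remains to prove that an extension of a hyperbolic cocycle by a hyperbolic one is hyperbolic
(`HyperbolicExtension.isHyperbolic`). Its stable space consists of the vectors with bounded forward
orbit. The vertical ones form Vˢ, and all of them project into Eˢ. Conversely, take w in Eˢ and lift
each point of its forward orbit with comparable norm. The lifts form a pseudo-orbit with vertical,
exponentially small errors. Stable parts of the errors die out when pushed forward. Unstable parts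
are pulled back to time 0, where they form a convergent series, and are subtracted from the initial
lift. The corrected vector lies over w and decays exponentially
(`HyperbolicExtension.exists_stable_lift`). Reversing time gives the unstable space. Only
compactness and uniform bounds on norms enter, with no continuity of the splittings. -/

/-- A cocycle `c` over a bijection `F`, together with an equivariant family `P` of surjections onto
a hyperbolic cocycle `b`, such that `c` is hyperbolic on the kernels of `P`. The norms are given by
the families `nu` and `nu'`, and all the bounds are uniform in the base point. -/
structure HyperbolicExtension (I W Q : Type*) [NormedAddCommGroup W] [NormedSpace ℝ W]
    [AddCommGroup Q] [Module ℝ Q] where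
  F : Equiv.Perm I
  c : ℤ → I → W →ₗ[ℝ] W
  b : ℤ → I → Q →ₗ[ℝ] Q
  P : I → W →ₗ[ℝ] Q
  nu : I → Seminorm ℝ W
  nu' : I → Seminorm ℝ Q
  Vs : I → Submodule ℝ W
  Vu : I → Submodule ℝ W
  Es : I → Submodule ℝ Q
  Eu : I → Submodule ℝ Q
  K : ℝ
  C : ℝ
  lam : ℝ
  c_zero : ∀ x v, c 0 x v = v
  c_add : ∀ k l x v, c (k + l) x v = c k ((F ^ l) x) (c l x v)
  P_c : ∀ k x v, P ((F ^ k) x) (c k x v) = b k x (P x v)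
  norm_le : ∀ x, ∃ a, ∀ w, ‖w‖ ≤ a * nu x w
  le_norm : ∀ x, ∃ a, ∀ w, nu x w ≤ a * ‖w‖
  eq_zero : ∀ x w, nu' x w = 0 → w = 0
  one_le_K : 1 ≤ K
  c_le : ∀ x v, nu (F x) (c 1 x v) ≤ K * nu x v
  c_le' : ∀ x v, nu (F⁻¹ x) (c (-1) x v) ≤ K * nu x v
  P_le : ∀ x v, nu' x (P x v) ≤ K * nu x v
  lift : ∀ x w, ∃ v, P x v = w ∧ nu x v ≤ K * nu' x w
  C_pos : 0 < C
  lam_pos : 0 < lam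
  lam_lt : lam < 1
  disj : ∀ x, Disjoint (Vs x) (Vu x)
  sup_eq : ∀ x, Vs x ⊔ Vu x = LinearMap.ker (P x)
  Vs_inv : ∀ k x, ∀ v ∈ Vs x, c k x v ∈ Vs ((F ^ k) x)
  Vu_inv : ∀ k x, ∀ v ∈ Vu x, c k x v ∈ Vu ((F ^ k) x)
  Vs_le : ∀ (k : ℕ) x, ∀ v ∈ Vs x, nu ((F ^ (k : ℤ)) x) (c k x v) ≤ C * lam ^ k * nu x v
  Vu_le : ∀ (k : ℕ) x, ∀ v ∈ Vu x, nu ((F ^ (-k : ℤ)) x) (c (-k) x v) ≤ C * lam ^ k * nu x v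
  isCompl : ∀ x, IsCompl (Es x) (Eu x)
  Es_inv : ∀ k x, ∀ v ∈ Es x, b k x v ∈ Es ((F ^ k) x)
  Eu_inv : ∀ k x, ∀ v ∈ Eu x, b k x v ∈ Eu ((F ^ k) x)
  Es_le : ∀ (k : ℕ) x, ∀ v ∈ Es x, nu' ((F ^ (k : ℤ)) x) (b k x v) ≤ C * lam ^ k * nu' x v
  Eu_le : ∀ (k : ℕ) x, ∀ v ∈ Eu x, nu' ((F ^ (-k : ℤ)) x) (b (-k) x v) ≤ C * lam ^ k * nu' x v

namespace HyperbolicExtension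

variable {I W Q : Type*} [NormedAddCommGroup W] [NormedSpace ℝ W] [AddCommGroup Q] [Module ℝ Q]

/-- The extension with time reversed. -/
def reverse (H : HyperbolicExtension I W Q) : HyperbolicExtension I W Q where
  F := H.F⁻¹
  c k := H.c (-k)
  b k := H.b (-k)
  P := H.P
  nu := H.nu
  nu' := H.nu'
  Vs := H.Vu
  Vu := H.Vs
  Es := H.Eu
  Eu := H.Es
  K := H.K
  C := H.C
  lam := H.lam
  c_zero x v := by simpa using H.c_zero x v
  c_add k l x v := by rw [neg_add, H.c_add, inv_zpow']
  P_c k x v := by rw [inv_zpow']; exact H.P_c _ x v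
  norm_le := H.norm_le
  le_norm := H.le_norm
  eq_zero := H.eq_zero
  one_le_K := H.one_le_K
  c_le := H.c_le'
  c_le' x v := by simpa using H.c_le x v
  P_le := H.P_le
  lift := H.lift
  C_pos := H.C_pos
  lam_pos := H.lam_pos
  lam_lt := H.lam_lt
  disj x := (H.disj x).symm
  sup_eq x := by rw [sup_comm]; exact H.sup_eq x
  Vs_inv k x v hv := by rw [inv_zpow']; exact H.Vu_inv _ x v hv
  Vu_inv k x v hv := by rw [inv_zpow']; exact H.Vs_inv _ x v hv
  Vs_le k x v hv := by rw [inv_zpow']; exact H.Vu_le _ x v hv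
  Vu_le k x v hv := by rw [inv_zpow', neg_neg]; exact H.Vs_le _ x v hv
  isCompl x := (H.isCompl x).symm
  Es_inv k x v hv := by rw [inv_zpow']; exact H.Eu_inv _ x v hv
  Eu_inv k x v hv := by rw [inv_zpow']; exact H.Es_inv _ x v hv
  Es_le k x v hv := by rw [inv_zpow']; exact H.Eu_le _ x v hv
  Eu_le k x v hv := by rw [inv_zpow', neg_neg]; exact H.Es_le _ x v hv

variable (H : HyperbolicExtension I W Q)

lemma F_add (k l : ℤ) (x : I) : (H.F ^ (k + l)) x = (H.F ^ k) ((H.F ^ l) x) := by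
  rw [zpow_add, Equiv.Perm.mul_apply]

lemma c_neg_c (k : ℤ) (x : I) (v : W) : H.c (-k) ((H.F ^ k) x) (H.c k x v) = v := by
  rw [← H.c_add, neg_add_cancel, H.c_zero]

lemma F_neg_F (k : ℤ) (x : I) : (H.F ^ (-k)) ((H.F ^ k) x) = x := by
  rw [← H.F_add, neg_add_cancel, zpow_zero, Equiv.Perm.one_apply]

lemma K_pos : 0 < H.K := zero_lt_one.trans_le H.one_le_K

lemma nu_eq_zero {x : I} {w : W} (h : H.nu x w = 0) : w = 0 := by
  obtain ⟨a, ha⟩ := H.norm_le x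
  have := ha w
  rw [h, mul_zero] at this
  exact norm_le_zero_iff.1 this

/-- The cocycle identities of `b` are not part of the structure: they descend from those of `c`
because every `P x` is onto. -/
lemma b_neg_b (k : ℤ) (x : I) (w : Q) : H.b (-k) ((H.F ^ k) x) (H.b k x w) = w := by
  obtain ⟨v, rfl, -⟩ := H.lift x w
  rw [← H.P_c, ← H.P_c, H.c_neg_c, H.F_neg_F]

lemma b_zero (x : I) (w : Q) : H.b 0 x w = w := by
  obtain ⟨v, rfl, -⟩ := H.lift x w
  rw [← H.P_c, H.c_zero, zpow_zero, Equiv.Perm.one_apply]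

lemma b_add (k l : ℤ) (x : I) (w : Q) : H.b (k + l) x w = H.b k ((H.F ^ l) x) (H.b l x w) := by
  obtain ⟨v, rfl, -⟩ := H.lift x w
  rw [← H.P_c, H.c_add, H.F_add, H.P_c k, H.P_c l]

lemma nu_c_le (k : ℕ) (x : I) (v : W) :
    H.nu ((H.F ^ (k : ℤ)) x) (H.c k x v) ≤ H.K ^ k * H.nu x v := by
  induction k with
  | zero => simp [H.c_zero]
  | succ k ih =>
    have h1 : ((k + 1 : ℕ) : ℤ) = 1 + (k : ℤ) := by push_cast; ring
    rw [h1, H.F_add, H.c_add, zpow_one]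
    refine (H.c_le _ _).trans ?_
    rw [pow_succ', mul_assoc]
    exact mul_le_mul_of_nonneg_left ih H.K_pos.le

/-- Vectors of `Vu` are expanded in the future. -/
lemma nu_le_of_mem_Vu (k : ℕ) {x : I} {v : W} (hv : v ∈ H.Vu x) :
    H.nu x v ≤ H.C * H.lam ^ k * H.nu ((H.F ^ (k : ℤ)) x) (H.c k x v) := by
  have := H.Vu_le k _ _ (H.Vu_inv k x v hv)
  rwa [H.c_neg_c, H.F_neg_F] at this

lemma nu'_le_of_mem_Eu (k : ℕ) {x : I} {v : Q} (hv : v ∈ H.Eu x) :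
    H.nu' x v ≤ H.C * H.lam ^ k * H.nu' ((H.F ^ (k : ℤ)) x) (H.b k x v) := by
  have := H.Eu_le k _ _ (H.Eu_inv k x v hv)
  rwa [H.b_neg_b, H.F_neg_F] at this

lemma lam_pow_le_one (k : ℕ) : H.lam ^ k ≤ 1 := pow_le_one₀ H.lam_pos.le H.lam_lt.le

lemma tendsto_C_lam (B : ℝ) :
    Filter.Tendsto (fun k : ℕ => H.C * H.lam ^ k * B) Filter.atTop (nhds 0) := by
  have := ((tendsto_pow_atTop_nhds_zero_of_lt_one H.lam_pos.le H.lam_lt).const_mul H.C).mul_const B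
  simpa using this

/-- The angle between `Vs` and `Vu` is uniformly bounded away from zero. -/
lemma exists_angle_bound : ∃ a : ℝ, 0 < a ∧ ∀ x, ∀ s ∈ H.Vs x, ∀ u ∈ H.Vu x,
    H.nu x s ≤ a * H.nu x (s + u) ∧ H.nu x u ≤ a * H.nu x (s + u) := by
  -- In `k` steps `Vu` at least doubles and `Vs` at least halves. If `s + u` were tiny compared with
  -- `u`, its image would have to grow by more than `K ^ k`.
  obtain ⟨k, hk⟩ := ((H.tendsto_C_lam 1).eventually (gt_mem_nhds (show (0 : ℝ) < 1 / 2 by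
    norm_num))).exists
  rw [mul_one] at hk
  have hKk : 0 < H.K ^ k := pow_pos H.K_pos k
  refine ⟨H.K ^ k + 2, by positivity, fun x s hs u hu => ?_⟩
  set q := H.C * H.lam ^ k
  have hq : 0 < q := mul_pos H.C_pos (pow_pos H.lam_pos k)
  have h1 := H.nu_le_of_mem_Vu k hu
  have h2 := H.Vs_le k x s hs
  have h3 := H.nu_c_le k x (s + u)
  have h4 : H.nu ((H.F ^ (k : ℤ)) x) (H.c k x u) ≤
      H.nu ((H.F ^ (k : ℤ)) x) (H.c k x (s + u)) + H.nu ((H.F ^ (k : ℤ)) x) (H.c k x s) := by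
    have := map_sub_le_add (H.nu ((H.F ^ (k : ℤ)) x)) (H.c k x (s + u)) (H.c k x s)
    rwa [← map_sub, add_sub_cancel_left] at this
  have h5 : H.nu x s ≤ H.nu x (s + u) + H.nu x u := by
    have := map_sub_le_add (H.nu x) (s + u) u
    rwa [add_sub_cancel_right] at this
  have hN := apply_nonneg (H.nu x) (s + u)
  have hS := apply_nonneg (H.nu x) s
  have hU := apply_nonneg (H.nu x) u
  have h6 : H.nu x u ≤ 1 / 2 * (H.K ^ k * H.nu x (s + u) + 1 / 2 * H.nu x s) := by
    refine h1.trans (mul_le_mul hk.le (h4.trans (add_le_add h3 (h2.trans ?_))) (apply_nonneg _ _)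
      (by norm_num))
    exact mul_le_mul_of_nonneg_right hk.le hS
  have h7 : 0 ≤ H.K ^ k * H.nu x (s + u) := by positivity
  constructor <;> linarith

/-- The vectors whose forward orbit is bounded. -/
def stable (x : I) : Submodule ℝ W where
  carrier := {v | ∃ B, ∀ k : ℕ, H.nu ((H.F ^ (k : ℤ)) x) (H.c k x v) ≤ B}
  add_mem' := by
    rintro v w ⟨B, hB⟩ ⟨B', hB'⟩
    refine ⟨B + B', fun k => ?_⟩
    rw [map_add]
    exact (map_add_le_add _ _ _).trans (add_le_add (hB k) (hB' k))
  zero_mem' := ⟨0, fun k => by simp⟩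
  smul_mem' := by
    rintro a v ⟨B, hB⟩
    refine ⟨‖a‖ * B, fun k => ?_⟩
    rw [map_smul, map_smul_eq_mul]
    exact mul_le_mul_of_nonneg_left (hB k) (norm_nonneg a)

lemma c_mem_stable {x : I} {v : W} (hv : v ∈ H.stable x) : H.c 1 x v ∈ H.stable (H.F x) := by
  obtain ⟨B, hB⟩ := hv
  refine ⟨B, fun k => ?_⟩
  have := hB (k + 1)
  push_cast at this
  rwa [H.F_add, H.c_add, zpow_one] at this

/-- Stepping back only prepends one term to the forward orbit, so boundedness survives with a
maximum as the new bound. -/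
lemma c_neg_mem_stable {x : I} {v : W} (hv : v ∈ H.stable x) :
    H.c (-1) x v ∈ H.stable (H.F⁻¹ x) := by
  obtain ⟨B, hB⟩ := hv
  refine ⟨max B (H.nu (H.F⁻¹ x) (H.c (-1) x v)), fun k => ?_⟩
  rcases k with _ | k
  · simp [H.c_zero]
  · refine le_max_of_le_left ?_
    have h := hB k
    have h1 : ((k + 1 : ℕ) : ℤ) = (k : ℤ) + 1 := by push_cast; ring
    have h2 : H.F⁻¹ x = (H.F ^ (-1 : ℤ)) x := by simp
    rw [h2, ← H.c_add, ← H.F_add, h1, add_neg_cancel_right]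
    exact h

lemma Vs_le_stable (x : I) : H.Vs x ≤ H.stable x := fun v hv =>
  ⟨H.C * H.nu x v, fun k => (H.Vs_le k x v hv).trans
    (mul_le_mul_of_nonneg_right (mul_le_of_le_one_right H.C_pos.le (H.lam_pow_le_one k))
      (apply_nonneg _ _))⟩

/-- The `Vu`-component of such a vector again has a bounded forward orbit, while `Vu` is
exponentially expanded; hence that component vanishes. -/
lemma mem_Vs_of_mem_stable {x : I} {v : W} (hv : v ∈ H.stable x) (h : H.P x v = 0) :
    v ∈ H.Vs x := by
  have hk : v ∈ H.Vs x ⊔ H.Vu x := by rw [H.sup_eq]; exact h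
  obtain ⟨s, hs, u, hu, rfl⟩ := Submodule.mem_sup.1 hk
  obtain ⟨B, hB⟩ := (Submodule.add_mem_iff_right _ (H.Vs_le_stable x hs)).1 hv
  have : H.nu x u ≤ 0 := ge_of_tendsto' (H.tendsto_C_lam B) fun k =>
    (H.nu_le_of_mem_Vu k hu).trans (mul_le_mul_of_nonneg_left (hB k)
      (mul_pos H.C_pos (pow_pos H.lam_pos k)).le)
  rw [H.nu_eq_zero (le_antisymm this (apply_nonneg _ _)), add_zero]
  exact hs

/-- Bounded orbits project to bounded orbits. The `Eu`-component of the projection is then bounded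
in the future although `Eu` is expanded, so it is zero. -/
lemma P_mem_Es_of_mem_stable {x : I} {v : W} (hv : v ∈ H.stable x) : H.P x v ∈ H.Es x := by
  obtain ⟨B, hB⟩ := hv
  have hk : H.P x v ∈ H.Es x ⊔ H.Eu x := by rw [(H.isCompl x).sup_eq_top]; trivial
  obtain ⟨s, hs, u, hu, hsu⟩ := Submodule.mem_sup.1 hk
  have h0 : ∀ k : ℕ, H.nu' x u ≤ H.C * H.lam ^ k * (H.K * B + H.C * H.nu' x s) := fun k => by
    refine (H.nu'_le_of_mem_Eu k hu).trans (mul_le_mul_of_nonneg_left ?_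
      (mul_pos H.C_pos (pow_pos H.lam_pos k)).le)
    have h1 : H.b k x u = H.P ((H.F ^ (k : ℤ)) x) (H.c k x v) - H.b k x s := by
      rw [H.P_c, ← hsu, map_add, add_sub_cancel_left]
    rw [h1]
    refine (map_sub_le_add _ _ _).trans (add_le_add ((H.P_le _ _).trans
      (mul_le_mul_of_nonneg_left (hB k) H.K_pos.le)) ((H.Es_le k x s hs).trans ?_))
    exact mul_le_mul_of_nonneg_right (mul_le_of_le_one_right H.C_pos.le (H.lam_pow_le_one k))
      (apply_nonneg _ _)
  have : H.nu' x u ≤ 0 := ge_of_tendsto' (H.tendsto_C_lam _) h0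
  rw [← hsu, H.eq_zero x u (le_antisymm this (apply_nonneg _ _)), add_zero]
  exact hs

end HyperbolicExtension

/-- The seminorm is equivalent to the norm of a complete space: one inequality gives summability,
the other the continuity of `q` needed to pass to the limit. The final bound involves neither
comparison constant, so it stays uniform when these vary with the base point. -/
lemma Seminorm.tsum_le_of_le_geometric {W : Type*} [NormedAddCommGroup W] [NormedSpace ℝ W]
    [CompleteSpace W] (q : Seminorm ℝ W) {a a' B t : ℝ} (ha : ∀ w, ‖w‖ ≤ a * q w)
    (ha' : ∀ w, q w ≤ a' * ‖w‖) (ht : 0 ≤ t) (ht' : t < 1) {z : ℕ → W}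
    (hz : ∀ j, q (z j) ≤ B * t ^ j) :
    Summable z ∧ q (∑' j, z j) ≤ B * (1 - t)⁻¹ := by
  have hgeo := (hasSum_geometric_of_lt_one ht ht').mul_left B
  have hB : 0 ≤ B := by simpa using (apply_nonneg q _).trans (hz 0)
  have hsum : Summable z := by
    refine Summable.of_norm_bounded (g := fun j => |a| * (B * t ^ j)) (hgeo.summable.mul_left _) ?_
    exact fun j => (ha _).trans (mul_le_mul (le_abs_self a) (hz j) (apply_nonneg _ _)
      (abs_nonneg a))
  refine ⟨hsum, ?_⟩
  have hq : Continuous q := by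
    refine q.continuous_of_continuousAt_zero ?_
    rw [ContinuousAt, map_zero]
    refine squeeze_zero (fun w => apply_nonneg q w) ha' ?_
    have : Filter.Tendsto (fun w : W => a' * ‖w‖) (nhds 0) (nhds (a' * ‖(0 : W)‖)) :=
      (continuous_const.mul continuous_norm).tendsto 0
    simpa using this
  refine le_of_tendsto ((hq.tendsto _).comp hsum.hasSum.tendsto_sum_nat)
    (Filter.Eventually.of_forall fun n => ?_)
  calc q (∑ i ∈ Finset.range n, z i) ≤ ∑ i ∈ Finset.range n, q (z i) :=
        Finset.le_sum_of_subadditive q (map_zero q).le (map_add_le_add q) _ _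
    _ ≤ ∑ i ∈ Finset.range n, B * t ^ i := Finset.sum_le_sum fun i _ => hz i
    _ ≤ _ := sum_le_hasSum _ (fun i _ => by positivity) hgeo


/-! ### Decaying lifts and the hyperbolic splitting of the total cocycle -/

namespace HyperbolicExtension

variable {I W Q : Type*} [NormedAddCommGroup W] [NormedSpace ℝ W] [AddCommGroup Q] [Module ℝ Q]
  (H : HyperbolicExtension I W Q)

/-- Variation of constants: the forward orbit of `l 0` expressed by a pseudo-orbit `l`. -/
lemma c_apply_pseudo_orbit (x : I) (l : ℕ → W) (k : ℕ) :
    H.c k x (l 0) = l k + ∑ j ∈ Finset.range k, H.c ((k - 1 - j : ℕ) : ℤ)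
      ((H.F ^ ((j + 1 : ℕ) : ℤ)) x) (H.c 1 ((H.F ^ (j : ℤ)) x) (l j) - l (j + 1)) := by
  induction k with
  | zero => simp [H.c_zero]
  | succ k ih =>
    have h1 : ((k + 1 : ℕ) : ℤ) = 1 + (k : ℤ) := by push_cast; ring
    rw [h1, H.c_add, ih, map_add, map_sum, Finset.sum_range_succ]
    have h2 : ∀ j ∈ Finset.range k, H.c 1 ((H.F ^ (k : ℤ)) x) (H.c ((k - 1 - j : ℕ) : ℤ)
        ((H.F ^ ((j + 1 : ℕ) : ℤ)) x) (H.c 1 ((H.F ^ (j : ℤ)) x) (l j) - l (j + 1))) =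
        H.c ((k + 1 - 1 - j : ℕ) : ℤ)
        ((H.F ^ ((j + 1 : ℕ) : ℤ)) x) (H.c 1 ((H.F ^ (j : ℤ)) x) (l j) - l (j + 1)) := by
      intro j hj
      have hj' := Finset.mem_range.1 hj
      have e1 : ((k + 1 - 1 - j : ℕ) : ℤ) = 1 + ((k - 1 - j : ℕ) : ℤ) := by omega
      have e2 : (k : ℤ) = ((k - 1 - j : ℕ) : ℤ) + ((j + 1 : ℕ) : ℤ) := by omega
      rw [e1, H.c_add, ← H.F_add, ← e2]
    rw [Finset.sum_congr rfl h2, Nat.add_sub_cancel, Nat.sub_self, Nat.cast_zero, H.c_zero]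
    abel

variable [FiniteDimensional ℝ W]

/-- Every vector of `Es` has a lift whose forward orbit decays exponentially. -/
lemma exists_stable_lift : ∃ C' μ : ℝ, 0 < C' ∧ 0 < μ ∧ μ < 1 ∧ H.lam ≤ μ ∧
    ∀ x, ∀ w ∈ H.Es x, ∃ v, H.P x v = w ∧
      ∀ k : ℕ, H.nu ((H.F ^ (k : ℤ)) x) (H.c k x v) ≤ C' * μ ^ k * H.nu' x w := by
  obtain ⟨a, ha, hangle⟩ := H.exists_angle_bound
  have hlam := H.lam_pos
  have hlam' := H.lam_lt
  have hK := H.K_pos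
  have hC := H.C_pos
  -- Any rate strictly between `lam` and 1 would do. Strictness is needed for the convolution of two
  -- geometric sequences below.
  set μ : ℝ := (1 + H.lam) / 2 with hμ
  have hμ0 : 0 < μ := by positivity
  have hμ1 : μ < 1 := by rw [hμ]; linarith
  have hlμ : H.lam < μ := by rw [hμ]; linarith
  -- The two terms bound the two parts of an error: the image of the lift at time `j`, and the lift
  -- at time `j + 1`.
  set D : ℝ := H.K * (H.K * H.C) + H.K * H.C with hD
  have hD0 : 0 < D := by positivity
  have hd1 : 0 < μ - H.lam := sub_pos.2 hlμ
  have hd2 : 0 < 1 - H.lam := sub_pos.2 hlam'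
  -- The three summands account for the chosen lift at time `k`, the stable errors made before time
  -- `k`, and the unstable errors still to come.
  refine ⟨H.K * H.C + H.C * (a * D) * (μ - H.lam)⁻¹ + H.C * (a * D) * (1 - H.lam)⁻¹, μ,
    by positivity, hμ0, hμ1, hlμ.le, fun x w hw => ?_⟩
  set t := H.nu' x w with ht
  have ht0 : 0 ≤ t := apply_nonneg _ _
  choose L hLP hLn using H.lift
  set l : ℕ → W := fun k => L ((H.F ^ (k : ℤ)) x) (H.b k x w) with hl
  have hlP : ∀ k : ℕ, H.P ((H.F ^ (k : ℤ)) x) (l k) = H.b k x w := fun k => hLP _ _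
  have hln : ∀ k : ℕ, H.nu ((H.F ^ (k : ℤ)) x) (l k) ≤ H.K * H.C * μ ^ k * t := fun k => by
    refine (hLn _ _).trans ?_
    rw [mul_assoc, mul_assoc]
    refine mul_le_mul_of_nonneg_left ((H.Es_le k x w hw).trans ?_) hK.le
    rw [mul_assoc]
    gcongr
  have hF1 : ∀ j : ℕ, H.F ((H.F ^ (j : ℤ)) x) = (H.F ^ ((j + 1 : ℕ) : ℤ)) x := fun j => by
    rw [Nat.cast_succ, add_comm, H.F_add, zpow_one]
  set δ : ℕ → W := fun j => H.c 1 ((H.F ^ (j : ℤ)) x) (l j) - l (j + 1) with hδ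
  have hδP : ∀ j : ℕ, H.P ((H.F ^ ((j + 1 : ℕ) : ℤ)) x) (δ j) = 0 := fun j => by
    have h1 := H.P_c 1 ((H.F ^ (j : ℤ)) x) (l j)
    have e1 : ((j + 1 : ℕ) : ℤ) = 1 + (j : ℤ) := by push_cast; ring
    rw [zpow_one, hF1, hlP] at h1
    rw [hδ, map_sub, h1, hlP, e1, H.b_add, sub_self]
  have hδn : ∀ j : ℕ, H.nu ((H.F ^ ((j + 1 : ℕ) : ℤ)) x) (δ j) ≤ D * μ ^ j * t := fun j => by
    refine (map_sub_le_add _ _ _).trans ?_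
    have h1 := H.c_le ((H.F ^ (j : ℤ)) x) (l j)
    rw [hF1] at h1
    have h2 := mul_le_mul_of_nonneg_left (hln j) hK.le
    have h3 : H.K * H.C * μ ^ (j + 1) * t ≤ H.K * H.C * μ ^ j * t := by
      gcongr H.K * H.C * ?_ * t
      exact pow_le_pow_of_le_one hμ0.le hμ1.le (Nat.le_succ j)
    calc _ ≤ H.K * (H.K * H.C * μ ^ j * t) + H.K * H.C * μ ^ j * t :=
          add_le_add (h1.trans h2) ((hln (j + 1)).trans h3)
      _ = _ := by rw [hD]; ring
  -- The errors are vertical because `b` is an exact orbit downstairs; the angle bound then controls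
  -- both components of each.
  have hsplit : ∀ j : ℕ, ∃ s ∈ H.Vs ((H.F ^ ((j + 1 : ℕ) : ℤ)) x),
      ∃ u ∈ H.Vu ((H.F ^ ((j + 1 : ℕ) : ℤ)) x), s + u = δ j := fun j => by
    have : δ j ∈ H.Vs ((H.F ^ ((j + 1 : ℕ) : ℤ)) x) ⊔ H.Vu ((H.F ^ ((j + 1 : ℕ) : ℤ)) x) := by
      rw [H.sup_eq]; exact hδP j
    exact Submodule.mem_sup.1 this
  choose s hs u hu hsu using hsplit
  have hsn : ∀ j : ℕ, H.nu ((H.F ^ ((j + 1 : ℕ) : ℤ)) x) (s j) ≤ a * D * μ ^ j * t := fun j => by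
    refine (hangle _ _ (hs j) _ (hu j)).1.trans ?_
    rw [hsu, mul_assoc, mul_assoc, ← mul_assoc D]
    exact mul_le_mul_of_nonneg_left (hδn j) ha.le
  have hun : ∀ j : ℕ, H.nu ((H.F ^ ((j + 1 : ℕ) : ℤ)) x) (u j) ≤ a * D * μ ^ j * t := fun j => by
    refine (hangle _ _ (hs j) _ (hu j)).2.trans ?_
    rw [hsu, mul_assoc, mul_assoc, ← mul_assoc D]
    exact mul_le_mul_of_nonneg_left (hδn j) ha.le
  -- the unstable errors, transported back to the origin of the orbit
  set y : ℕ → W := fun j => H.c (-((j + 1 : ℕ) : ℤ)) ((H.F ^ ((j + 1 : ℕ) : ℤ)) x) (u j) with hy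
  have hyV : ∀ j, y j ∈ H.Vu x := fun j => by
    have := H.Vu_inv (-((j + 1 : ℕ) : ℤ)) _ _ (hu j)
    rwa [H.F_neg_F] at this
  have hcy : ∀ (k : ℤ) (j : ℕ), H.c k x (y j) =
      H.c (k + -((j + 1 : ℕ) : ℤ)) ((H.F ^ ((j + 1 : ℕ) : ℤ)) x) (u j) := fun k j => by
    rw [H.c_add, H.F_neg_F]
  -- At time `k`, the unstable error number `j + k` has been pulled back only `j + 1` steps from
  -- where it arose. This gives the geometric factor in `j`, while the size of the error supplies
  -- the factor `μ ^ k`.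
  have htail : ∀ k j : ℕ, H.nu ((H.F ^ (k : ℤ)) x) (H.c k x (y (j + k))) ≤
      H.C * (a * D) * μ ^ k * t * H.lam ^ j := fun k j => by
    have e1 : (k : ℤ) + -((j + k + 1 : ℕ) : ℤ) = -((j + 1 : ℕ) : ℤ) := by push_cast; ring
    have e2 : (k : ℤ) = -((j + 1 : ℕ) : ℤ) + ((j + k + 1 : ℕ) : ℤ) := by push_cast; ring
    have h1 := H.Vu_le (j + 1) _ _ (hu (j + k))
    rw [← H.F_add, ← e2] at h1
    rw [hcy, e1]
    refine h1.trans ?_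
    have h2 : H.lam ^ (j + 1) ≤ H.lam ^ j :=
      pow_le_pow_of_le_one hlam.le hlam'.le (Nat.le_succ j)
    have h3 : μ ^ (j + k) ≤ μ ^ k := pow_le_pow_of_le_one hμ0.le hμ1.le (Nat.le_add_left k j)
    calc H.C * H.lam ^ (j + 1) * H.nu ((H.F ^ ((j + k + 1 : ℕ) : ℤ)) x) (u (j + k))
        ≤ H.C * H.lam ^ j * (a * D * μ ^ k * t) := by
          refine mul_le_mul (by gcongr) ((hun _).trans (by gcongr)) (apply_nonneg _ _)
            (by positivity)
      _ = _ := by ring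
  have htail' : ∀ k : ℕ, Summable (fun j => H.c k x (y (j + k))) ∧
      H.nu ((H.F ^ (k : ℤ)) x) (∑' j, H.c k x (y (j + k))) ≤
        H.C * (a * D) * μ ^ k * t * (1 - H.lam)⁻¹ := fun k => by
    obtain ⟨a₁, h₁⟩ := H.norm_le ((H.F ^ (k : ℤ)) x)
    obtain ⟨a₂, h₂⟩ := H.le_norm ((H.F ^ (k : ℤ)) x)
    exact Seminorm.tsum_le_of_le_geometric _ h₁ h₂ hlam.le hlam' (htail k)
  have hysum : Summable y := by
    have := (htail' 0).1
    simpa [H.c_zero] using this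
  have hyV' : ∑' j, y j ∈ H.Vu x :=
    (H.Vu x).closed_of_finiteDimensional.mem_of_tendsto hysum.hasSum
      (Filter.Eventually.of_forall fun n => Submodule.sum_mem _ fun i _ => hyV i)
  -- Removing all future unstable errors in advance cancels, at time `k`, exactly those that have
  -- occurred. The series lies in the closed subspace `Vu x`, hence in the kernel of `P x`, so the
  -- projection is unchanged.
  refine ⟨l 0 - ∑' j, y j, ?_, fun k => ?_⟩
  · have h1 : ∑' j, y j ∈ LinearMap.ker (H.P x) := by
      rw [← H.sup_eq]; exact Submodule.mem_sup_right hyV'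
    have h2 := hlP 0
    rw [Nat.cast_zero, zpow_zero, Equiv.Perm.one_apply, H.b_zero] at h2
    rw [map_sub, h2, LinearMap.mem_ker.1 h1, sub_zero]
  · have hcont : Continuous (H.c k x) := (H.c k x).continuous_of_finiteDimensional
    have h1 : H.c k x (∑' j, y j) =
        ∑ j ∈ Finset.range k, H.c k x (y j) + ∑' j, H.c k x (y (j + k)) := by
      have hm : HasSum (fun j => H.c k x (y j)) (H.c k x (∑' j, y j)) :=
        hysum.hasSum.map (H.c k x) hcont
      rw [← hm.tsum_eq, ← hm.summable.sum_add_tsum_nat_add k]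
    have h2 : ∀ j ∈ Finset.range k, H.c ((k - 1 - j : ℕ) : ℤ)
        ((H.F ^ ((j + 1 : ℕ) : ℤ)) x) (δ j) =
        H.c ((k - 1 - j : ℕ) : ℤ) ((H.F ^ ((j + 1 : ℕ) : ℤ)) x) (s j) + H.c k x (y j) := by
      intro j hj
      have hj' := Finset.mem_range.1 hj
      have e1 : (k : ℤ) + -((j + 1 : ℕ) : ℤ) = ((k - 1 - j : ℕ) : ℤ) := by omega
      rw [hcy, e1, ← hsu, map_add]
    have h3 : H.c k x (l 0 - ∑' j, y j) = l k + ∑ j ∈ Finset.range k, H.c ((k - 1 - j : ℕ) : ℤ)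
        ((H.F ^ ((j + 1 : ℕ) : ℤ)) x) (s j) - ∑' j, H.c k x (y (j + k)) := by
      rw [map_sub, H.c_apply_pseudo_orbit, h1, Finset.sum_congr rfl h2, Finset.sum_add_distrib]
      abel
    rw [h3]
    refine (map_sub_le_add _ _ _).trans ((add_le_add ((map_add_le_add _ _ _).trans
      (add_le_add (hln k) (Finset.le_sum_of_subadditive _ (map_zero _).le
        (map_add_le_add _) _ _))) (htail' k).2).trans ?_)
    have h4 : ∀ j ∈ Finset.range k, H.nu ((H.F ^ (k : ℤ)) x) (H.c ((k - 1 - j : ℕ) : ℤ)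
        ((H.F ^ ((j + 1 : ℕ) : ℤ)) x) (s j)) ≤
        H.C * (a * D) * t * (μ ^ j * H.lam ^ (k - 1 - j)) := by
      intro j hj
      have hj' := Finset.mem_range.1 hj
      have e2 : (k : ℤ) = ((k - 1 - j : ℕ) : ℤ) + ((j + 1 : ℕ) : ℤ) := by omega
      have h5 := H.Vs_le (k - 1 - j) _ _ (hs j)
      rw [← H.F_add, ← e2] at h5
      refine h5.trans ((mul_le_mul_of_nonneg_left (hsn j) (by positivity)).trans_eq (by ring))
    -- Telescoping: this sum times `μ - lam` equals `μ ^ k - lam ^ k`.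
    have h6 : ∑ j ∈ Finset.range k, μ ^ j * H.lam ^ (k - 1 - j) ≤ μ ^ k * (μ - H.lam)⁻¹ := by
      rw [← div_eq_mul_inv, le_div_iff₀ hd1, geom_sum₂_mul]
      have : 0 ≤ H.lam ^ k := by positivity
      linarith
    have h7 := (Finset.sum_le_sum h4).trans_eq (Finset.mul_sum _ _ _).symm
    have h8 := mul_le_mul_of_nonneg_left h6 (show 0 ≤ H.C * (a * D) * t by positivity)
    calc _ ≤ H.K * H.C * μ ^ k * t + H.C * (a * D) * t * (μ ^ k * (μ - H.lam)⁻¹) +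
          H.C * (a * D) * μ ^ k * t * (1 - H.lam)⁻¹ := by
          gcongr
          exact h7.trans h8
      _ = _ := by ring

lemma exists_mem_stable (x : I) {w : Q} (hw : w ∈ H.Es x) : ∃ v ∈ H.stable x, H.P x v = w := by
  obtain ⟨C', μ, hC', hμ, hμ', -, h⟩ := H.exists_stable_lift
  obtain ⟨v, hv, hvk⟩ := h x w hw
  refine ⟨v, ⟨C' * H.nu' x w, fun k => (hvk k).trans ?_⟩, hv⟩
  exact mul_le_mul_of_nonneg_right (mul_le_of_le_one_right hC'.le (pow_le_one₀ hμ.le hμ'.le))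
    (apply_nonneg _ _)

/-- A bounded vector differs from the decaying lift of its projection by a bounded vertical vector,
which lies in `Vs`. Both pieces decay, and the norm of each is controlled by that of the original
vector. -/
lemma exists_stable_le : ∃ C' μ : ℝ, 0 < C' ∧ 0 < μ ∧ μ < 1 ∧ ∀ (k : ℕ) x, ∀ v ∈ H.stable x,
    H.nu ((H.F ^ (k : ℤ)) x) (H.c k x v) ≤ C' * μ ^ k * H.nu x v := by
  obtain ⟨C', μ, hC', hμ, hμ', hlμ, h⟩ := H.exists_stable_lift
  have hK := H.K_pos
  have hC := H.C_pos
  have hlam := H.lam_pos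
  refine ⟨C' * H.K + H.C * (1 + C' * H.K), μ, by positivity, hμ, hμ', fun k x v hv => ?_⟩
  obtain ⟨v₀, hv₀, hk⟩ := h x _ (H.P_mem_Es_of_mem_stable hv)
  have hP := mul_le_mul_of_nonneg_left (H.P_le x v) (show 0 ≤ C' * μ ^ k by positivity)
  have hst : v₀ ∈ H.stable x := ⟨C' * H.nu' x (H.P x v), fun k => (hk k).trans <|
    mul_le_mul_of_nonneg_right (mul_le_of_le_one_right hC'.le (pow_le_one₀ hμ.le hμ'.le))
      (apply_nonneg _ _)⟩
  have hs : v - v₀ ∈ H.Vs x := H.mem_Vs_of_mem_stable (sub_mem hv hst) (by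
    rw [map_sub, hv₀, sub_self])
  -- The decay estimate at time 0 bounds the norm of the lift itself.
  have h0 := hk 0
  rw [Nat.cast_zero, zpow_zero, H.c_zero, Equiv.Perm.one_apply, pow_zero, mul_one] at h0
  have h1 : H.nu x (v - v₀) ≤ (1 + C' * H.K) * H.nu x v := by
    have := (map_sub_le_add (H.nu x) v v₀).trans
      (add_le_add_right (h0.trans (mul_le_mul_of_nonneg_left (H.P_le x v) hC'.le)) _)
    linarith
  have h2 : H.c k x v = H.c k x v₀ + H.c k x (v - v₀) := by rw [← map_add]; congr 1; abel
  rw [h2]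
  refine (map_add_le_add _ _ _).trans ((add_le_add ((hk k).trans hP)
    ((H.Vs_le k x _ hs).trans ?_)).trans_eq (show _ + H.C * μ ^ k * ((1 + C' * H.K) * H.nu x v) =
      _ by ring))
  gcongr

/-- The total cocycle of a hyperbolic extension is hyperbolic. -/
theorem isHyperbolic : ∃ (Ws Wu : I → Submodule ℝ W) (C' μ : ℝ), 0 < C' ∧ 0 < μ ∧ μ < 1 ∧
    (∀ x, IsCompl (Ws x) (Wu x)) ∧
    (∀ x, (Ws x).map (H.c 1 x) = Ws (H.F x)) ∧ (∀ x, (Wu x).map (H.c 1 x) = Wu (H.F x)) ∧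
    (∀ (k : ℕ) x, ∀ v ∈ Ws x, H.nu ((H.F ^ (k : ℤ)) x) (H.c k x v) ≤ C' * μ ^ k * H.nu x v) ∧
    (∀ (k : ℕ) x, ∀ v ∈ Wu x,
      H.nu ((H.F ^ (-k : ℤ)) x) (H.c (-k) x v) ≤ C' * μ ^ k * H.nu x v) := by
  obtain ⟨C₁, μ₁, hC₁, hμ₁, hμ₁', h₁⟩ := H.exists_stable_le
  obtain ⟨C₂, μ₂, hC₂, hμ₂, hμ₂', h₂⟩ := H.reverse.exists_stable_le
  have hc : ∀ x v, H.c 1 x (H.c (-1) (H.F x) v) = v := fun x v => by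
    simpa using H.c_neg_c (-1) (H.F x) v
  refine ⟨H.stable, H.reverse.stable, max C₁ C₂, max μ₁ μ₂, lt_max_of_lt_left hC₁,
    lt_max_of_lt_left hμ₁, max_lt hμ₁' hμ₂', fun x => ⟨?_, ?_⟩, fun x => ?_, fun x => ?_,
    fun k x v hv => (h₁ k x v hv).trans ?_, fun k x v hv => ?_⟩
  -- A vector bounded in both time directions projects into `Es ⊓ Eu`, so it is vertical; then it
  -- lies in `Vs ⊓ Vu`.
  · refine Submodule.disjoint_def.2 fun v hv hv' => ?_
    have hP : H.P x v = 0 := Submodule.disjoint_def.1 (H.isCompl x).disjoint _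
      (H.P_mem_Es_of_mem_stable hv) (H.reverse.P_mem_Es_of_mem_stable hv')
    exact Submodule.disjoint_def.1 (H.disj x) _ (H.mem_Vs_of_mem_stable hv hP)
      (H.reverse.mem_Vs_of_mem_stable hv' hP)
  -- Subtracting a stable lift of the `Es`-part and an unstable lift of the `Eu`-part of the
  -- projection leaves a vertical vector, which splits along `Vs` and `Vu`.
  · refine codisjoint_iff.2 (eq_top_iff.2 fun v _ => ?_)
    have hk : H.P x v ∈ H.Es x ⊔ H.Eu x := by rw [(H.isCompl x).sup_eq_top]; trivial
    obtain ⟨s, hs, u, hu, hsu⟩ := Submodule.mem_sup.1 hk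
    obtain ⟨s', hs', rfl⟩ := H.exists_mem_stable x hs
    obtain ⟨u', hu', rfl⟩ := H.reverse.exists_mem_stable x hu
    have hker : v - s' - u' ∈ H.Vs x ⊔ H.Vu x := by
      rw [H.sup_eq, LinearMap.mem_ker, map_sub, map_sub, ← hsu]
      change _ + H.P x u' - _ - _ = _
      abel
    have hle : H.Vs x ⊔ H.Vu x ≤ H.stable x ⊔ H.reverse.stable x :=
      sup_le_sup (H.Vs_le_stable x) (H.reverse.Vs_le_stable x)
    have := add_mem (add_mem (hle hker) (Submodule.mem_sup_right hu'))
      (Submodule.mem_sup_left hs')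
    simpa using this
  · refine le_antisymm (Submodule.map_le_iff_le_comap.2 fun v hv => H.c_mem_stable hv) fun v hv => ?_
    have := H.c_neg_mem_stable hv
    rw [show H.F⁻¹ (H.F x) = x from H.F.symm_apply_apply x] at this
    exact ⟨_, this, hc x v⟩
  · refine le_antisymm (Submodule.map_le_iff_le_comap.2 fun v hv => ?_) fun v hv => ?_
    · have := H.reverse.c_neg_mem_stable hv
      simpa [reverse] using this
    · have := H.reverse.c_mem_stable hv
      change H.c (-1) (H.F x) v ∈ H.reverse.stable (H.F⁻¹ (H.F x)) at this
      rw [show H.F⁻¹ (H.F x) = x from H.F.symm_apply_apply x] at this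
      exact ⟨_, this, hc x v⟩
  · gcongr
    · exact le_max_left _ _
    · exact le_max_left _ _
  · have := h₂ k x v hv
    simp only [reverse, inv_zpow'] at this
    refine this.trans ?_
    gcongr
    · exact le_max_right _ _
    · exact le_max_right _ _

end HyperbolicExtension

/-! ### Riemannian norms on compact manifolds -/

section Riemannian

open Bundle

variable {n : ℕ} {M : Type*} [TopologicalSpace M]
  [ChartedSpace (EuclideanSpace ℝ (Fin n)) M] [IsManifold (𝓡 n) ∞ M]

lemma RiemMetric.norm_eq (g : RiemMetric n M) {x : M} (v : TangentSpace (𝓡 n) x) :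
    letI : RiemannianBundle (fun x : M => TangentSpace (𝓡 n) x) := ⟨g.toRiemannianMetric⟩
    g.norm v = ‖v‖ := by
  let : RiemannianBundle (fun x : M => TangentSpace (𝓡 n) x) := ⟨g.toRiemannianMetric⟩
  rw [norm_eq_sqrt_real_inner]
  rfl

/-- The norm of a Riemannian metric, as a seminorm on the model space. -/
noncomputable def RiemMetric.seminorm (g : RiemMetric n M) (x : M) : Seminorm ℝ (EuclideanSpace ℝ (Fin n)) :=
  letI : RiemannianBundle (fun x : M => TangentSpace (𝓡 n) x) := ⟨g.toRiemannianMetric⟩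
  (normSeminorm ℝ (TangentSpace (𝓡 n) x) :)

lemma RiemMetric.seminorm_apply (g : RiemMetric n M) {x : M} (v : TangentSpace (𝓡 n) x) :
    g.seminorm x v = g.norm v :=
  (g.norm_eq v).symm

lemma RiemMetric.norm_eq_zero (g : RiemMetric n M) {x : M} {v : TangentSpace (𝓡 n) x}
    (h : g.norm v = 0) : v = 0 := by
  let : RiemannianBundle (fun x : M => TangentSpace (𝓡 n) x) := ⟨g.toRiemannianMetric⟩
  rw [g.norm_eq] at h
  exact _root_.norm_eq_zero.1 h

/-- In local coordinates the Riemannian norms are uniformly equivalent to the norm of the model. -/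
lemma RiemMetric.exists_local_bound (g : RiemMetric n M) (x₀ : M) : ∃ C > 0, ∀ᶠ y in nhds x₀,
    (∀ v : TangentSpace (𝓡 n) y, ‖(trivializationAt (EuclideanSpace ℝ (Fin n))
      (fun x : M => TangentSpace (𝓡 n) x) x₀).continuousLinearMapAt ℝ y v‖ ≤ C * g.norm v) ∧
    ∀ w, g.norm ((trivializationAt (EuclideanSpace ℝ (Fin n))
      (fun x : M => TangentSpace (𝓡 n) x) x₀).symmL ℝ y w) ≤ C * ‖w‖ := by
  let : RiemannianBundle (fun x : M => TangentSpace (𝓡 n) x) := ⟨g.toRiemannianMetric⟩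
  obtain ⟨C₁, hC₁, h₁⟩ := eventually_norm_trivializationAt_lt (EuclideanSpace ℝ (Fin n))
    (fun x : M => TangentSpace (𝓡 n) x) x₀
  obtain ⟨C₂, hC₂, h₂⟩ := eventually_norm_symmL_trivializationAt_lt (EuclideanSpace ℝ (Fin n))
    (fun x : M => TangentSpace (𝓡 n) x) x₀
  refine ⟨max C₁ C₂, lt_max_of_lt_left hC₁, ?_⟩
  filter_upwards [h₁, h₂] with y hy₁ hy₂
  refine ⟨fun v => ?_, fun w => ?_⟩
  · rw [g.norm_eq]
    exact (ContinuousLinearMap.le_of_opNorm_le _ (hy₁.le.trans (le_max_left _ _)) v)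
  · rw [g.norm_eq]
    exact (ContinuousLinearMap.le_of_opNorm_le _ (hy₂.le.trans (le_max_right _ _)) w)

/-- The constants may depend on the point: the comparison serves for convergence and boundedness
inside one tangent space, identified with the model space. -/
lemma RiemMetric.exists_norm_bounds (g : RiemMetric n M) (x : M) :
    (∃ a, ∀ w : EuclideanSpace ℝ (Fin n), ‖w‖ ≤ a * g.seminorm x w) ∧
    (∃ a, ∀ w : EuclideanSpace ℝ (Fin n), g.seminorm x w ≤ a * ‖w‖) := by
  obtain ⟨C, hC, h⟩ := g.exists_local_bound x
  obtain ⟨h₁, h₂⟩ := h.self_of_nhds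
  have hx := FiberBundle.mem_baseSet_trivializationAt' (F := EuclideanSpace ℝ (Fin n))
    (E := fun x : M => TangentSpace (𝓡 n) x) x
  set T : EuclideanSpace ℝ (Fin n) →L[ℝ] EuclideanSpace ℝ (Fin n) :=
    (trivializationAt (EuclideanSpace ℝ (Fin n))
      (fun x : M => TangentSpace (𝓡 n) x) x).continuousLinearMapAt ℝ x
  set T' : EuclideanSpace ℝ (Fin n) →L[ℝ] EuclideanSpace ℝ (Fin n) :=
    (trivializationAt (EuclideanSpace ℝ (Fin n))
      (fun x : M => TangentSpace (𝓡 n) x) x).symmL ℝ x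
  have hTT : ∀ w, T' (T w) = w := fun w => Trivialization.symmL_continuousLinearMapAt _ hx w
  constructor
  · refine ⟨‖T'‖ * C, fun w => ?_⟩
    rw [mul_assoc]
    conv_lhs => rw [← hTT w]
    exact (T'.le_opNorm _).trans (mul_le_mul_of_nonneg_left (h₁ w) (norm_nonneg _))
  · refine ⟨C * ‖T‖, fun w => ?_⟩
    rw [mul_assoc]
    refine (le_of_eq ?_).trans ((h₂ (T w)).trans
      (mul_le_mul_of_nonneg_left (T.le_opNorm _) hC.le))
    exact (congrArg (g.seminorm x) (hTT w)).symm.trans (g.seminorm_apply (x := x) _)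

variable {n' : ℕ} {M' : Type*} [TopologicalSpace M']
  [ChartedSpace (EuclideanSpace ℝ (Fin n')) M'] [IsManifold (𝓡 n') ∞ M']

/-- A finite subcover reduces the claim to finitely many local constants, all of which are dominated
by the sum of their absolute values. -/
lemma exists_bound_of_local [CompactSpace M] {p : ℝ → M → Prop}
    (hmono : ∀ K K' x, K ≤ K' → p K x → p K' x) (h : ∀ x₀, ∃ K, ∀ᶠ x in nhds x₀, p K x) :
    ∃ K, 1 ≤ K ∧ ∀ x, p K x := by
  choose K hK using h
  obtain ⟨t, -, ht⟩ := isCompact_univ.elim_nhds_subcover (fun x₀ => {x | p (K x₀) x})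
    (fun x _ => hK x)
  refine ⟨1 + ∑ x ∈ t, |K x|, le_add_of_nonneg_right (Finset.sum_nonneg fun _ _ => abs_nonneg _),
    fun x => ?_⟩
  obtain ⟨y, hy, hxy⟩ := Set.mem_iUnion₂.1 (ht (Set.mem_univ x))
  refine hmono _ _ x ?_ hxy
  have := Finset.single_le_sum (fun i _ => abs_nonneg (K i)) hy
  linarith [le_abs_self (K y)]

/-- The derivative of a smooth map in the coordinates of the trivializations at `x₀` and `f x₀`. -/
lemma exists_local_mfderiv {f : M → M'} (hf : ContMDiff (𝓡 n) (𝓡 n') ∞ f) (x₀ : M) :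
    ∃ A : M → EuclideanSpace ℝ (Fin n) →L[ℝ] EuclideanSpace ℝ (Fin n'), ContinuousAt A x₀ ∧
      ∀ᶠ x in nhds x₀,
        x ∈ (trivializationAt (EuclideanSpace ℝ (Fin n))
          (fun x : M => TangentSpace (𝓡 n) x) x₀).baseSet ∧
        f x ∈ (trivializationAt (EuclideanSpace ℝ (Fin n'))
          (fun x : M' => TangentSpace (𝓡 n') x) (f x₀)).baseSet ∧
        (∀ v : TangentSpace (𝓡 n) x, mfderiv (𝓡 n) (𝓡 n') f x v =
          (trivializationAt (EuclideanSpace ℝ (Fin n'))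
            (fun x : M' => TangentSpace (𝓡 n') x) (f x₀)).symmL ℝ (f x)
            (A x ((trivializationAt (EuclideanSpace ℝ (Fin n))
            (fun x : M => TangentSpace (𝓡 n) x) x₀).continuousLinearMapAt ℝ x v))) ∧
        (∀ w, A x w = (trivializationAt (EuclideanSpace ℝ (Fin n'))
            (fun x : M' => TangentSpace (𝓡 n') x) (f x₀)).continuousLinearMapAt ℝ (f x)
            (mfderiv (𝓡 n) (𝓡 n') f x ((trivializationAt (EuclideanSpace ℝ (Fin n))
            (fun x : M => TangentSpace (𝓡 n) x) x₀).symmL ℝ x w))) := by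
  have h := (ContMDiffAt.mfderiv_const (m := 0) (hf x₀) (by simp)).continuousAt
  refine ⟨_, h, ?_⟩
  have hb : ∀ᶠ x in nhds x₀, x ∈ (trivializationAt (EuclideanSpace ℝ (Fin n))
      (fun x : M => TangentSpace (𝓡 n) x) x₀).baseSet :=
    (trivializationAt _ _ x₀).open_baseSet.eventually_mem (FiberBundle.mem_baseSet_trivializationAt' x₀)
  have hb' : ∀ᶠ x in nhds x₀, f x ∈ (trivializationAt (EuclideanSpace ℝ (Fin n'))
      (fun x : M' => TangentSpace (𝓡 n') x) (f x₀)).baseSet :=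
    hf.continuous.continuousAt.eventually ((trivializationAt _ _ (f x₀)).open_baseSet.eventually_mem
      (FiberBundle.mem_baseSet_trivializationAt' _))
  filter_upwards [hb, hb'] with x hx hx'
  have h2 : ∀ w, inTangentCoordinates (𝓡 n) (𝓡 n') id f (mfderiv (𝓡 n) (𝓡 n') f) x₀ x w =
      (trivializationAt (EuclideanSpace ℝ (Fin n'))
            (fun x : M' => TangentSpace (𝓡 n') x) (f x₀)).continuousLinearMapAt ℝ (f x)
            (mfderiv (𝓡 n) (𝓡 n') f x ((trivializationAt (EuclideanSpace ℝ (Fin n))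
            (fun x : M => TangentSpace (𝓡 n) x) x₀).symmL ℝ x w)) := fun w => rfl
  refine ⟨hx, hx', fun v => ?_, h2⟩
  rw [h2, Trivialization.symmL_continuousLinearMapAt _ hx,
    Trivialization.symmL_continuousLinearMapAt _ hx']

/-- Smooth maps of compact manifolds have bounded derivatives. -/
lemma exists_norm_mfderiv_le [CompactSpace M] (g : RiemMetric n M) (g' : RiemMetric n' M')
    {f : M → M'} (hf : ContMDiff (𝓡 n) (𝓡 n') ∞ f) :
    ∃ K, 1 ≤ K ∧ ∀ (x : M) (v : TangentSpace (𝓡 n) x),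
      g'.norm (mfderiv (𝓡 n) (𝓡 n') f x v) ≤ K * g.norm v := by
  refine exists_bound_of_local (p := fun K x => ∀ v : TangentSpace (𝓡 n) x,
    g'.norm (mfderiv (𝓡 n) (𝓡 n') f x v) ≤ K * g.norm v) ?_ fun x₀ => ?_
  · exact fun K K' x hK h v => (h v).trans (mul_le_mul_of_nonneg_right hK (Real.sqrt_nonneg _))
  · obtain ⟨A, hA, hloc⟩ := exists_local_mfderiv hf x₀
    obtain ⟨C, hC, h₁⟩ := g.exists_local_bound x₀
    obtain ⟨C', hC', h₂⟩ := g'.exists_local_bound (f x₀)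
    refine ⟨C' * ((‖A x₀‖ + 1) * C), ?_⟩
    filter_upwards [hloc, h₁, hf.continuous.continuousAt.eventually h₂,
      hA.norm.eventually (gt_mem_nhds (lt_add_one _))] with x ⟨_, _, hx, _⟩ ⟨hx₁, _⟩ ⟨_, hx₂⟩ hAx v
    rw [hx, mul_assoc, mul_assoc]
    refine (hx₂ _).trans (mul_le_mul_of_nonneg_left ?_ hC'.le)
    exact ((A x).le_opNorm _).trans (mul_le_mul hAx.le (hx₁ v) (norm_nonneg _) (by positivity))

/-- The vectors of the target of a submersion of a compact manifold have lifts of comparable norm. -/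
lemma exists_norm_lift_le [CompactSpace M] (g : RiemMetric n M) (g' : RiemMetric n' M')
    {f : M → M'} (hf : ContMDiff (𝓡 n) (𝓡 n') ∞ f)
    (hsurj : ∀ x, Function.Surjective (mfderiv (𝓡 n) (𝓡 n') f x)) :
    ∃ K, 1 ≤ K ∧ ∀ (x : M) (w : TangentSpace (𝓡 n') (f x)), ∃ v : TangentSpace (𝓡 n) x,
      mfderiv (𝓡 n) (𝓡 n') f x v = w ∧ g.norm v ≤ K * g'.norm w := by
  refine exists_bound_of_local (p := fun K x => ∀ w : TangentSpace (𝓡 n') (f x),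
    ∃ v : TangentSpace (𝓡 n) x,
      mfderiv (𝓡 n) (𝓡 n') f x v = w ∧ g.norm v ≤ K * g'.norm w) ?_ fun x₀ => ?_
  · intro K K' x hK h w
    obtain ⟨v, hv, hv'⟩ := h w
    exact ⟨v, hv, hv'.trans (mul_le_mul_of_nonneg_right hK (Real.sqrt_nonneg _))⟩
  · obtain ⟨A, hA, hloc⟩ := exists_local_mfderiv hf x₀
    obtain ⟨C, hC, h₁⟩ := g.exists_local_bound x₀
    obtain ⟨C', hC', h₂⟩ := g'.exists_local_bound (f x₀)
    have hA₀ : Function.Surjective (A x₀) := fun w => by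
      obtain ⟨hb, hb', -, h⟩ := hloc.self_of_nhds
      obtain ⟨v, hv⟩ := hsurj x₀ ((trivializationAt (EuclideanSpace ℝ (Fin n'))
        (fun x : M' => TangentSpace (𝓡 n') x) (f x₀)).symmL ℝ (f x₀) w)
      refine ⟨(trivializationAt (EuclideanSpace ℝ (Fin n))
        (fun x : M => TangentSpace (𝓡 n) x) x₀).continuousLinearMapAt ℝ x₀ v, ?_⟩
      rw [h, Bundle.Trivialization.symmL_continuousLinearMapAt _ hb, hv,
        Bundle.Trivialization.continuousLinearMapAt_symmL _ hb']
    -- A right inverse `R` of `A x₀` is enough: near `x₀` the operator `A x ∘ R` is close to the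
    -- identity, hence invertible, and `R ∘ (A x ∘ R)⁻¹` is a right inverse of `A x` of locally
    -- bounded norm.
    obtain ⟨R₀, hR₀⟩ := (A x₀).toLinearMap.exists_rightInverse_of_surjective
      (LinearMap.range_eq_top.2 hA₀)
    set R : EuclideanSpace ℝ (Fin n') →L[ℝ] EuclideanSpace ℝ (Fin n) := R₀.toContinuousLinearMap
    have hAR : (A x₀).comp R = 1 := by
      ext1 w
      exact LinearMap.congr_fun hR₀ w
    have hc : ContinuousAt (fun x => (A x).comp R) x₀ := hA.clm_comp continuousAt_const
    have hunit : ∀ᶠ x in nhds x₀, IsUnit ((A x).comp R) := by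
      refine hc.eventually (Units.isOpen.eventually_mem ?_)
      change IsUnit ((A x₀).comp R)
      rw [hAR]
      exact isUnit_one
    have hinv : ContinuousAt (fun x => Ring.inverse ((A x).comp R)) x₀ := by
      refine ContinuousAt.comp (g := Ring.inverse) ?_ hc
      rw [hAR]
      exact NormedRing.inverse_continuousAt 1
    refine ⟨C * (‖R‖ * ((‖Ring.inverse ((A x₀).comp R)‖ + 1) * C')), ?_⟩
    filter_upwards [hloc, h₁, hf.continuous.continuousAt.eventually h₂, hunit,
      hinv.norm.eventually (gt_mem_nhds (lt_add_one _))]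
      with x ⟨hb, hb', hx, _⟩ ⟨_, hx₁⟩ ⟨hx₂, _⟩ hu hI w
    set B := Ring.inverse ((A x).comp R)
    have hB : ∀ u, A x (R (B u)) = u := fun u =>
      DFunLike.congr_fun (Ring.mul_inverse_cancel _ hu) u
    refine ⟨_, ?_, (hx₁ (R (B ((trivializationAt (EuclideanSpace ℝ (Fin n'))
        (fun x : M' => TangentSpace (𝓡 n') x) (f x₀)).continuousLinearMapAt ℝ (f x) w)))).trans ?_⟩
    · rw [hx, Bundle.Trivialization.continuousLinearMapAt_symmL _ hb, hB,
        Bundle.Trivialization.symmL_continuousLinearMapAt _ hb']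
    · rw [mul_assoc, mul_assoc, mul_assoc]
      refine mul_le_mul_of_nonneg_left ((R.le_opNorm _).trans
        (mul_le_mul_of_nonneg_left ((B.le_opNorm _).trans ?_) (norm_nonneg _))) hC.le
      exact mul_le_mul hI.le (hx₂ w) (norm_nonneg _) (by positivity)

/-- The pullback of a bilinear form by a linear map. -/
noncomputable def pullbackForm (B : EuclideanSpace ℝ (Fin n') →L[ℝ] EuclideanSpace ℝ (Fin n') →L[ℝ] ℝ)
    (D : EuclideanSpace ℝ (Fin n) →L[ℝ] EuclideanSpace ℝ (Fin n')) :
    EuclideanSpace ℝ (Fin n) →L[ℝ] EuclideanSpace ℝ (Fin n) →L[ℝ] ℝ :=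
  B.bilinearComp D D

/-- A bilinear form on a tangent space in local coordinates. -/
lemma inCoordinates_bilinear_apply {x₀ x : M}
    (hx : x ∈ (trivializationAt (EuclideanSpace ℝ (Fin n))
      (fun x : M => TangentSpace (𝓡 n) x) x₀).baseSet)
    (B : TangentSpace (𝓡 n) x →L[ℝ] TangentSpace (𝓡 n) x →L[ℝ] ℝ)
    (v w : EuclideanSpace ℝ (Fin n)) :
    ContinuousLinearMap.inCoordinates (EuclideanSpace ℝ (Fin n))
      (fun x : M => TangentSpace (𝓡 n) x) (EuclideanSpace ℝ (Fin n) →L[ℝ] ℝ)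
      (fun x : M => TangentSpace (𝓡 n) x →L[ℝ] ℝ) x₀ x x₀ x B v w =
    B ((trivializationAt (EuclideanSpace ℝ (Fin n)) (fun x : M => TangentSpace (𝓡 n) x) x₀).symm
        x v)
      ((trivializationAt (EuclideanSpace ℝ (Fin n)) (fun x : M => TangentSpace (𝓡 n) x) x₀).symm
        x w) := by
  rw [inCoordinates_apply_eq₂ hx hx (Set.mem_univ _)]
  exact DFunLike.congr_fun (Bundle.Trivial.linearMapAt_trivialization ℝ M ℝ x) _

/-- The pullback of a Riemannian metric by an immersion. -/
noncomputable def RiemMetric.pullback (g' : RiemMetric n' M') {f : M → M'}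
    (hf : ContMDiff (𝓡 n) (𝓡 n') ∞ f)
    (hinj : ∀ x, Function.Injective (mfderiv (𝓡 n) (𝓡 n') f x)) : RiemMetric n M where
  inner x := pullbackForm (n := n) (n' := n') (g'.inner (f x)) (mfderiv (𝓡 n) (𝓡 n') f x)
  symm x v w := g'.symm (f x) _ _
  pos x v hv := g'.pos (f x) _ fun h => hv (hinj x (h.trans (map_zero _).symm))
  isVonNBounded x := by
    -- An injective linear map of finite-dimensional spaces is bounded below, so the unit ball of
    -- the pulled back form is bounded.
    obtain ⟨⟨a, ha⟩, -⟩ := g'.exists_norm_bounds (f x)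
    let D : EuclideanSpace ℝ (Fin n) →L[ℝ] EuclideanSpace ℝ (Fin n') := mfderiv (𝓡 n) (𝓡 n') f x
    obtain ⟨K, -, hK⟩ := D.toLinearMap.exists_antilipschitzWith
      (LinearMap.ker_eq_bot.2 (hinj x))
    have hb : Bornology.IsVonNBounded ℝ {v : EuclideanSpace ℝ (Fin n) |
        pullbackForm (n := n) (n' := n') (g'.inner (f x)) D v v < 1} := by
      refine (NormedSpace.isVonNBounded_iff' _).2 ⟨K * |a|, fun v hv => ?_⟩
      refine (hK.le_mul_norm (map_zero _) v).trans (mul_le_mul_of_nonneg_left ((ha (D v)).trans ?_) K.2)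
      have h1 : g'.seminorm (f x) (D v) ≤ 1 := by
        rw [← Real.sqrt_one]
        exact (g'.seminorm_apply (x := f x) (D v)).trans_le (Real.sqrt_le_sqrt hv.le)
      calc a * g'.seminorm (f x) (D v) ≤ |a| * 1 :=
            mul_le_mul (le_abs_self a) h1 (apply_nonneg _ _) (abs_nonneg a)
        _ = |a| := mul_one _
    exact hb
  continuous := by
    refine continuous_iff_continuousAt.2 fun x₀ => ?_
    rw [continuousAt_hom_bundle]
    refine ⟨continuousAt_id, ?_⟩
    have hg := (g'.continuous.continuousAt (x := f x₀))
    rw [continuousAt_hom_bundle] at hg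
    obtain ⟨A, hA, hloc⟩ := exists_local_mfderiv hf x₀
    have hg' := ContinuousAt.comp (f := f) hg.2 hf.continuous.continuousAt
    -- In trivializations the pulled back form is the coordinate form of `g'` at `f x`, evaluated at
    -- `A x v` and `A x w`; each ingredient is continuous at `x₀`.
    refine continuousAt_clm_apply.2 fun v => continuousAt_clm_apply.2 fun w => ?_
    refine ((hg'.clm_apply (hA.clm_apply (continuousAt_const (y := v)))).clm_apply
      (hA.clm_apply (continuousAt_const (y := w)))).congr ?_
    filter_upwards [hloc] with x ⟨hb, hb', hx, _⟩
    have h1 : ∀ u, mfderiv (𝓡 n) (𝓡 n') f x ((trivializationAt (EuclideanSpace ℝ (Fin n))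
        (fun x : M => TangentSpace (𝓡 n) x) x₀).symm x u) =
        (trivializationAt (EuclideanSpace ℝ (Fin n'))
            (fun x : M' => TangentSpace (𝓡 n') x) (f x₀)).symm (f x) (A x u) := fun u => by
      have h2 := hx ((trivializationAt (EuclideanSpace ℝ (Fin n))
        (fun x : M => TangentSpace (𝓡 n) x) x₀).symmL ℝ x u)
      rw [Bundle.Trivialization.continuousLinearMapAt_symmL _ hb] at h2
      rwa [Bundle.Trivialization.symmL_apply _ hb, Bundle.Trivialization.symmL_apply _ hb'] at h2
    have h2 := congrArg₂ (fun a b : EuclideanSpace ℝ (Fin n') => g'.inner (f x) a b) (h1 v) (h1 w)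
    exact ((inCoordinates_bilinear_apply hb' (g'.inner (f x)) _ _).trans h2.symm).trans
      (inCoordinates_bilinear_apply hb (pullbackForm (n := n) (n' := n') (g'.inner (f x))
        (mfderiv (𝓡 n) (𝓡 n') f x)) v w).symm

end Riemannian

/-! ### Submanifolds given by local parametrizations -/

section Submanifold

variable {k l : ℕ} {E : Type*} [TopologicalSpace E] [ChartedSpace (EuclideanSpace ℝ (Fin l)) E]

/-- A smooth local parametrization `param` of the subset `X` near `x`, together with a smooth
function `coord` defined near `x` in the ambient manifold that inverts it. -/
structure LocalParametrization (k l : ℕ) {E : Type*} [TopologicalSpace E]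
    [ChartedSpace (EuclideanSpace ℝ (Fin l)) E] (X : Set E) (x : E) where
  coord : E → EuclideanSpace ℝ (Fin k)
  param : EuclideanSpace ℝ (Fin k) → E
  source : Set E
  target : Set (EuclideanSpace ℝ (Fin k))
  isOpen_source : IsOpen source
  isOpen_target : IsOpen target
  mem_source : x ∈ source
  coord_mem_target : coord x ∈ target
  contMDiffOn_coord : ContMDiffOn (𝓡 l) (𝓡 k) ∞ coord source
  contMDiffOn_param : ContMDiffOn (𝓡 k) (𝓡 l) ∞ param target
  param_mem : ∀ u ∈ target, param u ∈ X
  coord_param : ∀ u ∈ target, param u ∈ source → coord (param u) = u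
  param_coord : ∀ e ∈ source, e ∈ X → coord e ∈ target → param (coord e) = e

variable {X : Set E}

open Classical in
/-- The chart of `X` given by a local parametrization. -/
noncomputable def LocalParametrization.chart (x : X) (P : LocalParametrization k l X (x : E)) :
    OpenPartialHomeomorph X (EuclideanSpace ℝ (Fin k)) where
  toFun e := P.coord e
  -- The default `x` is never taken on the target, which `param` maps into `X`.
  invFun u := if h : P.param u ∈ X then ⟨P.param u, h⟩ else x
  source := {e | (e : E) ∈ P.source ∩ P.coord ⁻¹' P.target}
  target := P.target ∩ P.param ⁻¹' P.source
  map_source' e he := ⟨he.2, by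
    rw [Set.mem_preimage, P.param_coord e he.1 e.2 he.2]; exact he.1⟩
  map_target' u hu := by
    rw [dif_pos (P.param_mem u hu.1)]
    refine ⟨hu.2, ?_⟩
    rw [Set.mem_preimage, P.coord_param u hu.1 hu.2]
    exact hu.1
  left_inv' e he := by
    have h := P.param_coord e he.1 e.2 he.2
    rw [dif_pos (h.symm ▸ e.2)]
    exact Subtype.ext h
  right_inv' u hu := by
    rw [dif_pos (P.param_mem u hu.1)]
    exact P.coord_param u hu.1 hu.2
  open_source := (P.contMDiffOn_coord.continuousOn.isOpen_inter_preimage P.isOpen_source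
    P.isOpen_target).preimage continuous_subtype_val
  open_target := P.contMDiffOn_param.continuousOn.isOpen_inter_preimage P.isOpen_target
    P.isOpen_source
  continuousOn_toFun := P.contMDiffOn_coord.continuousOn.comp
    continuous_subtype_val.continuousOn fun _ he => he.1
  continuousOn_invFun := by
    rw [Topology.IsInducing.subtypeVal.continuousOn_iff]
    refine (P.contMDiffOn_param.continuousOn.mono Set.inter_subset_left).congr fun u hu => ?_
    simp only [Function.comp_apply]
    rw [dif_pos (P.param_mem u hu.1)]

lemma LocalParametrization.chart_symm {x : X} (P : LocalParametrization k l X (x : E))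
    {u : EuclideanSpace ℝ (Fin k)} (hu : u ∈ (P.chart x).target) :
    ((P.chart x).symm u : E) = P.param u :=
  congrArg Subtype.val (dif_pos (P.param_mem u hu.1))

/-- A subset covered by local parametrizations is an embedded submanifold: the inclusion is smooth,
and it has smooth local retractions. -/
theorem exists_submanifold_structure (h : ∀ x ∈ X, Nonempty (LocalParametrization k l X x)) :
    ∃ (_ : ChartedSpace (EuclideanSpace ℝ (Fin k)) X) (_ : IsManifold (𝓡 k) ∞ X),
      ContMDiff (𝓡 k) (𝓡 l) ∞ (Subtype.val : X → E) ∧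
      ∀ x : X, ∃ R : E → X, ContMDiffAt (𝓡 l) (𝓡 k) ∞ R x ∧ ∀ᶠ y : X in nhds x, R y = y := by
  have P : ∀ x : X, LocalParametrization k l X (x : E) := fun x => (h x x.2).some
  have hmem : ∀ x, x ∈ ((P x).chart x).source := fun x =>
    ⟨(P x).mem_source, (P x).coord_mem_target⟩
  let cs : ChartedSpace (EuclideanSpace ℝ (Fin k)) X :=
    { atlas := Set.range fun x => (P x).chart x
      chartAt := fun x => (P x).chart x
      mem_chart_source := hmem
      chart_mem_atlas := fun x => ⟨x, rfl⟩ }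
  have hm : IsManifold (𝓡 k) ∞ X := by
    refine isManifold_of_contDiffOn (𝓡 k) ∞ X ?_
    rintro _ _ ⟨x, rfl⟩ ⟨y, rfl⟩
    refine ContMDiffOn.contDiffOn ?_
    -- Transition maps factor through the ambient manifold as `coord ∘ param`, so they are smooth
    -- without any compatibility condition between the parametrizations.
    have h1 : ContMDiffOn (𝓡 k) (𝓡 k) ∞ ((P y).coord ∘ (P x).param)
        ((P x).target ∩ (P x).param ⁻¹' (P y).source) :=
      (P y).contMDiffOn_coord.comp ((P x).contMDiffOn_param.mono Set.inter_subset_left)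
        fun u hu => hu.2
    have h2 : ∀ u ∈ (((P x).chart x).symm.trans ((P y).chart y)).source,
        ((P y).chart y) (((P x).chart x).symm u) = (P y).coord ((P x).param u) :=
      fun u hu => congrArg (P y).coord ((P x).chart_symm hu.1)
    refine (h1.mono ?_).congr (f₁ := _) ?_
    · rintro u ⟨hu, -⟩
      have hu' : u ∈ (((P x).chart x).symm.trans ((P y).chart y)).source := by simpa using hu
      refine ⟨hu'.1.1, ?_⟩
      have := hu'.2.1
      change (((P x).chart x).symm u : E) ∈ (P y).source at this
      rwa [(P x).chart_symm hu'.1] at this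
    · rintro u ⟨hu, -⟩
      have hu' : u ∈ (((P x).chart x).symm.trans ((P y).chart y)).source := by simpa using hu
      exact h2 u hu'
  refine ⟨cs, hm, fun x => ?_, fun x => ⟨((P x).chart x).symm ∘ (P x).coord, ?_, ?_⟩⟩
  · have h1 : ContMDiffAt (𝓡 k) (𝓡 k) ∞ ((P x).chart x) x :=
      contMDiffOn_chart.contMDiffAt (((P x).chart x).open_source.mem_nhds (hmem x))
    have h2 : ContMDiffAt (𝓡 k) (𝓡 l) ∞ (P x).param ((P x).chart x x) :=
      (P x).contMDiffOn_param.contMDiffAt ((P x).isOpen_target.mem_nhds (P x).coord_mem_target)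
    refine (h2.comp x h1).congr_of_eventuallyEq ?_
    filter_upwards [((P x).chart x).open_source.mem_nhds (hmem x)] with y hy
    exact ((P x).param_coord y hy.1 y.2 hy.2).symm
  · have h1 : ContMDiffOn (𝓡 k) (𝓡 k) ∞ ((P x).chart x).symm ((P x).chart x).target :=
      contMDiffOn_chart_symm (x := x)
    have h2 := h1.contMDiffAt (((P x).chart x).open_target.mem_nhds
      (((P x).chart x).map_source (hmem x)))
    exact ContMDiffAt.comp (x : E) h2 ((P x).contMDiffOn_coord.contMDiffAt
      ((P x).isOpen_source.mem_nhds (P x).mem_source))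
  · filter_upwards [((P x).chart x).open_source.mem_nhds (hmem x)] with y hy
    exact ((P x).chart x).left_inv hy

/-- `X` is a smooth submanifold: the inclusion is smooth and has smooth local retractions. -/
def IsSmoothSubmanifold (k l : ℕ) {E : Type*} [TopologicalSpace E]
    [ChartedSpace (EuclideanSpace ℝ (Fin l)) E] (X : Set E)
    [ChartedSpace (EuclideanSpace ℝ (Fin k)) X] : Prop :=
  ContMDiff (𝓡 k) (𝓡 l) ∞ (Subtype.val : X → E) ∧
    ∀ x : X, ∃ R : E → X, ContMDiffAt (𝓡 l) (𝓡 k) ∞ R x ∧ ∀ᶠ y : X in nhds x, R y = y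

namespace IsSmoothSubmanifold

/-- The derivative of a local retraction is a left inverse. -/
lemma injective_mfderiv [ChartedSpace (EuclideanSpace ℝ (Fin k)) X]
    (hX : IsSmoothSubmanifold k l X) (x : X) :
    Function.Injective (mfderiv (𝓡 k) (𝓡 l) (Subtype.val : X → E) x) := by
  obtain ⟨R, hR, hR'⟩ := hX.2 x
  have h1 : HasMFDerivAt (𝓡 k) (𝓡 k) (R ∘ Subtype.val) x
      ((mfderiv (𝓡 l) (𝓡 k) R x).comp (mfderiv (𝓡 k) (𝓡 l) (Subtype.val : X → E) x)) :=
    (hR.mdifferentiableAt (by simp)).hasMFDerivAt.comp x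
      ((hX.1 x).mdifferentiableAt (by simp)).hasMFDerivAt
  have h2 : HasMFDerivAt (𝓡 k) (𝓡 k) (R ∘ Subtype.val) x
      (ContinuousLinearMap.id ℝ (TangentSpace (𝓡 k) x)) :=
    (hasMFDerivAt_id x).congr_of_eventuallyEq hR'
  have h3 := hasMFDerivAt_unique h1 h2
  intro v w hvw
  have h4 : ∀ u, (mfderiv (𝓡 l) (𝓡 k) R x) (mfderiv (𝓡 k) (𝓡 l) (Subtype.val : X → E) x u) = u :=
    fun u => DFunLike.congr_fun h3 u
  rw [← h4 v, ← h4 w, hvw]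

/-- A map into a submanifold is smooth if it is smooth as a map into the ambient manifold. -/
lemma contMDiffAt_of_val [ChartedSpace (EuclideanSpace ℝ (Fin k)) X]
    (hX : IsSmoothSubmanifold k l X) {F H : Type*} [NormedAddCommGroup F] [NormedSpace ℝ F]
    [TopologicalSpace H] {I : ModelWithCorners ℝ F H} {P : Type*} [TopologicalSpace P]
    [ChartedSpace H P] {f : P → X} {x : P}
    (hf : ContMDiffAt I (𝓡 l) ∞ (fun y => (f y : E)) x) : ContMDiffAt I (𝓡 k) ∞ f x := by
  obtain ⟨R, hR, hR'⟩ := hX.2 (f x)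
  have hc : ContinuousAt f x := Topology.IsInducing.subtypeVal.continuousAt_iff.2 hf.continuousAt
  refine (ContMDiffAt.comp (g := R) (f := fun y => (f y : E)) x hR hf).congr_of_eventuallyEq ?_
  filter_upwards [hc.eventually hR'] with y hy using hy.symm

end IsSmoothSubmanifold

end Submanifold

/-! ### Local diffeomorphisms -/

section LocalDiffeomorphism

variable {F H F' H' : Type*} [NormedAddCommGroup F] [NormedSpace ℝ F] [TopologicalSpace H]
  [NormedAddCommGroup F'] [NormedSpace ℝ F'] [TopologicalSpace H']
  {I : ModelWithCorners ℝ F H} {J : ModelWithCorners ℝ F' H'} {n : WithTop ℕ∞}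
  {P P' : Type*} [TopologicalSpace P] [ChartedSpace H P] [TopologicalSpace P'] [ChartedSpace H' P']

/-- A smooth map with a smooth local inverse, as a partial diffeomorphism. -/
def PartialDiffeomorph.ofLocalInverse {f : P → P'} {g : P' → P} {U : Set P} {V : Set P'}
    (hU : IsOpen U) (hV : IsOpen V) (hf : ContMDiffOn I J n f U) (hg : ContMDiffOn J I n g V)
    (hgf : ∀ x ∈ U, f x ∈ V → g (f x) = x) (hfg : ∀ y ∈ V, g y ∈ U → f (g y) = y) :
    PartialDiffeomorph I J P P' n where
  toFun := f
  invFun := g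
  source := U ∩ f ⁻¹' V
  target := V ∩ g ⁻¹' U
  map_source' x hx := ⟨hx.2, by rw [Set.mem_preimage, hgf x hx.1 hx.2]; exact hx.1⟩
  map_target' y hy := ⟨hy.2, by rw [Set.mem_preimage, hfg y hy.1 hy.2]; exact hy.1⟩
  left_inv' x hx := hgf x hx.1 hx.2
  right_inv' y hy := hfg y hy.1 hy.2
  open_source := hf.continuousOn.isOpen_inter_preimage hU hV
  open_target := hg.continuousOn.isOpen_inter_preimage hV hU
  contMDiffOn_toFun := hf.mono Set.inter_subset_left
  contMDiffOn_invFun := hg.mono Set.inter_subset_left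

/-- The inverse identities are required only where both maps stay in their domains, so `U` and `V`
can be chosen independently, without first matching them. -/
lemma isLocalDiffeomorphAt_of_local_inverse {f : P → P'} {g : P' → P} {U : Set P} {V : Set P'}
    (hU : IsOpen U) (hV : IsOpen V) (hf : ContMDiffOn I J n f U) (hg : ContMDiffOn J I n g V)
    (hgf : ∀ x ∈ U, f x ∈ V → g (f x) = x) (hfg : ∀ y ∈ V, g y ∈ U → f (g y) = y)
    {x : P} (hx : x ∈ U) (hx' : f x ∈ V) : IsLocalDiffeomorphAt I J n f x :=
  ⟨PartialDiffeomorph.ofLocalInverse hU hV hf hg hgf hfg, ⟨hx, hx'⟩, fun _ _ => rfl⟩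

lemma IsLocalDiffeomorphAt.exists_source_subset {f : P → P'} {x : P}
    (hf : IsLocalDiffeomorphAt I J n f x) {W : Set P} (hW : IsOpen W) (hx : x ∈ W) :
    ∃ Φ : PartialDiffeomorph I J P P' n, x ∈ Φ.source ∧ Φ.source ⊆ W ∧
      ∀ y ∈ Φ.source, f y = Φ y := by
  obtain ⟨Φ, hxΦ, hΦ⟩ := hf
  refine ⟨PartialDiffeomorph.ofLocalInverse (f := Φ) (g := Φ.invFun) (U := Φ.source ∩ W)
    (V := Φ.target) (Φ.open_source.inter hW) Φ.open_target
    (Φ.contMDiffOn_toFun.mono Set.inter_subset_left) Φ.contMDiffOn_invFun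
    (fun y hy _ => Φ.left_inv' hy.1) (fun y hy _ => Φ.right_inv' hy), ⟨⟨hxΦ, hx⟩,
    Φ.map_source' hxΦ⟩, fun y hy => hy.1.2, fun y hy => hΦ hy.1.1⟩

end LocalDiffeomorphism

/-! ### Suspensions -/

lemma MappingTorus.mk_eq_mk_iff {N : Type*} {f : N ≃ N} {r : N → ℝ} {p q : N × ℝ} :
    MappingTorus.mk f r p = MappingTorus.mk f r q ↔ ∃ k : ℤ, (suspensionDeck f r ^ k) p = q :=
  Quotient.eq

/-- Each deck step lowers the height by a positive value of the roof. -/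
lemma suspensionDeck_pow_snd_lt {N : Type*} {f : N ≃ N} {r : N → ℝ} (hr : ∀ x, 0 < r x)
    (k : ℕ) (p : N × ℝ) : ((suspensionDeck f r ^ (k + 1)) p).2 < p.2 := by
  induction k with
  | zero =>
    rw [zero_add, pow_one]
    exact sub_lt_self _ (hr _)
  | succ k ih =>
    rw [pow_succ', Equiv.Perm.mul_apply]
    exact (sub_lt_self _ (hr _)).trans ih

/-- Two points of `N × ℝ` over the same point of the mapping torus and at the same height agree. -/
lemma suspensionDeck_eq_of_snd_eq {N : Type*} {f : N ≃ N} {r : N → ℝ} (hr : ∀ x, 0 < r x)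
    {k : ℤ} {p q : N × ℝ} (h : (suspensionDeck f r ^ k) p = q) (h2 : p.2 = q.2) : p = q := by
  obtain ⟨_ | k, rfl | rfl⟩ := k.eq_nat_or_neg
  · simpa using h
  · simpa using h
  · have := suspensionDeck_pow_snd_lt (f := f) hr k p
    rw [zpow_natCast] at h
    rw [h, h2] at this
    exact absurd this (lt_irrefl _)
  · have := suspensionDeck_pow_snd_lt (f := f) hr k q
    rw [zpow_neg, Equiv.Perm.inv_eq_iff_eq, zpow_natCast] at h
    rw [← h, h2] at this
    exact absurd this (lt_irrefl _)

namespace SuspensionPresentation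

variable {n m : ℕ} {N M : Type*} [TopologicalSpace N] [ChartedSpace (EuclideanSpace ℝ (Fin n)) N]
  [TopologicalSpace M] [ChartedSpace (EuclideanSpace ℝ (Fin m)) M]
  {φ : Flow ℝ M} {f : N ≃ₘ^∞⟮𝓡 n, 𝓡 n⟯ N} {r : N → ℝ}
  (S : SuspensionPresentation (m := m) φ f r)

/-- The class of `(x, s)` is reached from that of `(x, 0)` in time `s`. From here on the mapping
torus is handled through the flow and the cross-section. -/
lemma toEquiv_mk (p : N × ℝ) :
    S.toEquiv (MappingTorus.mk f.toEquiv r p) = φ p.2 (S.crossSection p.1) := by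
  have h := S.map_flow p.2 (MappingTorus.mk f.toEquiv r (p.1, 0))
  have h2 : suspensionFlow f.toEquiv r p.2 (MappingTorus.mk f.toEquiv r (p.1, 0)) =
      MappingTorus.mk f.toEquiv r (p.1, 0 + p.2) := rfl
  rw [h2, zero_add] at h
  exact h

lemma flow_eq_iff {p q : N × ℝ} : φ p.2 (S.crossSection p.1) = φ q.2 (S.crossSection q.1) ↔
    ∃ k : ℤ, (suspensionDeck f.toEquiv r ^ k) p = q := by
  rw [← S.toEquiv_mk, ← S.toEquiv_mk, S.toEquiv.apply_eq_iff_eq, MappingTorus.mk_eq_mk_iff]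

lemma crossSection_injective : Function.Injective S.crossSection := by
  intro x y h
  obtain ⟨k, hk⟩ := (S.flow_eq_iff (p := (x, 0)) (q := (y, 0))).1 (by simpa using h)
  exact congrArg Prod.fst (suspensionDeck_eq_of_snd_eq S.roof_pos hk rfl)

lemma flow_roof (x : N) : φ (r x) (S.crossSection x) = S.crossSection (f x) := by
  have h := (S.flow_eq_iff (p := (x, r x)) (q := (f x, 0))).2 ⟨1, by
    rw [zpow_one]
    exact Prod.ext rfl (sub_self _)⟩
  simpa using h

lemma exists_flow_eq (y : M) : ∃ p : N × ℝ, φ p.2 (S.crossSection p.1) = y := by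
  obtain ⟨q, hq⟩ := S.toEquiv.surjective y
  obtain ⟨p, rfl⟩ := Quotient.exists_rep q
  exact ⟨p, (S.toEquiv_mk p).symm.trans hq⟩

lemma isLocalDiffeomorph_flow : IsLocalDiffeomorph ((𝓡 n).prod 𝓘(ℝ, ℝ)) (𝓡 m) ∞
    (fun p : N × ℝ => φ p.2 (S.crossSection p.1)) := by
  have := S.isLocalDiffeomorph
  simp only [S.toEquiv_mk] at this
  exact this

lemma contMDiff_crossSection : ContMDiff (𝓡 n) (𝓡 m) ∞ S.crossSection :=
  S.isLocalDiffeomorph.contMDiff.comp (contMDiff_id.prodMk contMDiff_const)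

/-- The cross-section has smooth local retractions. -/
lemma exists_retraction [CompactSpace N] [T2Space M] (x : N) :
    ∃ (O : Set M) (ρ : M → N), IsOpen O ∧ S.crossSection x ∈ O ∧ ContMDiffOn (𝓡 m) (𝓡 n) ∞ ρ O ∧
      ∀ y, S.crossSection y ∈ O → ρ (S.crossSection y) = y := by
  obtain ⟨Φ, hx, -, hΦ⟩ := (S.isLocalDiffeomorph_flow (x, 0)).exists_source_subset isOpen_univ
    (Set.mem_univ _)
  have hemb : Topology.IsClosedEmbedding S.crossSection :=
    S.contMDiff_crossSection.continuous.isClosedEmbedding S.crossSection_injective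
  -- The cross-section could re-enter `Φ.target` far from `x`, at a nonzero height in the
  -- coordinates of `Φ`. As it is embedded, `O` can be chosen to meet it only in points `y` with
  -- `(y, 0)` in the source of `Φ`.
  obtain ⟨O, hO, hO'⟩ := hemb.isInducing.isOpen_iff.1
    (Φ.open_source.preimage (Continuous.prodMk_left (X := N) (0 : ℝ)))
  have h0 : ∀ y, (y, (0 : ℝ)) ∈ Φ.source → S.crossSection y = Φ (y, 0) := fun y hy => by
    rw [← hΦ _ hy, φ.map_zero_apply]
  have hmem : ∀ y, S.crossSection y ∈ O ↔ (y, (0 : ℝ)) ∈ Φ.source := fun y =>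
    Set.ext_iff.1 hO' y
  refine ⟨O ∩ Φ.target, fun y => (Φ.invFun y).1, hO.inter Φ.open_target, ⟨(hmem x).2 hx, ?_⟩,
    contMDiff_fst.comp_contMDiffOn (Φ.contMDiffOn_invFun.mono Set.inter_subset_right),
    fun y hy => ?_⟩
  · rw [h0 x hx]
    exact Φ.map_source' hx
  · have hy' := (hmem y).1 hy.1
    simp only [h0 y hy']
    exact congrArg Prod.fst (Φ.left_inv' hy')

end SuspensionPresentation

/-! ### Torus bundles -/

lemma toTorus_surjective {d : ℕ} : Function.Surjective (toTorus (d := d)) := fun z => by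
  choose v hv using fun i => QuotientAddGroup.mk_surjective (z i)
  exact ⟨WithLp.toLp 2 v, funext hv⟩

section TorusBundle

variable {m k d : ℕ} {M E : Type*} [TopologicalSpace M] [ChartedSpace (EuclideanSpace ℝ (Fin m)) M]
  [TopologicalSpace E] [ChartedSpace (EuclideanSpace ℝ (Fin k)) E] {proj : E → M}

/-- Smooth coordinates take the fibre variable in ℝ^d, through the covering of the torus. On the
source, `proj` becomes the first projection. -/
lemma IsSmoothTorusTrivialization.exists_partialDiffeomorph
    {e : Bundle.Trivialization (UnitAddTorus (Fin d)) proj}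
    (he : IsSmoothTorusTrivialization (m := m) (k := k) e) {y : M} (hy : y ∈ e.baseSet)
    (v : EuclideanSpace ℝ (Fin d)) :
    ∃ Φ : PartialDiffeomorph ((𝓡 m).prod (𝓡 d)) (𝓡 k) (M × EuclideanSpace ℝ (Fin d)) E ∞,
      (y, v) ∈ Φ.source ∧ ∀ p ∈ Φ.source, p.1 ∈ e.baseSet ∧
        Φ p = e.toOpenPartialHomeomorph.symm (p.1, toTorus p.2) ∧ proj (Φ p) = p.1 := by
  obtain ⟨Φ, hΦ, hsub, heq⟩ := (he ⟨(y, v), hy, trivial⟩).exists_source_subset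
    (e.open_baseSet.preimage (continuous_fst (X := M) (Y := EuclideanSpace ℝ (Fin d)))) hy
  refine ⟨Φ, hΦ, fun p hp => ⟨hsub hp, (heq p hp).symm, ?_⟩⟩
  rw [← heq p hp]
  exact e.proj_symm_apply' (hsub hp)

lemma Bundle.Trivialization.symm_proj_snd {e : Bundle.Trivialization (UnitAddTorus (Fin d)) proj}
    {x : E} (hx : proj x ∈ e.baseSet) :
    e.toOpenPartialHomeomorph.symm (proj x, (e x).2) = x := by
  have hx' := e.mem_source.2 hx
  rw [← e.coe_fst hx']
  exact e.toOpenPartialHomeomorph.left_inv hx'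

lemma IsAffineTorusBundle.exists_partialDiffeomorph
    (h : IsAffineTorusBundle (m := m) (k := k) d proj) (x : E) :
    ∃ (e : Bundle.Trivialization (UnitAddTorus (Fin d)) proj) (v : EuclideanSpace ℝ (Fin d))
      (Φ : PartialDiffeomorph ((𝓡 m).prod (𝓡 d)) (𝓡 k) (M × EuclideanSpace ℝ (Fin d)) E ∞),
      (proj x, v) ∈ Φ.source ∧ Φ (proj x, v) = x ∧ ∀ p ∈ Φ.source, p.1 ∈ e.baseSet ∧
        Φ p = e.toOpenPartialHomeomorph.symm (p.1, toTorus p.2) ∧ proj (Φ p) = p.1 := by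
  obtain ⟨S, hS, hsm, -⟩ := h
  obtain ⟨e, he, hx⟩ := hS (proj x)
  obtain ⟨v, hv⟩ := toTorus_surjective (e x).2
  obtain ⟨Φ, hΦ, h⟩ := (hsm e he).exists_partialDiffeomorph hx v
  refine ⟨e, v, Φ, hΦ, ?_, h⟩
  rw [(h _ hΦ).2.1, hv]
  exact Bundle.Trivialization.symm_proj_snd hx

lemma IsAffineTorusBundle.contMDiff (h : IsAffineTorusBundle (m := m) (k := k) d proj) :
    ContMDiff (𝓡 k) (𝓡 m) ∞ proj := fun x => by
  obtain ⟨e, v, Φ, hΦ, hx, hp⟩ := h.exists_partialDiffeomorph x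
  have hx' : x ∈ Φ.target := by rw [← hx]; exact Φ.map_source' hΦ
  refine ((contMDiff_fst.comp_contMDiffOn Φ.contMDiffOn_invFun).contMDiffAt
    (Φ.open_target.mem_nhds hx')).congr_of_eventuallyEq ?_
  filter_upwards [Φ.open_target.mem_nhds hx'] with y hy
  have := (hp _ (Φ.map_target' hy)).2.2
  rw [show Φ (Φ.invFun y) = y from Φ.right_inv' hy] at this
  exact this

lemma IsAffineTorusBundle.surjective (h : IsAffineTorusBundle (m := m) (k := k) d proj) :
    Function.Surjective proj := fun x => by
  obtain ⟨S, hS, -⟩ := h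
  obtain ⟨e, -, hx⟩ := hS x
  exact ⟨_, e.proj_symm_apply' (x := 0) hx⟩

end TorusBundle

/-! ### The preimage of a cross-section in a torus bundle -/

section Preimage

variable {n m d k j : ℕ} {N M E : Type*}
  [TopologicalSpace N] [ChartedSpace (EuclideanSpace ℝ (Fin n)) N]
  [TopologicalSpace M] [ChartedSpace (EuclideanSpace ℝ (Fin m)) M]
  [TopologicalSpace E] [ChartedSpace (EuclideanSpace ℝ (Fin k)) E]
  {proj : E → M} {φ : Flow ℝ M} {Ψ : Flow ℝ E} {f : N ≃ₘ^∞⟮𝓡 n, 𝓡 n⟯ N} {r : N → ℝ}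
  {S : SuspensionPresentation (m := m) φ f r}

/-- Local parametrizations of the preimage of the cross-section, by a chart of the cross-section
and the coordinates of the fibers. -/
lemma SuspensionPresentation.nonempty_localParametrization [IsManifold (𝓡 n) ∞ N]
    [CompactSpace N] [T2Space M] (S : SuspensionPresentation (m := m) φ f r)
    (hproj : IsAffineTorusBundle (m := m) (k := k) d proj) :
    ∀ x ∈ proj ⁻¹' Set.range S.crossSection,
      Nonempty (LocalParametrization (n + d) k (proj ⁻¹' Set.range S.crossSection) x) := by
  rintro x ⟨y, hy⟩
  -- The retraction `ρ` extends the coordinates of `N` to an open set of `M`. This lets `coord` be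
  -- defined on an open set of `E` and not only on the preimage.
  obtain ⟨O, ρ, hO, hyO, hρ, hρι⟩ := S.exists_retraction y
  obtain ⟨e, v, Φ, hΦ, hx, hp⟩ := hproj.exists_partialDiffeomorph x
  have lin : EuclideanSpace ℝ (Fin (n + d)) ≃L[ℝ]
      EuclideanSpace ℝ (Fin n) × EuclideanSpace ℝ (Fin d) :=
    ContinuousLinearEquiv.ofFinrankEq (by simp)
  set κ := chartAt (EuclideanSpace ℝ (Fin n)) y
  have hκ : ContMDiffOn (𝓡 n) (𝓡 n) ∞ κ κ.source := contMDiffOn_chart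
  have hκ' : ContMDiffOn (𝓡 n) (𝓡 n) ∞ κ.symm κ.target := contMDiffOn_chart_symm
  have hxt : x ∈ Φ.target := by rw [← hx]; exact Φ.map_source' hΦ
  have hsrc : IsOpen (proj ⁻¹' (O ∩ ρ ⁻¹' κ.source)) :=
    (hρ.continuousOn.isOpen_inter_preimage hO κ.open_source).preimage hproj.contMDiff.continuous
  set g : EuclideanSpace ℝ (Fin (n + d)) → M × EuclideanSpace ℝ (Fin d) :=
    fun u => (S.crossSection (κ.symm (lin u).1), (lin u).2)
  have hg : ContMDiffOn (𝓡 (n + d)) ((𝓡 m).prod (𝓡 d)) ∞ g {u | (lin u).1 ∈ κ.target} := by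
    have h1 : ContMDiff (𝓡 (n + d)) (𝓡 n) ∞ fun u => (lin u).1 :=
      (contDiff_fst.comp lin.contDiff).contMDiff
    have h2 : ContMDiff (𝓡 (n + d)) (𝓡 d) ∞ fun u => (lin u).2 :=
      (contDiff_snd.comp lin.contDiff).contMDiff
    exact (S.contMDiff_crossSection.comp_contMDiffOn
      (hκ'.comp h1.contMDiffOn fun u hu => hu)).prodMk h2.contMDiffOn
  have hgo : IsOpen {u | (lin u).1 ∈ κ.target} :=
    κ.open_target.preimage (continuous_fst.comp lin.continuous)
  have hinv : ∀ z ∈ Φ.target, (Φ.invFun z).1 = proj z := fun z hz => by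
    have := (hp _ (Φ.map_target' hz)).2.2
    rw [show Φ (Φ.invFun z) = z from Φ.right_inv' hz] at this
    exact this.symm
  have hρy : ρ (proj x) = y := by rw [← hy]; exact hρι y hyO
  exact ⟨{
    coord := fun z => lin.symm (κ (ρ (proj z)), (Φ.invFun z).2)
    param := fun u => Φ (g u)
    source := Φ.target ∩ proj ⁻¹' (O ∩ ρ ⁻¹' κ.source)
    target := {u | (lin u).1 ∈ κ.target} ∩ g ⁻¹' Φ.source
    isOpen_source := Φ.open_target.inter hsrc
    isOpen_target := hg.continuousOn.isOpen_inter_preimage hgo Φ.open_source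
    mem_source := ⟨hxt, by rw [← hy]; exact hyO, by
      change ρ (proj x) ∈ κ.source
      rw [hρy]; exact mem_chart_source _ y⟩
    coord_mem_target := by
      refine ⟨?_, ?_⟩
      · rw [Set.mem_ofPred_eq, lin.apply_symm_apply, hρy]
        exact mem_chart_target _ y
      · have h1 : Φ.invFun x = (proj x, v) := by
          rw [← hx]
          exact (Φ.left_inv' hΦ).trans (by rw [hx])
        simp only [g, Set.mem_preimage, lin.apply_symm_apply, hρy]
        rw [κ.left_inv (mem_chart_source _ y), h1, hy]
        exact hΦ
    contMDiffOn_coord := by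
      refine lin.symm.contDiff.contMDiff.comp_contMDiffOn (ContMDiffOn.prodMk_space ?_ ?_)
      · exact hκ.comp (hρ.comp hproj.contMDiff.contMDiffOn fun z hz => hz.2.1)
          fun z hz => hz.2.2
      · exact contMDiff_snd.comp_contMDiffOn (Φ.contMDiffOn_invFun.mono Set.inter_subset_left)
    contMDiffOn_param := Φ.contMDiffOn_toFun.comp (hg.mono Set.inter_subset_left)
      fun u hu => hu.2
    param_mem := fun u hu => ⟨_, (hp _ hu.2).2.2.symm⟩
    coord_param := fun u hu hu' => by
      have h1 : Φ.invFun (Φ (g u)) = g u := Φ.left_inv' hu.2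
      have h2 : proj (Φ (g u)) = S.crossSection (κ.symm (lin u).1) := (hp _ hu.2).2.2
      have h3 : ρ (proj (Φ (g u))) = κ.symm (lin u).1 := by
        rw [h2]
        refine hρι _ ?_
        rw [← h2]
        exact hu'.2.1
      rw [h1, h3, κ.right_inv hu.1]
      exact lin.symm_apply_apply u
    param_coord := by
      rintro z hz ⟨w, hw⟩ -
      have h1 : ρ (proj z) = w := by
        rw [← hw]
        refine hρι _ ?_
        rw [hw]
        exact hz.2.1
      have h2 : w ∈ κ.source := by rw [← h1]; exact hz.2.2
      simp only [g, lin.apply_symm_apply]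
      rw [h1, κ.left_inv h2, hw, ← hinv z hz.1]
      exact Φ.right_inv' hz.1 }⟩

variable {p : proj ⁻¹' Set.range S.crossSection → N}

lemma proj_flow (hΨ : ∀ t e, proj (Ψ t e) = φ t (proj e)) (hp : ∀ e, S.crossSection (p e) = proj e)
    (t : ℝ) (x : proj ⁻¹' Set.range S.crossSection) :
    proj (Ψ t x) = φ t (S.crossSection (p x)) := by
  rw [hΨ, hp]

lemma surjective_of_crossSection_eq {E : Type*} {proj : E → M}
    {p : proj ⁻¹' Set.range S.crossSection → N} (hproj : Function.Surjective proj)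
    (hp : ∀ e, S.crossSection (p e) = proj e) : Function.Surjective p := fun y => by
  obtain ⟨e, he⟩ := hproj (S.crossSection y)
  exact ⟨⟨e, y, he.symm⟩, S.crossSection_injective ((hp _).trans he)⟩

variable [ChartedSpace (EuclideanSpace ℝ (Fin j)) (proj ⁻¹' Set.range S.crossSection)]

/-- Locally `p` is `ρ ∘ proj` for a smooth retraction `ρ` onto the cross-section. -/
lemma contMDiff_of_crossSection_eq [CompactSpace N] [T2Space M]
    (hX : IsSmoothSubmanifold j k (proj ⁻¹' Set.range S.crossSection))
    (hproj : ContMDiff (𝓡 k) (𝓡 m) ∞ proj) (hp : ∀ e, S.crossSection (p e) = proj e) :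
    ContMDiff (𝓡 j) (𝓡 n) ∞ p := fun x => by
  obtain ⟨O, ρ, hO, hxO, hρ, hρι⟩ := S.exists_retraction (p x)
  rw [hp] at hxO
  have h1 : ContMDiffAt (𝓡 j) (𝓡 m) ∞
      (fun z : proj ⁻¹' Set.range S.crossSection => proj z) x := (hproj.comp hX.1) x
  refine (ContMDiffAt.comp x (hρ.contMDiffAt (hO.mem_nhds hxO)) h1).congr_of_eventuallyEq ?_
  filter_upwards [h1.continuousAt.eventually (hO.mem_nhds hxO)] with z hz
  have hz' : proj z ∈ O := hz
  rw [Function.comp_apply, ← hp, hρι _ (by rwa [hp])]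

end Preimage

/-! ### Restriction of an affine torus bundle to a submanifold of the base -/

section RestrictedBundle

variable {d : ℕ} {N M E : Type*} [TopologicalSpace N] [TopologicalSpace M] [TopologicalSpace E]
  {proj : E → M} {ι : N → M} {p : proj ⁻¹' Set.range ι → N}

open Classical in
/-- The restriction of a local trivialization to the preimage of an injectively immersed
submanifold of the base. -/
noncomputable def Bundle.Trivialization.restrictRange
    (e : Bundle.Trivialization (UnitAddTorus (Fin d)) proj) (hι : Continuous ι)
    (hinj : Function.Injective ι) (hp : ∀ x, ι (p x) = proj x) (hpc : Continuous p)
    (hps : Function.Surjective p) : Bundle.Trivialization (UnitAddTorus (Fin d)) p where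
  toFun x := (p x, (e x).2)
  -- Off the base set any point will do; surjectivity of `p` provides one.
  invFun q := if h : ι q.1 ∈ e.baseSet then ⟨e.toOpenPartialHomeomorph.symm (ι q.1, q.2),
    q.1, (e.proj_symm_apply' h).symm⟩ else Function.surjInv hps q.1
  source := p ⁻¹' (ι ⁻¹' e.baseSet)
  target := (ι ⁻¹' e.baseSet) ×ˢ Set.univ
  map_source' x hx := ⟨hx, trivial⟩
  map_target' q hq := by
    have hq' : ι q.1 ∈ e.baseSet := hq.1
    rw [dif_pos hq', Set.mem_preimage, Set.mem_preimage, hp]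
    simpa only [e.proj_symm_apply' hq'] using hq'
  left_inv' x hx := by
    have hx' : ι (p x) ∈ e.baseSet := hx
    rw [dif_pos hx']
    refine Subtype.ext ?_
    have hx'' : proj x ∈ e.baseSet := hp x ▸ hx'
    have hx3 := e.mem_source.2 hx''
    change e.toOpenPartialHomeomorph.symm (ι (p x), (e x).2) = x
    rw [hp, ← e.coe_fst hx3]
    exact e.toOpenPartialHomeomorph.left_inv hx3
  right_inv' q hq := by
    have hq' : ι q.1 ∈ e.baseSet := hq.1
    rw [dif_pos hq']
    refine Prod.ext (hinj ?_) ?_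
    · rw [hp]
      exact e.proj_symm_apply' hq'
    · exact congrArg (fun u : M × UnitAddTorus (Fin d) => u.2)
        (e.apply_symm_apply' (x := q.2) hq')
  open_source := (e.open_baseSet.preimage hι).preimage hpc
  open_target := (e.open_baseSet.preimage hι).prod isOpen_univ
  continuousOn_toFun := by
    refine hpc.continuousOn.prodMk (continuous_snd.comp_continuousOn
      (e.continuousOn_toFun.comp continuous_subtype_val.continuousOn fun x hx => ?_))
    have hx' : ι (p x) ∈ e.baseSet := hx
    rw [hp] at hx'
    exact e.mem_source.2 hx'
  continuousOn_invFun := by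
    rw [Topology.IsInducing.subtypeVal.continuousOn_iff]
    have h1 : ContinuousOn (fun q : N × UnitAddTorus (Fin d) =>
        e.toOpenPartialHomeomorph.symm (ι q.1, q.2)) ((ι ⁻¹' e.baseSet) ×ˢ Set.univ) :=
      e.toOpenPartialHomeomorph.continuousOn_symm.comp
        ((hι.comp continuous_fst).prodMk continuous_snd).continuousOn
        fun q hq => e.mem_target.2 hq.1
    refine h1.congr fun q hq => ?_
    have hq' : ι q.1 ∈ e.baseSet := hq.1
    rw [Function.comp_apply, dif_pos hq']
  baseSet := ι ⁻¹' e.baseSet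
  open_baseSet := e.open_baseSet.preimage hι
  source_eq := rfl
  target_eq := rfl
  proj_toFun _ _ := rfl

variable {e : Bundle.Trivialization (UnitAddTorus (Fin d)) proj} {hι : Continuous ι}
    {hinj : Function.Injective ι} {hp : ∀ x, ι (p x) = proj x} {hpc : Continuous p}
    {hps : Function.Surjective p}

lemma Bundle.Trivialization.restrictRange_symm {q : N × UnitAddTorus (Fin d)}
    (hq : ι q.1 ∈ e.baseSet) :
    (((e.restrictRange hι hinj hp hpc hps).toOpenPartialHomeomorph.symm q :
      proj ⁻¹' Set.range ι) : E) = e.toOpenPartialHomeomorph.symm (ι q.1, q.2) :=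
  congrArg Subtype.val (dif_pos hq)

variable {n m k j : ℕ} [ChartedSpace (EuclideanSpace ℝ (Fin n)) N]
  [ChartedSpace (EuclideanSpace ℝ (Fin m)) M] [ChartedSpace (EuclideanSpace ℝ (Fin k)) E]
  [ChartedSpace (EuclideanSpace ℝ (Fin j)) (proj ⁻¹' Set.range ι)]

/-- The restricted map is `Φ ∘ (ι × id)`, smooth into the submanifold because it is smooth into `E`.
Its inverse takes the base coordinate from `p` and the fibre coordinate from `Φ⁻¹`. -/
lemma IsSmoothTorusTrivialization.restrictRange
    (he : IsSmoothTorusTrivialization (m := m) (k := k) e)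
    (hX : IsSmoothSubmanifold j k (proj ⁻¹' Set.range ι)) (hιs : ContMDiff (𝓡 n) (𝓡 m) ∞ ι)
    (hpsm : ContMDiff (𝓡 j) (𝓡 n) ∞ p) :
    IsSmoothTorusTrivialization (m := n) (k := j) (e.restrictRange hι hinj hp hpc hps) := by
  rintro ⟨⟨x, v⟩, hx, -⟩
  have hx' : ι x ∈ e.baseSet := hx
  obtain ⟨Φ, hΦ, h⟩ := he.exists_partialDiffeomorph hx' v
  set a : N × EuclideanSpace ℝ (Fin d) → M × EuclideanSpace ℝ (Fin d) := fun q => (ι q.1, q.2)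
  have ha : ContMDiff ((𝓡 n).prod (𝓡 d)) ((𝓡 m).prod (𝓡 d)) ∞ a :=
    (hιs.comp contMDiff_fst).prodMk contMDiff_snd
  set q : N × EuclideanSpace ℝ (Fin d) → proj ⁻¹' Set.range ι := fun y =>
    (e.restrictRange hι hinj hp hpc hps).toOpenPartialHomeomorph.symm (y.1, toTorus y.2)
  have hq : ∀ y, a y ∈ Φ.source → (q y : E) = Φ (a y) := fun y hy => by
    rw [(h _ hy).2.1]
    exact Bundle.Trivialization.restrictRange_symm (h _ hy).1
  have hU : IsOpen (a ⁻¹' Φ.source) := Φ.open_source.preimage ha.continuous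
  refine isLocalDiffeomorphAt_of_local_inverse (f := q)
    (g := fun z : proj ⁻¹' Set.range ι => (p z, (Φ.invFun z).2))
    hU (Φ.open_target.preimage continuous_subtype_val) ?_ ?_ ?_ ?_ hΦ ?_
  · intro y hy
    refine (hX.contMDiffAt_of_val ?_).contMDiffWithinAt
    refine (((Φ.contMDiffOn_toFun.contMDiffAt (Φ.open_source.mem_nhds hy)).comp y
      (ha y))).congr_of_eventuallyEq ?_
    filter_upwards [hU.mem_nhds hy] with z hz using hq z hz
  · exact hpsm.contMDiffOn.prodMk (contMDiff_snd.comp_contMDiffOn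
      (Φ.contMDiffOn_invFun.comp hX.1.contMDiffOn fun z hz => hz))
  · intro y hy _
    refine Prod.ext (hinj ?_) ?_
    · rw [hp, hq y hy]
      exact (h _ hy).2.2
    · rw [hq y hy]
      exact congrArg (fun u : M × EuclideanSpace ℝ (Fin d) => u.2) (Φ.left_inv' hy)
  · intro z hz hz'
    refine Subtype.ext ?_
    rw [hq _ hz']
    have hz2 : (z : E) ∈ Φ.target := hz
    have h1 : Φ (Φ.invFun z) = z := Φ.right_inv' hz2
    have h2 := (h _ (Φ.map_target' hz2)).2.2
    rw [h1] at h2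
    simp only [a, hp, h2]
    exact h1
  · rw [Set.mem_preimage, hq _ hΦ]
    exact Φ.map_source' hΦ

/-- The transition functions are `A ∘ ι` and `v ∘ ι`; continuity of `ι` keeps the linear part
locally constant. -/
lemma IsAffineTorusBundle.restrictRange (hproj : IsAffineTorusBundle (m := m) (k := k) d proj)
    (hX : IsSmoothSubmanifold j k (proj ⁻¹' Set.range ι)) (hιs : ContMDiff (𝓡 n) (𝓡 m) ∞ ι)
    (hinj : Function.Injective ι) (hp : ∀ x, ι (p x) = proj x)
    (hpsm : ContMDiff (𝓡 j) (𝓡 n) ∞ p) (hps : Function.Surjective p) :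
    IsAffineTorusBundle (m := n) (k := j) d p := by
  obtain ⟨T, hT, hTs, hTA⟩ := hproj
  have hι := hιs.continuous
  refine ⟨(fun e => e.restrictRange hι hinj hp hpsm.continuous hps) '' T, fun x => ?_, ?_, ?_⟩
  · obtain ⟨e, he, hx⟩ := hT (ι x)
    exact ⟨_, ⟨e, he, rfl⟩, hx⟩
  · rintro _ ⟨e, he, rfl⟩
    exact (hTs e he).restrictRange hX hιs hpsm
  · rintro _ ⟨e, he, rfl⟩ _ ⟨e', he', rfl⟩
    obtain ⟨A, v, hA, hv, hAv⟩ := hTA e he e' he'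
    refine ⟨A ∘ ι, v ∘ ι, fun x hx => hι.continuousAt.eventually (hA _ hx),
      hv.comp hι.continuousOn fun x hx => hx, fun x hx z => ?_⟩
    have h1 := Bundle.Trivialization.restrictRange_symm (hι := hι) (hinj := hinj) (hp := hp)
      (hpc := hpsm.continuous) (hps := hps) (q := (x, z)) (e := e) hx.1
    refine Prod.ext (hinj ?_) ?_
    · exact (hp _).trans ((congrArg proj h1).trans (e.proj_symm_apply' hx.1))
    · exact (congrArg (fun y => (e' y).2) h1).trans (congrArg Prod.snd (hAv _ hx z))

end RestrictedBundle

/-! ### The derivative cocycle of a diffeomorphism -/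

section DerivativeCocycle

variable {n : ℕ} {M : Type*} [TopologicalSpace M] [ChartedSpace (EuclideanSpace ℝ (Fin n)) M]
  (D : M ≃ₘ^∞⟮𝓡 n, 𝓡 n⟯ M)

/-- A diffeomorphism as a permutation. -/
def Diffeomorph.toPerm : Equiv.Perm M := D.toEquiv

lemma Diffeomorph.contMDiff_toPerm_zpow (k : ℤ) :
    ContMDiff (𝓡 n) (𝓡 n) ∞ ⇑(D.toPerm ^ k) := by
  induction k with
  | zero => exact contMDiff_id
  | succ k ih =>
    rw [zpow_add_one, Equiv.Perm.coe_mul]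
    exact ih.comp D.contMDiff
  | pred k ih =>
    rw [zpow_sub_one, Equiv.Perm.coe_mul]
    exact ih.comp D.symm.contMDiff

lemma Diffeomorph.coe_toPerm_zpow_natCast (k : ℕ) : ⇑(D.toPerm ^ (k : ℤ)) = D^[k] := by
  rw [zpow_natCast, ← Equiv.Perm.iterate_eq_pow]
  rfl

lemma Diffeomorph.coe_toPerm_zpow_neg (k : ℕ) : ⇑(D.toPerm ^ (-k : ℤ)) = D.symm^[k] := by
  rw [zpow_neg, ← inv_zpow, zpow_natCast, ← Equiv.Perm.iterate_eq_pow]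
  rfl

/-- The derivatives of the iterates of a diffeomorphism. -/
noncomputable def Diffeomorph.cocycle (k : ℤ) (x : M) :
    EuclideanSpace ℝ (Fin n) →ₗ[ℝ] EuclideanSpace ℝ (Fin n) :=
  (mfderiv (𝓡 n) (𝓡 n) ⇑(D.toPerm ^ k) x).toLinearMap

lemma Diffeomorph.cocycle_zero (x : M) (v : EuclideanSpace ℝ (Fin n)) : D.cocycle 0 x v = v := by
  have : mfderiv (𝓡 n) (𝓡 n) ⇑(D.toPerm ^ (0 : ℤ)) x = ContinuousLinearMap.id ℝ _ := mfderiv_id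
  exact DFunLike.congr_fun this v

lemma Diffeomorph.cocycle_add (k l : ℤ) (x : M) (v : EuclideanSpace ℝ (Fin n)) :
    D.cocycle (k + l) x v = D.cocycle k ((D.toPerm ^ l) x) (D.cocycle l x v) := by
  have h : ⇑(D.toPerm ^ (k + l)) = ⇑(D.toPerm ^ k) ∘ ⇑(D.toPerm ^ l) := by
    rw [zpow_add, Equiv.Perm.coe_mul]
  have := mfderiv_comp x ((D.contMDiff_toPerm_zpow k _).mdifferentiableAt (by simp))
    ((D.contMDiff_toPerm_zpow l x).mdifferentiableAt (by simp))
  rw [← h] at this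
  exact DFunLike.congr_fun this v

lemma Diffeomorph.cocycle_neg_one (x : M) (v : EuclideanSpace ℝ (Fin n)) :
    D.cocycle (-1) (D x) (D.cocycle 1 x v) = v := by
  have h := D.cocycle_add (-1) 1 x v
  rw [neg_add_cancel, D.cocycle_zero] at h
  exact h.symm

/-- An invariant family of subspaces is invariant under all the iterates. -/
lemma Diffeomorph.cocycle_mem {V : ∀ x : M, Submodule ℝ (TangentSpace (𝓡 n) x)}
    (hV : ∀ x, (V x).map (mfderiv (𝓡 n) (𝓡 n) D x).toLinearMap = V (D x)) (k : ℤ) (x : M)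
    (v : EuclideanSpace ℝ (Fin n)) (hv : v ∈ V x) : D.cocycle k x v ∈ V ((D.toPerm ^ k) x) := by
  have h1 : ∀ x (v : EuclideanSpace ℝ (Fin n)), v ∈ V x → D.cocycle 1 x v ∈ V (D x) :=
    fun x v hv => by
      rw [← hV]
      exact ⟨v, hv, rfl⟩
  -- Backward invariance uses that `hV` is an equality of subspaces and not merely an inclusion.
  have h2 : ∀ x (v : EuclideanSpace ℝ (Fin n)), v ∈ V x → D.cocycle (-1) x v ∈ V (D.symm x) := by
    intro x v hv
    have hx : D (D.symm x) = x := D.apply_symm_apply x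
    rw [← hx, ← hV] at hv
    obtain ⟨w, hw, hwv⟩ := hv
    have h3 := D.cocycle_neg_one (D.symm x) w
    rw [hx] at h3
    have h4 : D.cocycle (-1) x v = w := (congrArg (D.cocycle (-1) x) hwv).symm.trans h3
    exact (congrArg (· ∈ V (D.symm x)) h4).mpr hw
  induction k generalizing x v with
  | zero => rw [D.cocycle_zero]; exact hv
  | succ k ih =>
    rw [D.cocycle_add, zpow_add, Equiv.Perm.mul_apply]
    exact ih _ _ (h1 x v hv)
  | pred k ih =>
    rw [sub_eq_add_neg, D.cocycle_add, zpow_add, Equiv.Perm.mul_apply]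
    exact ih _ _ (h2 x v hv)

end DerivativeCocycle

/-! ### Derivatives along vertical vectors -/

section Vertical

variable {k : ℕ} {E : Type*} [TopologicalSpace E] [ChartedSpace (EuclideanSpace ℝ (Fin k)) E]
  {Ψ : Flow ℝ E}

/-- The derivative of the joint flow map is the sum of its time and space partials, and the time
partial drops out when the time is stationary along `v`. This permits a variable return time to be
frozen on vertical vectors. -/
lemma IsSmoothFlow.mfderiv_comp_of_eq_zero (h : IsSmoothFlow (m := k) Ψ)
    {F H P : Type*} [NormedAddCommGroup F] [NormedSpace ℝ F] [TopologicalSpace H]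
    {I : ModelWithCorners ℝ F H} [TopologicalSpace P] [ChartedSpace H P]
    {a : P → ℝ} {b : P → E} {x : P} (ha : MDifferentiableAt I 𝓘(ℝ, ℝ) a x)
    (hb : MDifferentiableAt I (𝓡 k) b x) {v : TangentSpace I x}
    (hv : mfderiv I 𝓘(ℝ, ℝ) a x v = 0) :
    mfderiv I (𝓡 k) (fun z => Ψ (a z) (b z)) x v =
      mfderiv (𝓡 k) (𝓡 k) (Ψ (a x)) (b x) (mfderiv I (𝓡 k) b x v) := by
  have h1 : MDifferentiableAt (𝓘(ℝ, ℝ).prod (𝓡 k)) (𝓡 k) (fun p : ℝ × E => Ψ p.1 p.2)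
      (a x, b x) := (h (a x, b x)).mdifferentiableAt (by simp)
  have h2 := mfderiv_comp x h1 (ha.prodMk hb)
  have h3 := DFunLike.congr_fun h2 v
  refine h3.trans ?_
  rw [ContinuousLinearMap.comp_apply, mfderiv_prod_eq_add_apply h1]
  rw [mfderiv_prodMk ha hb]
  have h4 : mfderiv 𝓘(ℝ, ℝ) (𝓡 k) (fun z => Ψ z (b x)) (a x) (mfderiv I 𝓘(ℝ, ℝ) a x v) = 0 := by
    rw [hv, map_zero]
  exact (congrArg (· + _) h4).trans (zero_add _)

end Vertical

/-! ### The suspension over the preimage of the cross-section -/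

lemma Equiv.Perm.semiconj_zpow {α β : Type*} {σ : Equiv.Perm α} {σ' : Equiv.Perm β} {h : α → β}
    (hσ : ∀ x, h (σ x) = σ' (h x)) (k : ℤ) (x : α) : h ((σ ^ k) x) = (σ' ^ k) (h x) := by
  have hinv : ∀ x, h (σ⁻¹ x) = σ'⁻¹ (h x) := fun x => by
    rw [Equiv.Perm.eq_inv_iff_eq, ← hσ]
    exact congrArg h (σ.apply_symm_apply x)
  induction k generalizing x with
  | zero => rfl
  | succ k ih => rw [zpow_add_one, zpow_add_one, Equiv.Perm.mul_apply, Equiv.Perm.mul_apply, ih, hσ]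
  | pred k ih =>
    rw [zpow_sub_one, zpow_sub_one, Equiv.Perm.mul_apply, Equiv.Perm.mul_apply, ih, hinv]

section Lift

variable {n m k j : ℕ} {N M E : Type*}
  [TopologicalSpace N] [ChartedSpace (EuclideanSpace ℝ (Fin n)) N]
  [TopologicalSpace M] [ChartedSpace (EuclideanSpace ℝ (Fin m)) M]
  [TopologicalSpace E] [ChartedSpace (EuclideanSpace ℝ (Fin k)) E]
  {proj : E → M} {φ : Flow ℝ M} {Ψ : Flow ℝ E} {f : N ≃ₘ^∞⟮𝓡 n, 𝓡 n⟯ N} {r : N → ℝ}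
  {S : SuspensionPresentation (m := m) φ f r}
  [ChartedSpace (EuclideanSpace ℝ (Fin j)) (proj ⁻¹' Set.range S.crossSection)]
  {p : proj ⁻¹' Set.range S.crossSection → N}

/-- Near every point, the flow `Ψ` takes the ambient manifold back to the preimage of the
cross-section. -/
lemma exists_flow_section (hX : IsSmoothSubmanifold j k (proj ⁻¹' Set.range S.crossSection))
    (hproj : ContMDiff (𝓡 k) (𝓡 m) ∞ proj) (hs : IsSmoothFlow (m := k) Ψ)
    (hΨ : ∀ t e, proj (Ψ t e) = φ t (proj e)) (hp : ∀ e, S.crossSection (p e) = proj e)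
    (hpc : Continuous p) (x : proj ⁻¹' Set.range S.crossSection) (s : ℝ) :
    ∃ (O : Set M) (τ : M → ℝ) (R : E → proj ⁻¹' Set.range S.crossSection)
      (U : Set ((proj ⁻¹' Set.range S.crossSection) × ℝ)), IsOpen O ∧ IsOpen U ∧ (x, s) ∈ U ∧
      ContMDiffOn (𝓡 m) 𝓘(ℝ, ℝ) ∞ τ O ∧ ContMDiffOn (𝓡 k) (𝓡 j) ∞ R (proj ⁻¹' O) ∧
      (∀ e, proj e ∈ O → (R e : E) = Ψ (-τ (proj e)) e) ∧
      ∀ z ∈ U, proj (Ψ z.2 z.1) ∈ O ∧ R (Ψ z.2 z.1) = z.1 ∧ τ (proj (Ψ z.2 z.1)) = z.2 := by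
  classical
  obtain ⟨Λ, hΛ, -, hΛφ⟩ := (S.isLocalDiffeomorph_flow (p x, s)).exists_source_subset isOpen_univ
    (Set.mem_univ _)
  set τ : M → ℝ := fun y => (Λ.invFun y).2
  have hτ : ContMDiffOn (𝓡 m) 𝓘(ℝ, ℝ) ∞ τ Λ.target :=
    contMDiff_snd.comp_contMDiffOn Λ.contMDiffOn_invFun
  -- Flowing `e` back for the time coordinate of `proj e` puts its projection on the cross-section.
  have hmem : ∀ e, proj e ∈ Λ.target →
      Ψ (-τ (proj e)) e ∈ proj ⁻¹' Set.range S.crossSection := fun e he => by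
    have h1 := hΛφ _ (Λ.map_target' he)
    rw [show Λ (Λ.invFun (proj e)) = proj e from Λ.right_inv' he] at h1
    refine ⟨(Λ.invFun (proj e)).1, ?_⟩
    have h2 := congrArg (φ (-τ (proj e))) h1
    rw [← φ.map_add, show -τ (proj e) + (Λ.invFun (proj e)).2 = 0 from neg_add_cancel _,
      φ.map_zero_apply] at h2
    rw [hΨ, h2]
  set R : E → proj ⁻¹' Set.range S.crossSection := fun e =>
    if h : Ψ (-τ (proj e)) e ∈ proj ⁻¹' Set.range S.crossSection then ⟨_, h⟩ else x
  have hR : ∀ e, proj e ∈ Λ.target → (R e : E) = Ψ (-τ (proj e)) e := fun e he =>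
    congrArg Subtype.val (dif_pos (hmem e he))
  refine ⟨Λ.target, τ, R, (fun z => (p z.1, z.2)) ⁻¹' Λ.source, Λ.open_target,
    Λ.open_source.preimage ((hpc.comp continuous_fst).prodMk continuous_snd), hΛ, hτ,
    fun e he => (hX.contMDiffAt_of_val ?_).contMDiffWithinAt, hR, fun z hz => ?_⟩
  · have ho := Λ.open_target.preimage hproj.continuous
    have h1 : ContMDiffAt (𝓡 k) 𝓘(ℝ, ℝ) ∞ (fun e => -τ (proj e)) e :=
      ((hτ.comp hproj.contMDiffOn fun _ h => h).contMDiffAt (ho.mem_nhds he)).neg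
    refine (ContMDiffAt.comp (g := fun q : ℝ × E => Ψ q.1 q.2) e (hs _)
      (h1.prodMk contMDiffAt_id)).congr_of_eventuallyEq ?_
    filter_upwards [ho.mem_nhds he] with e' he' using hR e' he'
  · have h1 : proj (Ψ z.2 z.1) = Λ (p z.1, z.2) := by
      rw [proj_flow hΨ hp]
      exact hΛφ _ hz
    have h2 : proj (Ψ z.2 z.1) ∈ Λ.target := h1 ▸ Λ.map_source' hz
    have h3 : τ (proj (Ψ z.2 z.1)) = z.2 := by
      rw [h1]
      exact congrArg Prod.snd (Λ.left_inv' hz)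
    refine ⟨h2, Subtype.ext ?_, h3⟩
    rw [hR _ h2, h3, ← Ψ.map_add, neg_add_cancel, Ψ.map_zero_apply]

/-- The return map of `Ψ` to the preimage of the cross-section. -/
lemma exists_return_map (hX : IsSmoothSubmanifold j k (proj ⁻¹' Set.range S.crossSection))
    (hs : IsSmoothFlow (m := k) Ψ) (hΨ : ∀ t e, proj (Ψ t e) = φ t (proj e))
    (hp : ∀ e, S.crossSection (p e) = proj e) (hpsm : ContMDiff (𝓡 j) (𝓡 n) ∞ p) :
    ∃ fhat : (proj ⁻¹' Set.range S.crossSection) ≃ₘ^∞⟮𝓡 j, 𝓡 j⟯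
      (proj ⁻¹' Set.range S.crossSection), ∀ x, (fhat x : E) = Ψ (r (p x)) x := by
  have h1 : ∀ x, φ (r (p x)) (S.crossSection (p x)) = S.crossSection (f (p x)) := fun x =>
    S.flow_roof _
  have h2 : ∀ x, φ (-r (f.symm (p x))) (S.crossSection (p x)) =
      S.crossSection (f.symm (p x)) := fun x => by
    have := S.flow_roof (f.symm (p x))
    rw [f.apply_symm_apply] at this
    rw [← this, ← φ.map_add, neg_add_cancel, φ.map_zero_apply]
  set F : proj ⁻¹' Set.range S.crossSection → proj ⁻¹' Set.range S.crossSection :=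
    fun x => ⟨Ψ (r (p x)) x, f (p x), by rw [proj_flow hΨ hp, h1]⟩
  -- The time of the last return is the roof at the point of departure, hence `r` at `f.symm (p x)`.
  set G : proj ⁻¹' Set.range S.crossSection → proj ⁻¹' Set.range S.crossSection :=
    fun x => ⟨Ψ (-r (f.symm (p x))) x, f.symm (p x), by rw [proj_flow hΨ hp, h2]⟩
  have hpF : ∀ x, p (F x) = f (p x) := fun x => S.crossSection_injective <| by
    rw [hp, ← h1]
    exact proj_flow hΨ hp _ _
  have hpG : ∀ x, p (G x) = f.symm (p x) := fun x => S.crossSection_injective <| by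
    rw [hp, ← h2]
    exact proj_flow hΨ hp _ _
  have hr : ContMDiff (𝓡 j) 𝓘(ℝ, ℝ) ∞ fun x => r (p x) := S.roof_smooth.comp hpsm
  have hr' : ContMDiff (𝓡 j) 𝓘(ℝ, ℝ) ∞ fun x => -r (f.symm (p x)) :=
    (S.roof_smooth.comp (f.symm.contMDiff.comp hpsm)).neg
  refine ⟨⟨⟨F, G, fun x => ?_, fun x => ?_⟩, fun x => ?_, fun x => ?_⟩, fun x => rfl⟩
  · refine Subtype.ext ?_
    change Ψ (-r (f.symm (p (F x)))) (Ψ (r (p x)) x) = x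
    rw [hpF, f.symm_apply_apply, ← Ψ.map_add, neg_add_cancel, Ψ.map_zero_apply]
  · refine Subtype.ext ?_
    change Ψ (r (p (G x))) (Ψ (-r (f.symm (p x))) x) = x
    rw [hpG, ← Ψ.map_add, add_neg_cancel, Ψ.map_zero_apply]
  · exact hX.contMDiffAt_of_val
      (ContMDiffAt.comp (g := fun q : ℝ × E => Ψ q.1 q.2) x (hs _) ((hr x).prodMk (hX.1 x)))
  · exact hX.contMDiffAt_of_val
      (ContMDiffAt.comp (g := fun q : ℝ × E => Ψ q.1 q.2) x (hs _) ((hr' x).prodMk (hX.1 x)))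

variable {fhat : (proj ⁻¹' Set.range S.crossSection) ≃ₘ^∞⟮𝓡 j, 𝓡 j⟯
      (proj ⁻¹' Set.range S.crossSection)}

lemma apply_return_map (hΨ : ∀ t e, proj (Ψ t e) = φ t (proj e))
    (hp : ∀ e, S.crossSection (p e) = proj e) (hfhat : ∀ x, (fhat x : E) = Ψ (r (p x)) x)
    (x : proj ⁻¹' Set.range S.crossSection) : p (fhat x) = f (p x) :=
  S.crossSection_injective <| by rw [hp, hfhat, proj_flow hΨ hp, S.flow_roof]

/-- The flow `Ψ` is the suspension of its return map. -/
lemma exists_suspensionPresentation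
    (hX : IsSmoothSubmanifold j k (proj ⁻¹' Set.range S.crossSection))
    (hproj : ContMDiff (𝓡 k) (𝓡 m) ∞ proj) (hs : IsSmoothFlow (m := k) Ψ)
    (hΨ : ∀ t e, proj (Ψ t e) = φ t (proj e)) (hp : ∀ e, S.crossSection (p e) = proj e)
    (hpsm : ContMDiff (𝓡 j) (𝓡 n) ∞ p) (hfhat : ∀ x, (fhat x : E) = Ψ (r (p x)) x) :
    ∃ Shat : SuspensionPresentation (m := k) Ψ fhat (fun e => r (p e)),
      ∀ e, Shat.crossSection e = (e : E) := by
  have hpf := apply_return_map hΨ hp hfhat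
  set σ := suspensionDeck fhat.toEquiv fun e => r (p e)
  set Θ : (proj ⁻¹' Set.range S.crossSection) × ℝ → E := fun q => Ψ q.2 q.1
  have hσ : ∀ q (l : ℤ), Θ ((σ ^ l) q) = Θ q := fun q l => by
    have h1 : ∀ q, Θ (σ q) = (1 : Equiv.Perm E) (Θ q) := fun q => by
      change Ψ (q.2 - r (p q.1)) (fhat q.1) = Ψ q.2 q.1
      rw [hfhat, ← Ψ.map_add, sub_add_cancel]
    rw [Equiv.Perm.semiconj_zpow h1, one_zpow, Equiv.Perm.one_apply]
  have hσp : ∀ q (l : ℤ), (p ((σ ^ l) q).1, ((σ ^ l) q).2) =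
      (suspensionDeck f.toEquiv r ^ l) (p q.1, q.2) := fun q l =>
    Equiv.Perm.semiconj_zpow (h := fun q : (proj ⁻¹' Set.range S.crossSection) × ℝ =>
      (p q.1, q.2)) (fun q => Prod.ext (hpf q.1) rfl) l q
  set T : MappingTorus fhat.toEquiv (fun e => r (p e)) → E := Quotient.lift Θ (by
    rintro q _ ⟨l, rfl⟩
    exact (hσ q l).symm)
  have hT : Function.Bijective T := by
    constructor
    -- Injectivity downstairs yields a deck power `l` matching the projections. The same power
    -- upstairs gives the right height without changing the image in `E`, and then invertibility of
    -- the time-`q'.2` map identifies the points.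
    · rintro ⟨q⟩ ⟨q'⟩ h
      have h' : Ψ q.2 q.1 = Ψ q'.2 q'.1 := h
      have h1 := congrArg proj h'
      rw [proj_flow hΨ hp, proj_flow hΨ hp] at h1
      obtain ⟨l, hl⟩ := (S.flow_eq_iff (p := (p q.1, q.2)) (q := (p q'.1, q'.2))).1 h1
      refine MappingTorus.mk_eq_mk_iff.2 ⟨l, ?_⟩
      have h2 : ((σ ^ l) q).2 = q'.2 := congrArg (fun u : N × ℝ => u.2) ((hσp q l).trans hl)
      have h3 : Ψ q'.2 ((σ ^ l) q).1 = Ψ q'.2 q'.1 := by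
        rw [← h', ← h2]
        exact hσ q l
      have h4 := congrArg (Ψ (-q'.2)) h3
      rw [← Ψ.map_add, ← Ψ.map_add, neg_add_cancel, Ψ.map_zero_apply, Ψ.map_zero_apply] at h4
      exact Prod.ext (Subtype.ext h4) h2
    -- The height is dictated by the base: flow `e` back by the time for which `proj e` comes from
    -- the cross-section.
    · intro e
      obtain ⟨q, hq⟩ := S.exists_flow_eq (proj e)
      have hmem : Ψ (-q.2) e ∈ proj ⁻¹' Set.range S.crossSection := by
        refine ⟨q.1, ?_⟩
        rw [hΨ, ← hq, ← φ.map_add, neg_add_cancel, φ.map_zero_apply]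
      refine ⟨MappingTorus.mk _ _ (⟨_, hmem⟩, q.2), ?_⟩
      change Ψ q.2 (Ψ (-q.2) e) = e
      rw [← Ψ.map_add, add_neg_cancel, Ψ.map_zero_apply]
  refine ⟨{
    roof_smooth := S.roof_smooth.comp hpsm
    roof_pos := fun x => S.roof_pos _
    toEquiv := Equiv.ofBijective T hT
    isLocalDiffeomorph := ?_
    map_flow := ?_ }, fun e => Ψ.map_zero_apply e⟩
  · rintro ⟨x, s⟩
    obtain ⟨O, τ, R, U, hO, hU, hxU, hτ, hR, hRe, hUz⟩ :=
      exists_flow_section hX hproj hs hΨ hp hpsm.continuous x s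
    refine isLocalDiffeomorphAt_of_local_inverse (f := Θ) (g := fun e => (R e, τ (proj e)))
      hU (hO.preimage hproj.continuous) ?_
      (hR.prodMk (hτ.comp hproj.contMDiffOn fun _ h => h))
      (fun z hz _ => Prod.ext (hUz z hz).2.1 (hUz z hz).2.2) (fun e he _ => ?_) hxU
      (hUz _ hxU).1
    · exact ContMDiff.contMDiffOn (ContMDiff.comp (g := fun q : ℝ × E => Ψ q.1 q.2) hs
        (contMDiff_snd.prodMk (hX.1.comp contMDiff_fst)))
    · change Ψ (τ (proj e)) (R e) = e
      rw [hRe e he, ← Ψ.map_add, add_neg_cancel, Ψ.map_zero_apply]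
  · rintro t ⟨q⟩
    change Ψ (q.2 + t) q.1 = Ψ t (Ψ q.2 q.1)
    rw [← Ψ.map_add, add_comm]

/-- A positive lower bound on the roof converts contraction in flow time into contraction per
return. An empty `N` has no minimum and is treated apart. -/
lemma exists_roof_lower_bound [CompactSpace N] (S : SuspensionPresentation (m := m) φ f r) :
    ∃ c > 0, ∀ y, c ≤ r y := by
  rcases isEmpty_or_nonempty N with hN | hN
  · exact ⟨1, one_pos, fun y => (hN.false y).elim⟩
  · obtain ⟨y, -, hy⟩ := isCompact_univ.exists_isMinOn Set.univ_nonempty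
      S.roof_smooth.continuous.continuousOn
    exact ⟨r y, S.roof_pos y, fun z => hy (Set.mem_univ z)⟩

/-- The iterates of the return map are given by the flow for smooth times. -/
lemma exists_return_time (hΨ : ∀ t e, proj (Ψ t e) = φ t (proj e))
    (hp : ∀ e, S.crossSection (p e) = proj e) (hfhat : ∀ x, (fhat x : E) = Ψ (r (p x)) x)
    {c : ℝ} (hc : ∀ y, c ≤ r y) (l : ℕ) :
    ∃ τ : N → ℝ, ContMDiff (𝓡 n) 𝓘(ℝ, ℝ) ∞ τ ∧ (∀ y, l * c ≤ τ y) ∧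
      ∀ x, (((fhat.toPerm ^ (l : ℤ)) x : proj ⁻¹' Set.range S.crossSection) : E) =
        Ψ (τ (p x)) x := by
  have hpf := apply_return_map hΨ hp hfhat
  induction l with
  | zero => exact ⟨fun _ => 0, contMDiff_const, fun y => by simp,
      fun x => (Ψ.map_zero_apply _).symm⟩
  | succ l ih =>
    obtain ⟨τ, hτ, hτc, hτΨ⟩ := ih
    -- First one return, of duration `r y`, and then `l` returns starting from `f y`.
    refine ⟨fun y => τ (f y) + r y, (hτ.comp f.contMDiff).add S.roof_smooth, fun y => ?_,
      fun x => ?_⟩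
    · have := hτc (f y)
      have := hc y
      push_cast
      linarith
    · rw [Nat.cast_succ, zpow_add_one, Equiv.Perm.mul_apply, hτΨ]
      change Ψ (τ (p (fhat x))) (fhat x) = _
      rw [hpf, hfhat, ← Ψ.map_add]

/-- Going back `l` returns takes the time that the earlier point, over `f^{-l} y`, needs to come
forward. -/
lemma exists_return_time_neg (hΨ : ∀ t e, proj (Ψ t e) = φ t (proj e))
    (hp : ∀ e, S.crossSection (p e) = proj e) (hfhat : ∀ x, (fhat x : E) = Ψ (r (p x)) x)
    {c : ℝ} (hc : ∀ y, c ≤ r y) (l : ℕ) :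
    ∃ τ : N → ℝ, ContMDiff (𝓡 n) 𝓘(ℝ, ℝ) ∞ τ ∧ (∀ y, l * c ≤ τ y) ∧
      ∀ x, (((fhat.toPerm ^ (-l : ℤ)) x : proj ⁻¹' Set.range S.crossSection) : E) =
        Ψ (-τ (p x)) x := by
  have hpf := apply_return_map hΨ hp hfhat
  obtain ⟨τ, hτ, hτc, hτΨ⟩ := exists_return_time hΨ hp hfhat hc l
  refine ⟨fun y => τ ((f.toPerm ^ (-l : ℤ)) y), hτ.comp (f.contMDiff_toPerm_zpow _),
    fun y => hτc _, fun x => ?_⟩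
  have h1 := hτΨ ((fhat.toPerm ^ (-l : ℤ)) x)
  rw [← Equiv.Perm.mul_apply, ← zpow_add, add_neg_cancel, zpow_zero, Equiv.Perm.one_apply,
    Equiv.Perm.semiconj_zpow (σ := fhat.toPerm) (σ' := f.toPerm) hpf] at h1
  conv_rhs => rw [h1, ← Ψ.map_add, neg_add_cancel, Ψ.map_zero_apply]

end Lift

/-! ### Hyperbolicity of the return map -/

/-- In bundle coordinates the projection is the first factor projection. -/
lemma IsAffineTorusBundle.surjective_mfderiv {m k d : ℕ} {M E : Type*}
    [TopologicalSpace M] [ChartedSpace (EuclideanSpace ℝ (Fin m)) M]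
    [TopologicalSpace E] [ChartedSpace (EuclideanSpace ℝ (Fin k)) E] {proj : E → M}
    (h : IsAffineTorusBundle (m := m) (k := k) d proj) (x : E) :
    Function.Surjective (mfderiv (𝓡 k) (𝓡 m) proj x) := by
  obtain ⟨e, v, Φ, hΦ, hx, hp⟩ := h.exists_partialDiffeomorph x
  have h1 : HasMFDerivAt ((𝓡 m).prod (𝓡 d)) (𝓡 m) (proj ∘ Φ) (proj x, v)
      ((mfderiv (𝓡 k) (𝓡 m) proj (Φ (proj x, v))).comp
        (mfderiv ((𝓡 m).prod (𝓡 d)) (𝓡 k) Φ (proj x, v))) :=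
    ((h.contMDiff _).mdifferentiableAt (by simp)).hasMFDerivAt.comp _
      (Φ.mdifferentiableAt (by simp) hΦ).hasMFDerivAt
  have h2 : HasMFDerivAt ((𝓡 m).prod (𝓡 d)) (𝓡 m) (proj ∘ Φ) (proj x, v)
      (ContinuousLinearMap.fst ℝ (EuclideanSpace ℝ (Fin m)) (EuclideanSpace ℝ (Fin d))) := by
    refine (hasMFDerivAt_fst (proj x, v)).congr_of_eventuallyEq ?_
    filter_upwards [Φ.open_source.mem_nhds hΦ] with q hq using (hp q hq).2.2
  have h3 := hasMFDerivAt_unique h1 h2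
  rw [hx] at h3
  intro w
  exact ⟨_, DFunLike.congr_fun h3 ((w, 0) : EuclideanSpace ℝ (Fin m) × EuclideanSpace ℝ (Fin d))⟩

lemma SuspensionPresentation.injective_mfderiv_crossSection {n m : ℕ} {N M : Type*}
    [TopologicalSpace N] [ChartedSpace (EuclideanSpace ℝ (Fin n)) N]
    [TopologicalSpace M] [ChartedSpace (EuclideanSpace ℝ (Fin m)) M] [CompactSpace N] [T2Space M]
    {φ : Flow ℝ M} {f : N ≃ₘ^∞⟮𝓡 n, 𝓡 n⟯ N} {r : N → ℝ}
    (S : SuspensionPresentation (m := m) φ f r) (y : N) :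
    Function.Injective (mfderiv (𝓡 n) (𝓡 m) S.crossSection y) := by
  obtain ⟨O, ρ, hO, hyO, hρ, hρι⟩ := S.exists_retraction y
  have hc := S.contMDiff_crossSection y
  have h1 := ((hρ.contMDiffAt (hO.mem_nhds hyO)).mdifferentiableAt
    (by simp)).hasMFDerivAt.comp y (hc.mdifferentiableAt (by simp)).hasMFDerivAt
  have h2 : HasMFDerivAt (𝓡 n) (𝓡 n) (ρ ∘ S.crossSection) y
      (ContinuousLinearMap.id ℝ (TangentSpace (𝓡 n) y)) := by
    refine (hasMFDerivAt_id y).congr_of_eventuallyEq ?_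
    filter_upwards [hc.continuousAt.eventually (hO.mem_nhds hyO)] with z hz using hρι z hz
  have h3 := hasMFDerivAt_unique h1 h2
  intro v w hvw
  have h4 : ∀ u, mfderiv (𝓡 m) (𝓡 n) ρ (S.crossSection y)
      (mfderiv (𝓡 n) (𝓡 m) S.crossSection y u) = u := fun u => DFunLike.congr_fun h3 u
  rw [← h4 v, ← h4 w, hvw]

section Hyperbolicity

variable {n m k j d : ℕ} {N M E : Type*}
  [TopologicalSpace N] [ChartedSpace (EuclideanSpace ℝ (Fin n)) N]
  [TopologicalSpace M] [ChartedSpace (EuclideanSpace ℝ (Fin m)) M]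
  [TopologicalSpace E] [ChartedSpace (EuclideanSpace ℝ (Fin k)) E]
  {proj : E → M} {φ : Flow ℝ M} {Ψ : Flow ℝ E} {f : N ≃ₘ^∞⟮𝓡 n, 𝓡 n⟯ N} {r : N → ℝ}
  {S : SuspensionPresentation (m := m) φ f r}
  [ChartedSpace (EuclideanSpace ℝ (Fin j)) (proj ⁻¹' Set.range S.crossSection)]
  {p : proj ⁻¹' Set.range S.crossSection → N}
  {fhat : (proj ⁻¹' Set.range S.crossSection) ≃ₘ^∞⟮𝓡 j, 𝓡 j⟯
      (proj ⁻¹' Set.range S.crossSection)}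

lemma mfderiv_proj_val (hX : IsSmoothSubmanifold j k (proj ⁻¹' Set.range S.crossSection))
    (hproj : ContMDiff (𝓡 k) (𝓡 m) ∞ proj) (hp : ∀ e, S.crossSection (p e) = proj e)
    (hpsm : ContMDiff (𝓡 j) (𝓡 n) ∞ p) (x : proj ⁻¹' Set.range S.crossSection)
    (v : EuclideanSpace ℝ (Fin j)) :
    mfderiv (𝓡 k) (𝓡 m) proj x (mfderiv (𝓡 j) (𝓡 k)
      (Subtype.val : proj ⁻¹' Set.range S.crossSection → E) x v) =
    mfderiv (𝓡 n) (𝓡 m) S.crossSection (p x) (mfderiv (𝓡 j) (𝓡 n) p x v) := by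
  have h1 := mfderiv_comp x ((hproj (x : E)).mdifferentiableAt (by simp))
    ((hX.1 x).mdifferentiableAt (by simp))
  have h2 := mfderiv_comp x ((S.contMDiff_crossSection (p x)).mdifferentiableAt (by simp))
    ((hpsm x).mdifferentiableAt (by simp))
  have h3 : proj ∘ (Subtype.val : proj ⁻¹' Set.range S.crossSection → E) = S.crossSection ∘ p :=
    funext fun z => (hp z).symm
  rw [h3] at h1
  exact (DFunLike.congr_fun h1 v).symm.trans (DFunLike.congr_fun h2 v)

/-- Vertical vectors are tangent to the preimage of the cross-section. -/
lemma exists_mfderiv_val_eq (hX : IsSmoothSubmanifold j k (proj ⁻¹' Set.range S.crossSection))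
    (hproj : ContMDiff (𝓡 k) (𝓡 m) ∞ proj) (hs : IsSmoothFlow (m := k) Ψ)
    (hΨ : ∀ t e, proj (Ψ t e) = φ t (proj e)) (hp : ∀ e, S.crossSection (p e) = proj e)
    (hpc : Continuous p) (x : proj ⁻¹' Set.range S.crossSection) (w : EuclideanSpace ℝ (Fin k))
    (hw : mfderiv (𝓡 k) (𝓡 m) proj x w = 0) :
    ∃ v : EuclideanSpace ℝ (Fin j), mfderiv (𝓡 j) (𝓡 k)
      (Subtype.val : proj ⁻¹' Set.range S.crossSection → E) x v = w := by
  obtain ⟨O, τ, R, U, hO, -, hxU, hτ, hR, hRe, hU⟩ :=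
    exists_flow_section hX hproj hs hΨ hp hpc x 0
  obtain ⟨h1, h2, h3⟩ := hU _ hxU
  simp only [Ψ.map_zero_apply] at h1 h2 h3
  have hx := (hO.preimage hproj.continuous).mem_nhds h1
  have hRx := hR.contMDiffAt hx
  have hτx : MDifferentiableAt (𝓡 m) 𝓘(ℝ, ℝ) (fun y => -τ y) (proj x) :=
    (hτ.contMDiffAt (hO.mem_nhds h1)).neg.mdifferentiableAt (by simp)
  have hpx := (hproj (x : E)).mdifferentiableAt (n := ∞) (by simp)
  have ha := mfderiv_comp (x : E) hτx hpx
  have h4 := hs.mfderiv_comp_of_eq_zero (a := fun e => -τ (proj e)) (b := fun e => e)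
    (hτx.comp (x : E) hpx) mdifferentiableAt_id (v := w) (by
      exact (DFunLike.congr_fun ha w).trans
        ((congrArg (mfderiv (𝓡 m) 𝓘(ℝ, ℝ) (fun y => -τ y) (proj x)) hw).trans (map_zero _)))
  -- Near `x` the map `e ↦ Ψ^{-τ(proj e)} e` takes values in the preimage. Its time is zero at `x`
  -- and stationary along the vertical `w`, so its derivative fixes `w`, which is therefore the
  -- image of `DR w`.
  have h5 : (fun e => Ψ (-τ (proj e)) e) =ᶠ[nhds (x : E)] Subtype.val ∘ R := by
    filter_upwards [hx] with e he using (hRe e he).symm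
  have h6 := mfderiv_comp (x : E) ((hX.1 (R x)).mdifferentiableAt (by simp))
    (hRx.mdifferentiableAt (by simp))
  have h7 : Ψ (-τ (proj x)) = id := by
    funext e
    rw [h3, neg_zero, Ψ.map_zero_apply, id]
  rw [h5.mfderiv_eq, h6, h7, h2] at h4
  refine ⟨mfderiv (𝓡 k) (𝓡 j) R x w, (show _ = _ from h4).trans ?_⟩
  have h8 : mfderiv (𝓡 k) (𝓡 k) (fun e : E => e) (x : E) =
    ContinuousLinearMap.id ℝ (TangentSpace (𝓡 k) (x : E)) := mfderiv_id
  have h9 : mfderiv (𝓡 k) (𝓡 k) (id : E → E) (x : E) =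
    ContinuousLinearMap.id ℝ (TangentSpace (𝓡 k) (x : E)) := mfderiv_id
  rw [h9, h8]
  rfl

/-- On vertical vectors, a map given by the flow for a time that depends on the base point acts as
the derivative of the flow. -/
lemma mfderiv_val_flow (hX : IsSmoothSubmanifold j k (proj ⁻¹' Set.range S.crossSection))
    (hs : IsSmoothFlow (m := k) Ψ) (hpsm : ContMDiff (𝓡 j) (𝓡 n) ∞ p) {τ : N → ℝ}
    (hτ : ContMDiff (𝓡 n) 𝓘(ℝ, ℝ) ∞ τ)
    {h : proj ⁻¹' Set.range S.crossSection → proj ⁻¹' Set.range S.crossSection}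
    (hh : ContMDiff (𝓡 j) (𝓡 j) ∞ h) (hhτ : ∀ x, (h x : E) = Ψ (τ (p x)) x)
    (x : proj ⁻¹' Set.range S.crossSection) (v : EuclideanSpace ℝ (Fin j))
    (hv : mfderiv (𝓡 j) (𝓡 n) p x v = 0) :
    mfderiv (𝓡 j) (𝓡 k) (Subtype.val : proj ⁻¹' Set.range S.crossSection → E) (h x)
      (mfderiv (𝓡 j) (𝓡 j) h x v) =
    mfderiv (𝓡 k) (𝓡 k) (Ψ (τ (p x))) x (mfderiv (𝓡 j) (𝓡 k)
      (Subtype.val : proj ⁻¹' Set.range S.crossSection → E) x v) := by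
  have hpx := (hpsm x).mdifferentiableAt (n := ∞) (by simp)
  have hτx := (hτ (p x)).mdifferentiableAt (n := ∞) (by simp)
  have ha := mfderiv_comp x hτx hpx
  have h4 := hs.mfderiv_comp_of_eq_zero (a := fun z => τ (p z)) (b := fun z => (z : E))
    (hτx.comp x hpx) ((hX.1 x).mdifferentiableAt (by simp)) (v := v) (by
      exact (DFunLike.congr_fun ha v).trans
        ((congrArg (mfderiv (𝓡 n) 𝓘(ℝ, ℝ) τ (p x)) hv).trans (map_zero _)))
  have h5 := mfderiv_comp x ((hX.1 (h x)).mdifferentiableAt (by simp))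
    ((hh x).mdifferentiableAt (by simp))
  have h6 : Subtype.val ∘ h = fun z : proj ⁻¹' Set.range S.crossSection => Ψ (τ (p z)) (z : E) :=
    funext hhτ
  rw [h6] at h5
  exact (DFunLike.congr_fun h5 v).symm.trans h4

end Hyperbolicity

/-! ### Derivative cocycles measured in Riemannian norms -/

section CocycleNorm

variable {n : ℕ} {M : Type*} [TopologicalSpace M] [ChartedSpace (EuclideanSpace ℝ (Fin n)) M]
  [IsManifold (𝓡 n) ∞ M] (D : M ≃ₘ^∞⟮𝓡 n, 𝓡 n⟯ M) (g : RiemMetric n M)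

lemma Diffeomorph.seminorm_cocycle_natCast (k : ℕ) (x : M) (v : EuclideanSpace ℝ (Fin n)) :
    g.seminorm ((D.toPerm ^ (k : ℤ)) x) (D.cocycle k x v) =
      g.norm (mfderiv (𝓡 n) (𝓡 n) D^[k] x v) := by
  rw [← D.coe_toPerm_zpow_natCast k]
  exact g.seminorm_apply _

lemma Diffeomorph.seminorm_cocycle_neg (k : ℕ) (x : M) (v : EuclideanSpace ℝ (Fin n)) :
    g.seminorm ((D.toPerm ^ (-k : ℤ)) x) (D.cocycle (-k) x v) =
      g.norm (mfderiv (𝓡 n) (𝓡 n) D.symm^[k] x v) := by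
  rw [← D.coe_toPerm_zpow_neg k]
  exact g.seminorm_apply _

end CocycleNorm

/-! ### The vertical splitting on the preimage, and the Anosov property of the return map -/

section ReturnMap

variable {n m k j : ℕ} {N M E : Type*}
  [TopologicalSpace N] [ChartedSpace (EuclideanSpace ℝ (Fin n)) N]
  [TopologicalSpace M] [ChartedSpace (EuclideanSpace ℝ (Fin m)) M]
  [TopologicalSpace E] [ChartedSpace (EuclideanSpace ℝ (Fin k)) E]
  {proj : E → M} {φ : Flow ℝ M} {Ψ : Flow ℝ E} {f : N ≃ₘ^∞⟮𝓡 n, 𝓡 n⟯ N} {r : N → ℝ}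
  {S : SuspensionPresentation (m := m) φ f r}
  [ChartedSpace (EuclideanSpace ℝ (Fin j)) (proj ⁻¹' Set.range S.crossSection)]
  {p : proj ⁻¹' Set.range S.crossSection → N}

/-- The vectors tangent to the preimage of the cross-section that belong to a given family of
subspaces of the tangent spaces of the ambient manifold. -/
noncomputable def tangentPart (V : ∀ e : E, Submodule ℝ (TangentSpace (𝓡 k) e))
    (x : proj ⁻¹' Set.range S.crossSection) : Submodule ℝ (EuclideanSpace ℝ (Fin j)) :=
  (V x).comap (mfderiv (𝓡 j) (𝓡 k)
    (Subtype.val : proj ⁻¹' Set.range S.crossSection → E) x).toLinearMap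

variable {V V' : ∀ e : E, Submodule ℝ (TangentSpace (𝓡 k) e)}

/-- The two projections differ by the derivative of the cross-section, which is injective. -/
lemma mfderiv_eq_zero_iff [CompactSpace N] [T2Space M]
    (hX : IsSmoothSubmanifold j k (proj ⁻¹' Set.range S.crossSection))
    (hproj : ContMDiff (𝓡 k) (𝓡 m) ∞ proj) (hp : ∀ e, S.crossSection (p e) = proj e)
    (hpsm : ContMDiff (𝓡 j) (𝓡 n) ∞ p) (x : proj ⁻¹' Set.range S.crossSection)
    (v : EuclideanSpace ℝ (Fin j)) :
    mfderiv (𝓡 j) (𝓡 n) p x v = 0 ↔ mfderiv (𝓡 k) (𝓡 m) proj x (mfderiv (𝓡 j) (𝓡 k)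
      (Subtype.val : proj ⁻¹' Set.range S.crossSection → E) x v) = 0 := by
  have h1 := mfderiv_proj_val hX hproj hp hpsm x v
  constructor
  · intro h
    exact h1.trans ((congrArg (mfderiv (𝓡 n) (𝓡 m) S.crossSection (p x)) h).trans (map_zero _))
  · intro h
    exact S.injective_mfderiv_crossSection (p x) ((h1.symm.trans h).trans (map_zero _).symm)

/-- The components of a vector of ker Dp are split off in the tangent space of `E`. They are
vertical, hence tangent to the preimage, so the splitting descends to it. -/
lemma tangentPart_sup [CompactSpace N] [T2Space M]
    (hX : IsSmoothSubmanifold j k (proj ⁻¹' Set.range S.crossSection))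
    (hproj : ContMDiff (𝓡 k) (𝓡 m) ∞ proj) (hs : IsSmoothFlow (m := k) Ψ)
    (hΨ : ∀ t e, proj (Ψ t e) = φ t (proj e)) (hp : ∀ e, S.crossSection (p e) = proj e)
    (hpsm : ContMDiff (𝓡 j) (𝓡 n) ∞ p)
    (hV : ∀ e, V e ⊔ V' e = LinearMap.ker (mfderiv (𝓡 k) (𝓡 m) proj e).toLinearMap)
    (x : proj ⁻¹' Set.range S.crossSection) :
    (tangentPart V x ⊔ tangentPart V' x : Submodule ℝ (EuclideanSpace ℝ (Fin j))) =
      LinearMap.ker (mfderiv (𝓡 j) (𝓡 n) p x).toLinearMap := by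
  have hle : ∀ w ∈ V x ⊔ V' x, mfderiv (𝓡 k) (𝓡 m) proj x w = 0 := fun w hw => by
    rw [hV] at hw
    exact hw
  refine le_antisymm (sup_le ?_ ?_) fun v hv => ?_
  · exact fun v hv => (mfderiv_eq_zero_iff hX hproj hp hpsm x v).2
      (hle _ (Submodule.mem_sup_left hv))
  · exact fun v hv => (mfderiv_eq_zero_iff hX hproj hp hpsm x v).2
      (hle _ (Submodule.mem_sup_right hv))
  · have h1 : mfderiv (𝓡 j) (𝓡 k) (Subtype.val : proj ⁻¹' Set.range S.crossSection → E) x v ∈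
        V x ⊔ V' x := by
      rw [hV]
      exact (mfderiv_eq_zero_iff hX hproj hp hpsm x v).1 hv
    obtain ⟨a, ha, b, hb, hab⟩ := Submodule.mem_sup.1 h1
    obtain ⟨a', rfl⟩ := exists_mfderiv_val_eq hX hproj hs hΨ hp hpsm.continuous x a
      (hle _ (Submodule.mem_sup_left ha))
    obtain ⟨b', rfl⟩ := exists_mfderiv_val_eq hX hproj hs hΨ hp hpsm.continuous x b
      (hle _ (Submodule.mem_sup_right hb))
    refine Submodule.mem_sup.2 ⟨a', ha, b', hb, hX.injective_mfderiv x ?_⟩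
    exact (map_add _ _ _).trans hab

lemma tangentPart_disjoint (hX : IsSmoothSubmanifold j k (proj ⁻¹' Set.range S.crossSection))
    (hV : ∀ e, Disjoint (V e) (V' e)) (x : proj ⁻¹' Set.range S.crossSection) :
    Disjoint (tangentPart V x : Submodule ℝ (EuclideanSpace ℝ (Fin j))) (tangentPart V' x) :=
  Submodule.disjoint_def.2 fun _ hv hv' => hX.injective_mfderiv x
    ((Submodule.disjoint_def.1 (hV x) _ hv hv').trans (map_zero _).symm)

lemma mem_tangentPart_of_flow
    (hX : IsSmoothSubmanifold j k (proj ⁻¹' Set.range S.crossSection))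
    (hs : IsSmoothFlow (m := k) Ψ) (hpsm : ContMDiff (𝓡 j) (𝓡 n) ∞ p)
    (hV : ∀ (t : ℝ) (e : E), (V e).map (mfderiv (𝓡 k) (𝓡 k) (Ψ t) e).toLinearMap = V (Ψ t e))
    {τ : N → ℝ} (hτ : ContMDiff (𝓡 n) 𝓘(ℝ, ℝ) ∞ τ)
    {h : proj ⁻¹' Set.range S.crossSection → proj ⁻¹' Set.range S.crossSection}
    (hh : ContMDiff (𝓡 j) (𝓡 j) ∞ h) (hhτ : ∀ x, (h x : E) = Ψ (τ (p x)) x)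
    (x : proj ⁻¹' Set.range S.crossSection) (v : EuclideanSpace ℝ (Fin j))
    (hv : mfderiv (𝓡 j) (𝓡 n) p x v = 0) (hvV : v ∈ tangentPart V x) :
    mfderiv (𝓡 j) (𝓡 j) h x v ∈ tangentPart V (h x) := by
  -- Seen in the model space, the subspaces at the equal points `h x` and `Ψ (τ (p x)) x` have the
  -- same type and can be exchanged by rewriting.
  let V₀ : E → Submodule ℝ (EuclideanSpace ℝ (Fin k)) := V
  have h1 : mfderiv (𝓡 k) (𝓡 k) (Ψ (τ (p x))) x (mfderiv (𝓡 j) (𝓡 k)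
      (Subtype.val : proj ⁻¹' Set.range S.crossSection → E) x v) ∈ V (Ψ (τ (p x)) x) := by
    rw [← hV]
    exact ⟨_, hvV, rfl⟩
  have h2 := mfderiv_val_flow hX hs hpsm hτ hh hhτ x v hv
  have h3 : V₀ (h x) = V₀ (Ψ (τ (p x)) x) := congrArg V₀ (hhτ x)
  exact (congrArg (· ∈ V₀ (h x)) h2).mpr (h3 ▸ h1)

/-- With the metric pulled back from `E`, norms on vertical vectors agree with those seen by the
flow, so its contraction estimates transfer without a new constant. -/
lemma seminorm_flow_eq [IsManifold (𝓡 k) ∞ E]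
    [IsManifold (𝓡 j) ∞ (proj ⁻¹' Set.range S.crossSection)] (g : RiemMetric k E)
    (hX : IsSmoothSubmanifold j k (proj ⁻¹' Set.range S.crossSection))
    (hs : IsSmoothFlow (m := k) Ψ) (hpsm : ContMDiff (𝓡 j) (𝓡 n) ∞ p)
    {τ : N → ℝ} (hτ : ContMDiff (𝓡 n) 𝓘(ℝ, ℝ) ∞ τ)
    {h : proj ⁻¹' Set.range S.crossSection → proj ⁻¹' Set.range S.crossSection}
    (hh : ContMDiff (𝓡 j) (𝓡 j) ∞ h) (hhτ : ∀ x, (h x : E) = Ψ (τ (p x)) x)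
    (x : proj ⁻¹' Set.range S.crossSection) (v : EuclideanSpace ℝ (Fin j))
    (hv : mfderiv (𝓡 j) (𝓡 n) p x v = 0) :
    (g.pullback hX.1 hX.injective_mfderiv).seminorm (h x) (mfderiv (𝓡 j) (𝓡 j) h x v) =
      g.norm (mfderiv (𝓡 k) (𝓡 k) (Ψ (τ (p x))) x (mfderiv (𝓡 j) (𝓡 k)
        (Subtype.val : proj ⁻¹' Set.range S.crossSection → E) x v)) := by
  have h2 := mfderiv_val_flow hX hs hpsm hτ hh hhτ x v hv
  calc _ = g.norm (mfderiv (𝓡 j) (𝓡 k) (Subtype.val : proj ⁻¹' Set.range S.crossSection → E)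
        (h x) (mfderiv (𝓡 j) (𝓡 j) h x v)) := RiemMetric.seminorm_apply _ _
    _ = g.seminorm (h x) (mfderiv (𝓡 k) (𝓡 k) (Ψ (τ (p x))) x (mfderiv (𝓡 j) (𝓡 k)
        (Subtype.val : proj ⁻¹' Set.range S.crossSection → E) x v)) :=
      (g.seminorm_apply _).symm.trans (congrArg (g.seminorm (h x)) h2)
    _ = _ := by
      rw [hhτ]
      exact g.seminorm_apply _

/-- Exponential contraction by the flow for long times. -/
lemma flow_norm_le [IsManifold (𝓡 k) ∞ E] {g : RiemMetric k E} {C lam c : ℝ}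
    (hlam : 0 < lam) (hlam' : lam < 1) (hc : 0 < c) {σ : ℝ → ℝ}
    (hV : ∀ t : ℝ, 0 < t → ∀ (e : E), ∀ v ∈ V e,
      g.norm (mfderiv (𝓡 k) (𝓡 k) (Ψ (σ t)) e v) ≤ C * lam ^ t * g.norm v)
    {C' lam' : ℝ} (hCC : C ≤ C') (hC' : 0 ≤ C') (hll : lam ^ c ≤ lam')
    {l : ℕ} (hl : 0 < l) {t : ℝ} (ht : l * c ≤ t) (e : E) (v : TangentSpace (𝓡 k) e)
    (hv : v ∈ V e) :
    g.norm (mfderiv (𝓡 k) (𝓡 k) (Ψ (σ t)) e v) ≤ C' * lam' ^ l * g.norm v := by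
  have hn : 0 ≤ g.norm v := Real.sqrt_nonneg _
  have hl' : (0 : ℝ) < l := Nat.cast_pos.2 hl
  refine (hV t ((mul_pos hl' hc).trans_le ht) e v hv).trans ?_
  -- `l` returns take time at least `l * c`, and powers of `lam < 1` decrease with the exponent.
  have h2 : lam ^ t ≤ lam' ^ l := by
    calc lam ^ t ≤ lam ^ (c * l) :=
          Real.rpow_le_rpow_of_exponent_ge hlam hlam'.le (by linarith)
      _ = (lam ^ c) ^ l := by rw [Real.rpow_mul hlam.le, Real.rpow_natCast]
      _ ≤ lam' ^ l := pow_le_pow_left₀ (Real.rpow_nonneg hlam.le _) hll l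
  gcongr

/-- The return map of a fiberwise Anosov flow over the suspension of an Anosov diffeomorphism is
an Anosov diffeomorphism. -/
theorem isAnosovDiffeo_return_map {d : ℕ} [IsManifold (𝓡 n) ∞ N] [CompactSpace N]
    [IsManifold (𝓡 m) ∞ M] [T2Space M] [IsManifold (𝓡 k) ∞ E]
    [IsManifold (𝓡 j) ∞ (proj ⁻¹' Set.range S.crossSection)]
    [CompactSpace (proj ⁻¹' Set.range S.crossSection)]
    {fhat : (proj ⁻¹' Set.range S.crossSection) ≃ₘ^∞⟮𝓡 j, 𝓡 j⟯
      (proj ⁻¹' Set.range S.crossSection)}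
    (hX : IsSmoothSubmanifold j k (proj ⁻¹' Set.range S.crossSection))
    (hproj : ContMDiff (𝓡 k) (𝓡 m) ∞ proj)
    (hΨ : IsFiberwiseAnosovFlow (m := m) (k := k) proj φ Ψ) (hf : IsAnosovDiffeo f)
    (hp : ∀ e, S.crossSection (p e) = proj e)
    (hpb : IsAffineTorusBundle (m := n) (k := j) d p)
    (hfhat : ∀ x, (fhat x : E) = Ψ (r (p x)) x) : IsAnosovDiffeo fhat := by
  obtain ⟨hs, hΨφ, gE, Vs, Vu, C₁, lam₁, hC₁, hlam₁, hlam₁', hdisj, hsup, hVs, hVu, hVsle,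
    hVule⟩ := hΨ
  obtain ⟨gN, Es, Eu, C₂, lam₂, hC₂, hlam₂, hlam₂', hcompl, hEs, hEu, hEsle, hEule⟩ := hf
  have hpsm := hpb.contMDiff
  have hpf := apply_return_map hΨφ hp hfhat
  obtain ⟨c, hc, hcr⟩ := exists_roof_lower_bound S
  have hiter : ∀ (l : ℤ) x, p ((fhat.toPerm ^ l) x) = (f.toPerm ^ l) (p x) := fun l x =>
    Equiv.Perm.semiconj_zpow (σ := fhat.toPerm) (σ' := f.toPerm) hpf l x
  set g := gE.pullback hX.1 hX.injective_mfderiv with hg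
  obtain ⟨K₁, hK₁, hK₁'⟩ := exists_norm_mfderiv_le g g fhat.contMDiff
  obtain ⟨K₂, hK₂, hK₂'⟩ := exists_norm_mfderiv_le g g fhat.symm.contMDiff
  obtain ⟨K₃, hK₃, hK₃'⟩ := exists_norm_mfderiv_le g gN hpsm
  obtain ⟨K₄, hK₄, hK₄'⟩ := exists_norm_lift_le g gN hpsm hpb.surjective_mfderiv
  set K := K₁ + K₂ + K₃ + K₄ with hK
  set C := max 1 (max C₁ C₂)
  -- The fibre contracts by `lam₁ ^ c` per return and the base by `lam₂` per iterate of `f`.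
  set lam := max (lam₁ ^ c) lam₂
  have hC : 1 ≤ C := le_max_left _ _
  have hC₁C : C₁ ≤ C := (le_max_left _ _).trans (le_max_right _ _)
  have hC₂C : C₂ ≤ C := (le_max_right _ _).trans (le_max_right _ _)
  have hlam1 : lam₁ ^ c ≤ lam := le_max_left _ _
  have hlam2 : lam₂ ≤ lam := le_max_right _ _
  have hlam : 0 < lam := hlam₂.trans_le hlam2
  have hlam' : lam < 1 := max_lt (Real.rpow_lt_one hlam₁.le hlam₁' hc) hlam₂'
  have hlamk : ∀ l : ℕ, C₂ * lam₂ ^ l ≤ C * lam ^ l := fun l => by gcongr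
  have hker : ∀ x (v : EuclideanSpace ℝ (Fin j)), v ∈ tangentPart Vs x ⊔ tangentPart Vu x →
      mfderiv (𝓡 j) (𝓡 n) p x v = 0 := fun x v hv => by
    rw [tangentPart_sup hX hproj hs hΨφ hp hpsm hsup] at hv
    exact hv
  have hinv : ∀ (V : ∀ e : E, Submodule ℝ (TangentSpace (𝓡 k) e)),
      (∀ t e, (V e).map (mfderiv (𝓡 k) (𝓡 k) (Ψ t) e).toLinearMap = V (Ψ t e)) →
      (∀ x (v : EuclideanSpace ℝ (Fin j)), v ∈ tangentPart V x →
        mfderiv (𝓡 j) (𝓡 n) p x v = 0) →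
      ∀ (l : ℤ) x (v : EuclideanSpace ℝ (Fin j)), v ∈ tangentPart V x →
        fhat.cocycle l x v ∈ tangentPart V ((fhat.toPerm ^ l) x) := by
    intro V hV hVk l x v hv
    obtain ⟨l, rfl | rfl⟩ := l.eq_nat_or_neg
    · obtain ⟨τ, hτ, -, hτΨ⟩ := exists_return_time hΨφ hp hfhat hcr l
      exact mem_tangentPart_of_flow hX hs hpsm hV hτ (fhat.contMDiff_toPerm_zpow _) hτΨ x v
        (hVk x v hv) hv
    · obtain ⟨τ, hτ, -, hτΨ⟩ := exists_return_time_neg hΨφ hp hfhat hcr l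
      exact mem_tangentPart_of_flow hX hs hpsm hV hτ.neg (fhat.contMDiff_toPerm_zpow _) hτΨ x v
        (hVk x v hv) hv
  have hVs0 : ∀ x (v : EuclideanSpace ℝ (Fin j)), v ∈ tangentPart Vs x →
      mfderiv (𝓡 j) (𝓡 n) p x v = 0 := fun x v hv => hker x v (Submodule.mem_sup_left hv)
  have hVu0 : ∀ x (v : EuclideanSpace ℝ (Fin j)), v ∈ tangentPart Vu x →
      mfderiv (𝓡 j) (𝓡 n) p x v = 0 := fun x v hv => hker x v (Submodule.mem_sup_right hv)
  have hle0 : ∀ x (v : EuclideanSpace ℝ (Fin j)), g.seminorm x v ≤ C * lam ^ 0 * g.seminorm x v :=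
    fun x v => by
      rw [pow_zero, mul_one]
      exact le_mul_of_one_le_left (apply_nonneg _ _) hC
  have hVs1 : ∀ (l : ℕ) x (v : EuclideanSpace ℝ (Fin j)), v ∈ tangentPart Vs x →
      g.seminorm ((fhat.toPerm ^ (l : ℤ)) x) (fhat.cocycle l x v) ≤
        C * lam ^ l * g.seminorm x v := by
    intro l x v hv
    -- The flow estimates hold only for positive times. The case `l = 0` rests on `C ≥ 1`, which is
    -- why 1 enters the definition of `C`.
    rcases Nat.eq_zero_or_pos l with rfl | hl
    · rw [Nat.cast_zero, fhat.cocycle_zero]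
      exact hle0 x v
    · obtain ⟨τ, hτ, hτc, hτΨ⟩ := exists_return_time hΨφ hp hfhat hcr l
      have h1 := flow_norm_le (Ψ := Ψ) (σ := id) hlam₁ hlam₁' hc
        hVsle hC₁C (zero_le_one.trans hC) hlam1 hl
        (hτc (p x)) x _ hv
      exact (seminorm_flow_eq gE hX hs hpsm hτ (fhat.contMDiff_toPerm_zpow _) hτΨ x v
        (hVs0 x v hv)).trans_le h1
  have hVu1 : ∀ (l : ℕ) x (v : EuclideanSpace ℝ (Fin j)), v ∈ tangentPart Vu x →
      g.seminorm ((fhat.toPerm ^ (-l : ℤ)) x) (fhat.cocycle (-l) x v) ≤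
        C * lam ^ l * g.seminorm x v := by
    intro l x v hv
    rcases Nat.eq_zero_or_pos l with rfl | hl
    · rw [Nat.cast_zero, neg_zero, fhat.cocycle_zero]
      exact hle0 x v
    · obtain ⟨τ, hτ, hτc, hτΨ⟩ := exists_return_time_neg hΨφ hp hfhat hcr l
      have h1 := flow_norm_le (Ψ := Ψ) (σ := Neg.neg) hlam₁ hlam₁' hc
        hVule hC₁C (zero_le_one.trans hC) hlam1 hl
        (hτc (p x)) x _ hv
      exact (seminorm_flow_eq gE hX hs hpsm hτ.neg (fhat.contMDiff_toPerm_zpow _) hτΨ x v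
        (hVu0 x v hv)).trans_le h1
  let H : HyperbolicExtension (proj ⁻¹' Set.range S.crossSection) (EuclideanSpace ℝ (Fin j))
      (EuclideanSpace ℝ (Fin n)) :=
    { F := fhat.toPerm
      c := fhat.cocycle
      -- The base cocycle is pulled back along `p`, so that fibre and base data share the index set
      -- `N̂`; `p` intertwines the return map with `f`.
      b := fun l x => f.cocycle l (p x)
      P := fun x => (mfderiv (𝓡 j) (𝓡 n) p x).toLinearMap
      nu := fun x => g.seminorm x
      nu' := fun x => gN.seminorm (p x)
      Vs := tangentPart Vs
      Vu := tangentPart Vu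
      Es := fun x => Es (p x)
      Eu := fun x => Eu (p x)
      K := K
      C := C
      lam := lam
      c_zero := fhat.cocycle_zero
      c_add := fhat.cocycle_add
      P_c := by
        intro l x v
        have h1 := mfderiv_comp x ((hpsm ((fhat.toPerm ^ l) x)).mdifferentiableAt (by simp))
          ((fhat.contMDiff_toPerm_zpow l x).mdifferentiableAt (by simp))
        have h2 := mfderiv_comp x ((f.contMDiff_toPerm_zpow l (p x)).mdifferentiableAt (by simp))
          ((hpsm x).mdifferentiableAt (by simp))
        have h3 : p ∘ ⇑(fhat.toPerm ^ l) = ⇑(f.toPerm ^ l) ∘ p := funext (hiter l)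
        rw [h3] at h1
        exact (DFunLike.congr_fun h1 v).symm.trans (DFunLike.congr_fun h2 v)
      norm_le := fun x => (g.exists_norm_bounds x).1
      le_norm := fun x => (g.exists_norm_bounds x).2
      eq_zero := fun x w h => gN.norm_eq_zero ((gN.seminorm_apply _).symm.trans h)
      one_le_K := by linarith
      c_le := by
        intro x v
        refine (?_ : _ ≤ K₁ * g.seminorm x v).trans
          (mul_le_mul_of_nonneg_right (by linarith) (apply_nonneg _ _))
        exact (RiemMetric.seminorm_apply _ _).trans_le ((hK₁' x v).trans_eq
          (congrArg (K₁ * ·) (g.seminorm_apply _).symm))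
      c_le' := by
        intro x v
        refine (?_ : _ ≤ K₂ * g.seminorm x v).trans
          (mul_le_mul_of_nonneg_right (by linarith) (apply_nonneg _ _))
        exact (RiemMetric.seminorm_apply _ _).trans_le ((hK₂' x v).trans_eq
          (congrArg (K₂ * ·) (g.seminorm_apply _).symm))
      P_le := by
        intro x v
        refine (?_ : _ ≤ K₃ * g.seminorm x v).trans
          (mul_le_mul_of_nonneg_right (by linarith) (apply_nonneg _ _))
        exact (RiemMetric.seminorm_apply _ _).trans_le ((hK₃' x v).trans_eq
          (congrArg (K₃ * ·) (g.seminorm_apply _).symm))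
      lift := by
        intro x w
        obtain ⟨v, hv, hvw⟩ := hK₄' x w
        refine ⟨v, hv, ?_⟩
        refine (?_ : _ ≤ K₄ * gN.seminorm (p x) w).trans
          (mul_le_mul_of_nonneg_right (by linarith) (apply_nonneg _ _))
        exact (g.seminorm_apply _).trans_le (hvw.trans_eq
          (congrArg (K₄ * ·) (gN.seminorm_apply _).symm))
      C_pos := zero_lt_one.trans_le hC
      lam_pos := hlam
      lam_lt := hlam'
      disj := tangentPart_disjoint hX hdisj
      sup_eq := tangentPart_sup hX hproj hs hΨφ hp hpsm hsup
      Vs_inv := hinv Vs hVs hVs0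
      Vu_inv := hinv Vu hVu hVu0
      Vs_le := hVs1
      Vu_le := hVu1
      isCompl := fun x => hcompl (p x)
      Es_inv := fun l x v hv => by
        rw [hiter]
        exact f.cocycle_mem hEs l (p x) v hv
      Eu_inv := fun l x v hv => by
        rw [hiter]
        exact f.cocycle_mem hEu l (p x) v hv
      Es_le := fun l x v hv => by
        rw [hiter, f.seminorm_cocycle_natCast gN]
        exact (hEsle l (p x) v hv).trans
          (mul_le_mul_of_nonneg_right (hlamk l) (Real.sqrt_nonneg _))
      Eu_le := fun l x v hv => by
        rw [hiter, f.seminorm_cocycle_neg gN]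
        exact (hEule l (p x) v hv).trans
          (mul_le_mul_of_nonneg_right (hlamk l) (Real.sqrt_nonneg _)) }
  obtain ⟨Ws, Wu, C', μ, hC', hμ, hμ', h1, h2, h3, h4, h5⟩ := H.isHyperbolic
  refine ⟨g, Ws, Wu, C', μ, hC', hμ, hμ', h1, h2, h3, fun l x v hv => ?_, fun l x v hv => ?_⟩
  · exact (fhat.seminorm_cocycle_natCast g l x v).symm.trans_le (h4 l x v hv)
  · exact (fhat.seminorm_cocycle_neg g l x v).symm.trans_le (h5 l x v hv)

end ReturnMap

/-! ### The theorem -/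

theorem proposition2p10 {n m d : ℕ} {N M E : Type*}
    [TopologicalSpace N] [ChartedSpace (EuclideanSpace ℝ (Fin n)) N] [IsManifold (𝓡 n) ∞ N]
    [CompactSpace N] [T2Space N]
    [TopologicalSpace M] [ChartedSpace (EuclideanSpace ℝ (Fin m)) M] [IsManifold (𝓡 m) ∞ M]
    [CompactSpace M] [T2Space M]
    [TopologicalSpace E] [ChartedSpace (EuclideanSpace ℝ (Fin (m + d))) E]
    [IsManifold (𝓡 (m + d)) ∞ E] [CompactSpace E] [T2Space E]
    (proj : E → M) (hproj : IsAffineTorusBundle (m := m) (k := m + d) d proj)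
    (φ : Flow ℝ M) (hφ : IsAnosovFlow (m := m) φ)
    (Φ : Flow ℝ E) (hΦ : IsFiberwiseAnosovFlow (m := m) (k := m + d) proj φ Φ)
    (f : N ≃ₘ^∞⟮𝓡 n, 𝓡 n⟯ N) (hf : IsAnosovDiffeo f)
    (r : N → ℝ) (S : SuspensionPresentation (m := m) φ f r) :
    -- a smooth structure on `N̂ = π⁻¹(N)` that makes it a submanifold of `E`
    ∃ (_ : ChartedSpace (EuclideanSpace ℝ (Fin (n + d))) (proj ⁻¹' Set.range S.crossSection))
      (_ : IsManifold (𝓡 (n + d)) ∞ (proj ⁻¹' Set.range S.crossSection)),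
      ContMDiff (𝓡 (n + d)) (𝓡 (m + d)) ∞
        (Subtype.val : (proj ⁻¹' Set.range S.crossSection) → E) ∧
      (∀ e : (proj ⁻¹' Set.range S.crossSection), Function.Injective
        (mfderiv (𝓡 (n + d)) (𝓡 (m + d))
          (Subtype.val : (proj ⁻¹' Set.range S.crossSection) → E) e)) ∧
      -- the restriction `p : N̂ → N` of `proj` (written in `N`) is an affine torus bundle
      ∃ p : (proj ⁻¹' Set.range S.crossSection) → N,
        (∀ e, S.crossSection (p e) = proj e) ∧
        IsAffineTorusBundle (m := n) (k := n + d) d p ∧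
        -- `Φ` is the suspension of an Anosov diffeomorphism of its cross-section `N̂`
        ∃ fhat : (proj ⁻¹' Set.range S.crossSection) ≃ₘ^∞⟮𝓡 (n + d), 𝓡 (n + d)⟯
            (proj ⁻¹' Set.range S.crossSection),
          IsAnosovDiffeo fhat ∧
          ∃ Shat : SuspensionPresentation (m := m + d) Φ fhat (fun e => r (p e)),
            ∀ e, Shat.crossSection e = (e : E) := by
  have hps := hproj.contMDiff
  obtain ⟨cs, hcs, hX⟩ := exists_submanifold_structure (S.nonempty_localParametrization hproj)
  have hX : IsSmoothSubmanifold (n + d) (m + d) (proj ⁻¹' Set.range S.crossSection) := hX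
  obtain ⟨hs, hΨ, -⟩ := id hΦ
  -- Membership in the preimage supplies a point of `N`, unique because the cross-section is
  -- injective; the choice is therefore canonical and turns out smooth.
  choose p hp using fun e : proj ⁻¹' Set.range S.crossSection => e.2
  have hpsm := contMDiff_of_crossSection_eq hX hps hp
  have hpb : IsAffineTorusBundle (m := n) (k := n + d) d p :=
    hproj.restrictRange hX S.contMDiff_crossSection S.crossSection_injective hp hpsm
      (surjective_of_crossSection_eq hproj.surjective hp)
  have hcompact : CompactSpace (proj ⁻¹' Set.range S.crossSection) :=
    isCompact_iff_compactSpace.1 (((isCompact_range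
      S.contMDiff_crossSection.continuous).isClosed.preimage hps.continuous).isCompact)
  obtain ⟨fhat, hfhat⟩ := exists_return_map hX hs hΨ hp hpsm
  exact ⟨cs, hcs, hX.1, hX.injective_mfderiv, p, hp, hpb, fhat,
    isAnosovDiffeo_return_map hX hps hΦ hf hp hpb hfhat,
    exists_suspensionPresentation hX hps hs hΨ hp hpsm hfhat⟩
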